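/- **Setting.** Let $p$ be a prime, $a\ge 1$, $q=p^a$, $n\ge 1$ and $k\ge 0$ integers, with $\gcd(n+1,p)=1$. Fix a root $\gamma\in\overline{\mathbb Q}_p$ of $\sum_{j\ge 0}T^{p^j}/p^j$ with $\operatorname{ord}_p\gamma=1/(p-1)$ and a $q$-th root $\tilde\gamma=\gamma^{1/q}$; let $\mathbb Q_q$ be the unramified extension of $\mathbb Q_p$ of degree $a$, let $\mathcal O_q$ be the ring of integers of $\mathbb Q_q(\tilde\gamma)$, and let $\gamma_i=\sum_{j=0}^{i}\gamma^{p^j}/p^j$. Let $$\mathcal O=\Big\{\sum_{r\ge0}a(r)\gamma^{(n+1)r}t^r \;:\; a(r)\in\mathcal O_q,\ a(r)\to0\Big\},$$ with the norm $\big|\sum_r a(r)\gamma^{(n+1)r}t^r\big|=\sup_r|a(r)|$. For $u\in\mathbb Z^n$ put $m(u)=\max\{0,-u_1,\dots,-u_n\}$ and $w(u)=u_1+\cdots+u_n+(n+1)m(u)\ge 0$, and let $$\mathcal C=\Big\{\sum_{u\in\mathbb Z^n}\xi(u)\gamma^{w(u)}t^{m(u)}x^u \;:\; \xi(u)\in\mathcal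 O,\ \xi(u)\to0\text{ as }w(u)\to\infty\Big\}.$$ With $K(t,x)=x_1+\cdots+x_n+\dfrac{t}{x_1\cdots x_n}$ and $H=\sum_{i\ge0}\gamma_iK(t^{p^i},x^{p^i})$, let $$D_{t,l}=x_l\frac{\partial}{\partial x_l}+x_l\frac{\partial H}{\partial x_l}\quad(1\le l\le n),\qquad \partial=t\frac{\partial}{\partial t}+t\frac{\partial H}{\partial t}.$$ These operators act on $\mathcal C$ and commute; the $D_{t,l}$ are $\mathcal O$-linear. Let $H^n=\mathcal C/\sum_{l}D_{t,l}\,\mathcal C$ be the top cohomology of the Koszul complex of $D_{t,1},\dots,D_{t,n}$ on $\mathcal C$, an $\mathcal O$-module with the connection induced by $\partial$ (over $t\,d/dt$ on $\mathcal O$), and let $e_0=1$ and $e_j=\gamma^jx_1\cdots x_j$ $(1\le j\le n)$ in $H^n$. Let $\mathcal S_k=\operatorname{Sym}^k_{\mathcal O}H^n$, and extend $\partial$ to $\mathcal S_k$ by the Leibniz rule. Put $$H^0(\mathcal S_k,\partial)=\ker(\partial\mid\mathcal S_k),\qquad H^1(\mathcal S_k,\partial)=\mathcal S_k/\partial\mathcal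 S_k .$$ Let $I_k$ be the set of $\underline i=(i_0,\dots,i_n)\in\mathbb Z_{\ge0}^{n+1}$ with $i_0+\cdots+i_n=k$. For $\underline i\in I_k$ put $e^{\underline i}=e_0^{i_0}\cdots e_n^{i_n}\in\mathcal S_k$ and $w(\underline i)=\sum_j j\,i_j$. For an integer $N\ge 0$ let $\operatorname{Fil}^N\mathcal S_k$ be the $\mathcal O_q$-submodule generated by the $\gamma^{(n+1)r}t^re^{\underline i}$ with $r\ge0$, $\underline i\in I_k$ and $(n+1)r+w(\underline i)\le N$. Let $\zeta$ be a primitive $(n+1)$-th root of unity in $\overline{\mathbb F}_p$ and $$d_k(n,p)=\#\Big\{\underline i\in I_k \;:\; \sum_{j=0}^n i_j\zeta^j=0\text{ in }\overline{\mathbb F}_p\Big\}.$$ Let $\overline{\mathcal S}_k$ be the $k$-th symmetric power of the free $\mathbb F_q[t]$-module on $\bar e_0,\dots,\bar e_n$, and let $\nabla$ be the $\mathbb F_q[t]$-linear map on $\overline{\mathcal S}_k$ which extends $\bar e_j\mapsto\bar e_{j+1}$ $(0\le j<n)$, $\bar e_n\mapsto t\bar e_0$ by the Leibniz rule. Call a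 subset $B\subseteq I_k$ a *constant basis* if the classes of $\bar e^{\underline i}=\bar e_0^{i_0}\cdots\bar e_n^{i_n}$, $\underline i\in B$, form an $\mathbb F_q$-basis of $\overline{\mathcal S}_k/\nabla\overline{\mathcal S}_k$. **Theorem.** Assume $d_k(n,p)=0$. Then $H^0(\mathcal S_k,\partial)=0$. A constant basis exists, and for every constant basis $B_k$ the following hold. 1. $H^1(\mathcal S_k,\partial)$ is a free $\mathcal O_q$-module of rank $\frac{1}{n+1}\binom{n+k}{n}$, and the classes of $e^{\underline i}$, $\underline i\in B_k$, form a basis of it. 2. For every $N\ge0$ and every $\xi\in\operatorname{Fil}^N\mathcal S_k$ there are $C(\underline i,\xi)\in\mathcal O_q$ $(\underline i\in B_k)$ with $$\xi\equiv\sum_{\underline i\in B_k}C(\underline i,\xi)\,e^{\underline i}\pmod{\partial\mathcal S_k},\qquad \operatorname{ord}_pC(\underline i,\xi)\ge w(\underline i)-N .$$ -/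

import Mathlib

set_option linter.unusedSectionVars false

namespace HyperKloosterman

noncomputable section

/-! ### Symmetric powers and the Leibniz extension of a connection -/

section Sym

variable (R M : Type*) [CommRing R] [AddCommGroup M] [Module R M]

/-- `Sym^k_R M`, realised as the degree `k` part of the symmetric algebra of `M`. -/
def SymPow (k : ℕ) : Submodule R (SymmetricAlgebra R M) :=
  LinearMap.range (SymmetricAlgebra.ι R M) ^ k

variable {R M}

/-- Ring homomorphisms out of the symmetric algebra, over a ring homomorphism out of `R`. -/
def symLiftRing {B : Type*} [CommRing B] (φ : R →+* B) (f : M →+ B)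
    (hf : ∀ (r : R) (m : M), f (r • m) = φ r * f m) : SymmetricAlgebra R M →+* B :=
  letI : Algebra R B := φ.toAlgebra
  (SymmetricAlgebra.lift (R := R) (M := M) (A := B)
    { f with map_smul' := fun r m => (hf r m).trans (Algebra.smul_def r (f m)).symm }).toRingHom

theorem symLiftRing_ι {B : Type*} [CommRing B] (φ : R →+* B) (f : M →+ B)
    (hf : ∀ (r : R) (m : M), f (r • m) = φ r * f m) (m : M) :
    symLiftRing φ f hf (SymmetricAlgebra.ι R M m) = f m := by
  let _ : Algebra R B := φ.toAlgebra
  exact SymmetricAlgebra.lift_ι_apply _ m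

theorem symLiftRing_algebraMap {B : Type*} [CommRing B] (φ : R →+* B) (f : M →+ B)
    (hf : ∀ (r : R) (m : M), f (r • m) = φ r * f m) (r : R) :
    symLiftRing φ f hf (algebraMap R _ r) = φ r := by
  let _ : Algebra R B := φ.toAlgebra
  exact AlgHom.commutes (SymmetricAlgebra.lift (R := R) (M := M) (A := B)
    { f with map_smul' := fun r m => (hf r m).trans (Algebra.smul_def r (f m)).symm }) r

variable {S : Type*} [CommRing S] [Algebra S R] [Module S M] [IsScalarTower S R M]

/-- `r ↦ g r + ε d r` as a ring homomorphism, for `d` a derivation along `g`. -/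
def dualRingHom {A : Type*} [CommRing A] (g : R →+* A) (d : R →+ A) (h1 : d 1 = 0)
    (hd : ∀ a b, d (a * b) = g a * d b + g b * d a) : R →+* TrivSqZeroExt A A where
  toFun r := TrivSqZeroExt.inl (g r) + TrivSqZeroExt.inr (d r)
  map_one' := by ext <;> simp [h1]
  map_mul' a b := by ext <;> simp [hd, mul_comm]
  map_zero' := by ext <;> simp
  map_add' a b := by ext <;> simp

/-- `m ↦ f m + ε d m` as an additive map. -/
def dualAddHom {A : Type*} [CommRing A] (f d : M →+ A) : M →+ TrivSqZeroExt A A where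
  toFun m := TrivSqZeroExt.inl (f m) + TrivSqZeroExt.inr (d m)
  map_zero' := by ext <;> simp
  map_add' a b := by ext <;> simp

theorem dual_smul {A : Type*} [CommRing A] (g : R →+* A) (d : R →+ A) (h1 : d 1 = 0)
    (hd : ∀ a b, d (a * b) = g a * d b + g b * d a) (f d' : M →+ A)
    (hf : ∀ (r : R) (m : M), f (r • m) = g r * f m)
    (hd' : ∀ (r : R) (m : M), d' (r • m) = d r * f m + g r * d' m) (r : R) (m : M) :
    dualAddHom f d' (r • m) = dualRingHom g d h1 hd r * dualAddHom f d' m := by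
  ext
  · simp [dualAddHom, dualRingHom, hf]
  · simp [dualAddHom, dualRingHom, hd', mul_comm, add_comm]

/-- The ring homomorphism `a ↦ a + ε ∂a` from the symmetric algebra to dual numbers over it. -/
def symDual (δ : Derivation S R R) (nabla : M →ₗ[S] M)
    (h : ∀ (r : R) (m : M), nabla (r • m) = δ r • m + r • nabla m) :
    SymmetricAlgebra R M →+*
      TrivSqZeroExt (SymmetricAlgebra R M) (SymmetricAlgebra R M) :=
  symLiftRing
    (dualRingHom (algebraMap R (SymmetricAlgebra R M))
      ((algebraMap R (SymmetricAlgebra R M)).toAddMonoidHom.comp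
        (δ : R →ₗ[S] R).toAddMonoidHom)
      (by simp)
      (fun a b => by
        change algebraMap R (SymmetricAlgebra R M) (δ (a * b)) = _ * algebraMap R _ (δ b) +
          _ * algebraMap R _ (δ a)
        rw [Derivation.leibniz, map_add, smul_eq_mul, smul_eq_mul, map_mul, map_mul]))
    (dualAddHom (SymmetricAlgebra.ι R M).toAddMonoidHom
      ((SymmetricAlgebra.ι R M).toAddMonoidHom.comp nabla.toAddMonoidHom))
    (dual_smul _ _ _ _ _ _
      (fun r m => by
        change SymmetricAlgebra.ι R M (r • m) = _ * SymmetricAlgebra.ι R M m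
        rw [map_smul, Algebra.smul_def])
      (fun r m => by
        change SymmetricAlgebra.ι R M (nabla (r • m)) =
          algebraMap R _ (δ r) * SymmetricAlgebra.ι R M m +
            algebraMap R _ r * SymmetricAlgebra.ι R M (nabla m)
        rw [h, map_add, map_smul, map_smul, Algebra.smul_def, Algebra.smul_def]))

theorem symDual_algebraMap (δ : Derivation S R R) (nabla : M →ₗ[S] M)
    (h : ∀ (r : R) (m : M), nabla (r • m) = δ r • m + r • nabla m) (r : R) :
    symDual δ nabla h (algebraMap R _ r) =
      TrivSqZeroExt.inl (algebraMap R _ r) + TrivSqZeroExt.inr (algebraMap R _ (δ r)) :=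
  symLiftRing_algebraMap _ _ _ r

theorem symDual_ι (δ : Derivation S R R) (nabla : M →ₗ[S] M)
    (h : ∀ (r : R) (m : M), nabla (r • m) = δ r • m + r • nabla m) (m : M) :
    symDual δ nabla h (SymmetricAlgebra.ι R M m) =
      TrivSqZeroExt.inl (SymmetricAlgebra.ι R M m) +
        TrivSqZeroExt.inr (SymmetricAlgebra.ι R M (nabla m)) :=
  symLiftRing_ι _ _ _ m

variable (δ : Derivation S R R) (nabla : M →ₗ[S] M)
    (h : ∀ (r : R) (m : M), nabla (r • m) = δ r • m + r • nabla m)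

theorem symDual_fst (a : SymmetricAlgebra R M) : (symDual δ nabla h a).fst = a := by
  induction a using SymmetricAlgebra.induction with
  | algebraMap r => rw [symDual_algebraMap, TrivSqZeroExt.fst_add, TrivSqZeroExt.fst_inl, TrivSqZeroExt.fst_inr, add_zero]
  | ι m => rw [symDual_ι, TrivSqZeroExt.fst_add, TrivSqZeroExt.fst_inl, TrivSqZeroExt.fst_inr, add_zero]
  | mul a b ha hb => rw [map_mul, TrivSqZeroExt.fst_mul, ha, hb]
  | add a b ha hb => rw [map_add, TrivSqZeroExt.fst_add, ha, hb]

/-- The Leibniz extension of a connection `nabla` on `M` (over the derivation `δ` of `R`) to the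
symmetric algebra: it is additive, equals `δ` on `R` and `nabla` on `M`, and satisfies
`∂(ab) = a ∂b + b ∂a`; see the lemmas below. -/
def symDeriv : SymmetricAlgebra R M →+ SymmetricAlgebra R M where
  toFun a := (symDual δ nabla h a).snd
  map_zero' := by simp
  map_add' a b := by simp

theorem symDeriv_algebraMap (r : R) :
    symDeriv δ nabla h (algebraMap R _ r) = algebraMap R _ (δ r) := by
  change (symDual δ nabla h _).snd = _
  rw [symDual_algebraMap, TrivSqZeroExt.snd_add, TrivSqZeroExt.snd_inl, TrivSqZeroExt.snd_inr, zero_add]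

theorem symDeriv_ι (m : M) :
    symDeriv δ nabla h (SymmetricAlgebra.ι R M m) = SymmetricAlgebra.ι R M (nabla m) := by
  change (symDual δ nabla h _).snd = _
  rw [symDual_ι, TrivSqZeroExt.snd_add, TrivSqZeroExt.snd_inl, TrivSqZeroExt.snd_inr, zero_add]

theorem symDeriv_mul (a b : SymmetricAlgebra R M) :
    symDeriv δ nabla h (a * b) = a * symDeriv δ nabla h b + b * symDeriv δ nabla h a := by
  change (symDual δ nabla h _).snd = _
  rw [map_mul, TrivSqZeroExt.snd_mul, symDual_fst, symDual_fst, smul_eq_mul,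
    op_smul_eq_smul, smul_eq_mul]
  rfl

theorem symDeriv_mem {k : ℕ} {x : SymmetricAlgebra R M} (hx : x ∈ SymPow R M k) :
    symDeriv δ nabla h x ∈ SymPow R M k := by
  unfold SymPow at *
  induction hx using Submodule.pow_induction_on_left' with
  | algebraMap r =>
    rw [symDeriv_algebraMap, pow_zero, Submodule.one_eq_range]
    exact ⟨δ r, rfl⟩
  | add x y i hx hy ihx ihy => rw [map_add]; exact add_mem ihx ihy
  | mem_mul m hm i x hx ih =>
    obtain ⟨m, rfl⟩ := hm
    rw [symDeriv_mul, symDeriv_ι, mul_comm x, pow_succ']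
    exact add_mem (Submodule.mul_mem_mul ⟨m, rfl⟩ ih) (Submodule.mul_mem_mul ⟨_, rfl⟩ hx)

theorem symDeriv_smul (c : S) (x : SymmetricAlgebra R M) :
    symDeriv δ nabla h (c • x) = c • symDeriv δ nabla h x := by
  rw [← algebraMap_smul R c x, Algebra.smul_def, symDeriv_mul, symDeriv_algebraMap,
    Derivation.map_algebraMap, map_zero, mul_zero, add_zero, ← Algebra.smul_def, algebraMap_smul]

/-- The induced connection `∂` on `Sym^k_R M`. -/
def symConn (k : ℕ) : SymPow R M k →ₗ[S] SymPow R M k where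
  toFun x := ⟨symDeriv δ nabla h x, symDeriv_mem δ nabla h x.2⟩
  map_add' x y := Subtype.ext (map_add (symDeriv δ nabla h) (x : SymmetricAlgebra R M) y)
  map_smul' c x := Subtype.ext (symDeriv_smul δ nabla h c x)

end Sym

/-- Multi-indices `i = (i_0, …, i_n)` with `i_0 + ⋯ + i_n = k`. -/
abbrev SymIdx (n k : ℕ) : Type := {i : Fin (n + 1) → ℕ // ∑ j, i j = k}

/-- The weight `w(i) = 0·i_0 + 1·i_1 + ⋯ + n·i_n`. -/
def SymIdx.weight {n k : ℕ} (i : SymIdx n k) : ℕ := ∑ j : Fin (n + 1), (j : ℕ) * i.1 j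

theorem prod_ι_mem {R M : Type*} [CommRing R] [AddCommGroup M] [Module R M] {J : Type*}
    (e : J → M) (i : J → ℕ) (s : Finset J) :
    ∏ j ∈ s, SymmetricAlgebra.ι R M (e j) ^ i j ∈ SymPow R M (∑ j ∈ s, i j) := by
  classical
  unfold SymPow
  induction s using Finset.induction_on with
  | empty =>
    rw [Finset.prod_empty, Finset.sum_empty, pow_zero]
    exact Submodule.one_le.1 le_rfl
  | insert j s hj ih =>
    rw [Finset.prod_insert hj, Finset.sum_insert hj, pow_add]
    exact Submodule.mul_mem_mul (Submodule.pow_mem_pow _ (LinearMap.mem_range_self _ (e j)) _) ih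

/-- The monomial `e^i = e_0^{i_0} ⋯ e_n^{i_n}` in `Sym^k_R M`. -/
def symMonomial {R M : Type*} [CommRing R] [AddCommGroup M] [Module R M] {n k : ℕ}
    (e : Fin (n + 1) → M) (i : SymIdx n k) : SymPow R M k :=
  ⟨∏ j, SymmetricAlgebra.ι R M (e j) ^ i.1 j, by
    have h := prod_ι_mem (R := R) e i.1 Finset.univ
    rwa [i.2] at h⟩

section Instances

variable (S R M : Type*) [CommRing S] [CommRing R] [Algebra S R] [AddCommGroup M] [Module R M]
  [Module S M] [IsScalarTower S R M] (k : ℕ)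

instance : AddCommGroup (SymPow R M k) := (SymPow R M k).addCommGroup
instance : Module R (SymPow R M k) := (SymPow R M k).module
instance : SMul R (SymPow R M k) := (SymPow R M k).module.toSMul
instance : Module S (SymPow R M k) := (SymPow R M k).module'
instance : SMul S (SymPow R M k) := (SymPow R M k).module'.toSMul

end Instances

section Cohomology

variable {S V : Type*} [CommRing S] [AddCommGroup V] [Module S V] (d : V →ₗ[S] V)

/-- `H^0` of the two-term complex `V → V (dt/t)` with boundary map `d`. -/
abbrev CohZero : Submodule S V := LinearMap.ker d

/-- `H^1` of the two-term complex `V → V (dt/t)` with boundary map `d`. -/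
abbrev CohOne : Type _ := V ⧸ LinearMap.range d

end Cohomology

end

end HyperKloosterman

namespace HyperKloosterman
noncomputable section

open Filter Topology

/-- A choice of `γ̃ = γ^{1/q}` in an algebraic closure of `ℚ_p`, where `q = p^a` and `γ` is a root
of `∑_{j ≥ 0} T^{p^j} / p^j` with `ord_p γ = 1 / (p - 1)`, that is `|γ| = p^{-1/(p-1)}`. -/
structure DworkPi (p a : ℕ) [Fact p.Prime] where
  root : PadicAlgCl p
  hasSum_root : HasSum (fun j : ℕ => (root ^ p ^ a) ^ p ^ j / (p : PadicAlgCl p) ^ j) 0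
  norm_root : ‖root ^ p ^ a‖ = (p : ℝ) ^ (-(1 / ((p : ℝ) - 1)))

variable {p a : ℕ} [Fact p.Prime] (π : DworkPi p a)

namespace DworkPi

/-- The element `γ`. -/
def gamma : PadicAlgCl p := π.root ^ p ^ a

/-- The field `ℚ_q(γ^{1/q})`. The unramified extension `ℚ_q` of degree `a` of `ℚ_p` is generated
by the roots of unity of order dividing `q - 1`. -/
def baseField : IntermediateField ℚ_[p] (PadicAlgCl p) :=
  IntermediateField.adjoin ℚ_[p] ({x | x ^ (p ^ a - 1) = 1} ∪ {π.root})

/-- The ring of integers `O_q` of `ℚ_q(γ^{1/q})`. -/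
def integers : Subring (PadicAlgCl p) where
  carrier := {x | x ∈ π.baseField ∧ ‖x‖ ≤ 1}
  mul_mem' {x y} hx hy := ⟨mul_mem hx.1 hy.1, by
    rw [norm_mul]; exact mul_le_one₀ hx.2 (norm_nonneg _) hy.2⟩
  one_mem' := ⟨one_mem _, by simp⟩
  add_mem' {x y} hx hy := ⟨add_mem hx.1 hy.1,
    (IsUltrametricDist.norm_add_le_max x y).trans (max_le hx.2 hy.2)⟩
  zero_mem' := ⟨zero_mem _, by simp⟩
  neg_mem' {x} hx := ⟨neg_mem hx.1, by rw [norm_neg]; exact hx.2⟩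

instance : CommRing π.integers := π.integers.toCommRing
instance : CommSemiring π.integers := CommRing.toCommSemiring

theorem isUnit_integers_iff (x : π.integers) : IsUnit x ↔ ‖(x : PadicAlgCl p)‖ = 1 := by
  constructor
  · rintro ⟨u, rfl⟩
    have h : ((u : π.integers) : PadicAlgCl p) * ((u⁻¹ : (π.integers)ˣ) : π.integers) = 1 := by
      rw [← Subring.coe_mul, Units.mul_inv, Subring.coe_one]
    have h1 := congrArg norm h
    rw [norm_mul, norm_one] at h1
    have h2 := (u : π.integers).2.2
    have h3 := ((u⁻¹ : (π.integers)ˣ) : π.integers).2.2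
    have h4 := norm_nonneg ((u : π.integers) : PadicAlgCl p)
    nlinarith
  · intro h
    have hx : (x : PadicAlgCl p) ≠ 0 := norm_ne_zero_iff.1 (by rw [h]; exact one_ne_zero)
    refine IsUnit.of_mul_eq_one ⟨(x : PadicAlgCl p)⁻¹, inv_mem x.2.1, by rw [norm_inv, h, inv_one]⟩
      (Subtype.ext (mul_inv_cancel₀ hx))

instance : IsLocalRing π.integers :=
  IsLocalRing.of_nonunits_add fun x y hx hy => by
    rw [mem_nonunits_iff, isUnit_integers_iff] at *
    have hx' := lt_of_le_of_ne x.2.2 hx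
    have hy' := lt_of_le_of_ne y.2.2 hy
    exact ((IsUltrametricDist.norm_add_le_max (x : PadicAlgCl p) y).trans_lt (max_lt hx' hy')).ne

/-- `γ_i = ∑_{j ≤ i} γ^{p^j} / p^j`. -/
def gammaSum (i : ℕ) : PadicAlgCl p :=
  ∑ j ∈ Finset.range (i + 1), π.gamma ^ p ^ j / (p : PadicAlgCl p) ^ j

theorem norm_gamma_pow : ‖π.gamma‖ ^ (p - 1) = (p : ℝ)⁻¹ := by
  have hp := (Fact.out : p.Prime).two_le
  have h1 : ((p - 1 : ℕ) : ℝ) = (p : ℝ) - 1 := by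
    rw [Nat.cast_sub (by omega), Nat.cast_one]
  have h2 : (0 : ℝ) < (p : ℝ) - 1 := by
    rw [← h1]; exact_mod_cast (by omega : 0 < p - 1)
  rw [gamma, π.norm_root, ← Real.rpow_natCast, ← Real.rpow_mul (by positivity), h1, neg_mul,
    one_div_mul_cancel h2.ne', Real.rpow_neg_one]

theorem gamma_ne_zero : π.gamma ≠ 0 := by
  have hp := (Fact.out : p.Prime).two_le
  intro h
  have h1 := π.norm_gamma_pow
  rw [h, norm_zero, zero_pow (by omega)] at h1
  have : (p : ℝ) ≠ 0 := by exact_mod_cast (by omega : p ≠ 0)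
  exact (inv_ne_zero this) h1.symm

theorem norm_gamma_le_one : ‖π.gamma‖ ≤ 1 := by
  have hp := (Fact.out : p.Prime).two_le
  by_contra! h
  have h1 := π.norm_gamma_pow
  have h2 : 1 ≤ ‖π.gamma‖ ^ (p - 1) := one_le_pow₀ h.le
  rw [h1] at h2
  have h3 : (p : ℝ)⁻¹ < 1 := inv_lt_one_of_one_lt₀ (by exact_mod_cast (by omega : 1 < p))
  linarith

theorem gamma_mem_field : π.gamma ∈ π.baseField :=
  pow_mem (IntermediateField.subset_adjoin _ _ (Set.mem_union_right _ (Set.mem_singleton π.root))) _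

theorem gamma_mem : π.gamma ∈ π.integers := ⟨π.gamma_mem_field, π.norm_gamma_le_one⟩

/-- The coefficient `γ_i p^i` of the differentials. -/
def coef (i : ℕ) : PadicAlgCl p := π.gammaSum i * (p : PadicAlgCl p) ^ i

theorem norm_p : ‖(p : PadicAlgCl p)‖ = (p : ℝ)⁻¹ := by
  have h := PadicAlgCl.norm_extends p ((p : ℕ) : ℚ_[p])
  rw [Padic.norm_p] at h
  rw [← h]
  exact congrArg norm (map_natCast (algebraMap ℚ_[p] (PadicAlgCl p)) p).symm

theorem norm_term_le (i d : ℕ) (hd : 1 ≤ d) :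
    ‖π.gamma ^ p ^ (i + d) / (p : PadicAlgCl p) ^ (i + d)‖ * ((p : ℝ)⁻¹) ^ i ≤
      ‖π.gamma‖ ^ p ^ i * ((p : ℝ)⁻¹) ^ i := by
  have hp := (Fact.out : p.Prime).two_le
  have hp0 : (0 : ℝ) < p := by exact_mod_cast (by omega : 0 < p)
  have hG : (p - 1) * ∑ e ∈ Finset.range d, p ^ e + 1 = p ^ d := by
    have h := Nat.geomSum_eq hp d
    have hdvd : p - 1 ∣ p ^ d - 1 := by simpa using Nat.sub_dvd_pow_sub_pow p 1 d
    rw [h, Nat.mul_div_cancel' hdvd]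
    have : 0 < p ^ d := by positivity
    omega
  set G := ∑ e ∈ Finset.range d, p ^ e with hGdef
  have hGd : d ≤ G := by
    calc d = ∑ e ∈ Finset.range d, 1 := by simp
      _ ≤ G := Finset.sum_le_sum fun e _ => Nat.one_le_pow _ _ (by omega)
  have hpi : i + 1 ≤ p ^ i := Nat.lt_pow_self (by omega)
  have hexp : i + d ≤ p ^ i * G := by nlinarith
  have h1 : p ^ (i + d) = p ^ i + (p - 1) * (p ^ i * G) := by
    rw [pow_add, ← hG]; ring
  rw [norm_div, norm_pow, norm_pow, norm_p, h1, pow_add, pow_mul, norm_gamma_pow, div_eq_mul_inv,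
    ← inv_pow, inv_inv]
  have h2 : ((p : ℝ)⁻¹) ^ (p ^ i * G) * (p : ℝ) ^ (i + d) ≤ 1 := by
    rw [inv_pow, inv_mul_le_one₀ (by positivity)]
    exact pow_le_pow_right₀ (by exact_mod_cast (by omega : 1 ≤ p)) hexp
  have h3 : 0 ≤ ‖π.gamma‖ ^ p ^ i * ((p : ℝ)⁻¹) ^ i := by positivity
  calc _ = (‖π.gamma‖ ^ p ^ i * ((p : ℝ)⁻¹) ^ i) *
        (((p : ℝ)⁻¹) ^ (p ^ i * G) * (p : ℝ) ^ (i + d)) := by ring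
    _ ≤ _ := mul_le_of_le_one_right h3 h2

theorem norm_coef_le (i : ℕ) :
    ‖π.coef i‖ ≤ ‖π.gamma‖ ^ p ^ i * ((p : ℝ)⁻¹) ^ i := by
  have hp := (Fact.out : p.Prime).two_le
  have hp0 : (0 : ℝ) < p := by exact_mod_cast (by omega : 0 < p)
  set f : ℕ → PadicAlgCl p := fun j => π.gamma ^ p ^ j / (p : PadicAlgCl p) ^ j with hf
  have hs : Tendsto (fun M => ∑ j ∈ Finset.range M, f j) atTop (𝓝 0) :=
    π.hasSum_root.tendsto_sum_nat
  have ht : Tendsto (fun M => ‖π.gammaSum i - ∑ j ∈ Finset.range M, f j‖ * ((p : ℝ)⁻¹) ^ i) atTop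
      (𝓝 (‖π.gammaSum i - 0‖ * ((p : ℝ)⁻¹) ^ i)) :=
    ((tendsto_const_nhds.sub hs).norm).mul_const _
  have hb : ∀ M ≥ i + 1, ‖π.gammaSum i - ∑ j ∈ Finset.range M, f j‖ * ((p : ℝ)⁻¹) ^ i ≤
      ‖π.gamma‖ ^ p ^ i * ((p : ℝ)⁻¹) ^ i := by
    intro M hM
    have h1 : ∑ j ∈ Finset.range M, f j = π.gammaSum i + ∑ j ∈ Finset.Ico (i + 1) M, f j := by
      rw [gammaSum, Finset.sum_range_add_sum_Ico _ hM]
    have hq : 0 < ((p : ℝ)⁻¹) ^ i := by positivity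
    rw [h1, sub_add_cancel_left, norm_neg, ← le_div_iff₀ hq]
    refine IsUltrametricDist.norm_sum_le_of_forall_le_of_nonneg (by positivity) fun j hj => ?_
    rw [Finset.mem_Ico] at hj
    rw [le_div_iff₀ hq]
    have := π.norm_term_le i (j - i) (by omega)
    rwa [show i + (j - i) = j by omega] at this
  have := le_of_tendsto ht (eventually_atTop.2 ⟨i + 1, hb⟩)
  rwa [sub_zero, ← norm_p, ← norm_pow, ← norm_mul, norm_pow, norm_p] at this

theorem coef_div_mem (i : ℕ) : π.coef i / π.gamma ^ p ^ i ∈ π.integers := by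
  refine ⟨div_mem (mul_mem (sum_mem fun j _ => div_mem (pow_mem π.gamma_mem_field _)
    (pow_mem (natCast_mem _ _) _)) (pow_mem (natCast_mem _ _) _)) (pow_mem π.gamma_mem_field _), ?_⟩
  have hp := (Fact.out : p.Prime).two_le
  have hg : 0 < ‖π.gamma‖ := norm_pos_iff.2 π.gamma_ne_zero
  rw [norm_div, norm_pow, div_le_one (by positivity)]
  refine (π.norm_coef_le i).trans (mul_le_of_le_one_right (by positivity) ?_)
  exact pow_le_one₀ (by positivity) (inv_le_one_of_one_le₀ (by exact_mod_cast (by omega : 1 ≤ p)))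

theorem tendsto_coef_div : Tendsto (fun i => ‖π.coef i / π.gamma ^ p ^ i‖) atTop (𝓝 0) := by
  have hp := (Fact.out : p.Prime).two_le
  have hg : 0 < ‖π.gamma‖ := norm_pos_iff.2 π.gamma_ne_zero
  refine squeeze_zero (fun _ => norm_nonneg _) (fun i => ?_)
    (tendsto_pow_atTop_nhds_zero_of_lt_one (r := (p : ℝ)⁻¹) (by positivity)
      (inv_lt_one_of_one_lt₀ (by exact_mod_cast (by omega : 1 < p))))
  rw [norm_div, norm_pow, div_le_iff₀ (by positivity), mul_comm]
  exact π.norm_coef_le i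

end DworkPi
end
end HyperKloosterman

namespace HyperKloosterman
noncomputable section

open Filter Topology

variable {p a : ℕ} [Fact p.Prime] (π : DworkPi p a) (n : ℕ)

/-- Power series in `t` over an algebraic closure of `ℚ_p`. -/
abbrev SeriesT (p : ℕ) [Fact p.Prime] : Type := PowerSeries (PadicAlgCl p)

/-- The coefficient `a(r)` in the expansion `ξ = ∑_r a(r) γ^{(n+1) r} t^r`. -/
def normCoeff (ξ : SeriesT p) (r : ℕ) : PadicAlgCl p :=
  PowerSeries.coeff r ξ / π.gamma ^ ((n + 1) * r)

theorem normCoeff_add (ξ η : SeriesT p) (r : ℕ) :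
    normCoeff π n (ξ + η) r = normCoeff π n ξ r + normCoeff π n η r := by
  simp [normCoeff, add_div]

theorem normCoeff_mul (ξ η : SeriesT p) (r : ℕ) :
    normCoeff π n (ξ * η) r =
      ∑ x ∈ Finset.HasAntidiagonal.antidiagonal r, normCoeff π n ξ x.1 * normCoeff π n η x.2 := by
  rw [normCoeff, PowerSeries.coeff_mul, Finset.sum_div]
  refine Finset.sum_congr rfl fun x hx => ?_
  rw [Finset.HasAntidiagonal.mem_antidiagonal] at hx
  rw [normCoeff, normCoeff, ← hx, mul_add, pow_add, mul_div_mul_comm]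

theorem normCoeff_C (c : PadicAlgCl p) (r : ℕ) :
    normCoeff π n (PowerSeries.C c) r = if r = 0 then c else 0 := by
  rw [normCoeff, PowerSeries.coeff_C]
  split_ifs with h
  · simp [h]
  · simp

theorem tendsto_conv {f g : ℕ → PadicAlgCl p} (hf : ∀ i, ‖f i‖ ≤ 1) (hg : ∀ i, ‖g i‖ ≤ 1)
    (hf0 : Tendsto f atTop (𝓝 0)) (hg0 : Tendsto g atTop (𝓝 0)) :
    Tendsto (fun r => ∑ x ∈ Finset.HasAntidiagonal.antidiagonal r, f x.1 * g x.2) atTop (𝓝 0) := by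
  rw [Metric.tendsto_atTop] at *
  intro ε hε
  obtain ⟨N, hN⟩ := hf0 (ε / 2) (by positivity)
  obtain ⟨N', hN'⟩ := hg0 (ε / 2) (by positivity)
  refine ⟨N + N', fun r hr => ?_⟩
  rw [dist_zero_right]
  refine lt_of_le_of_lt ?_ (half_lt_self hε)
  refine IsUltrametricDist.norm_sum_le_of_forall_le_of_nonneg (by positivity) fun x hx => ?_
  rw [Finset.HasAntidiagonal.mem_antidiagonal] at hx
  rw [norm_mul]
  by_cases h : N ≤ x.1
  · have := (hN _ h).le
    rw [dist_zero_right] at this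
    calc _ ≤ ε / 2 * 1 := mul_le_mul this (hg _) (norm_nonneg _) (by positivity)
      _ = _ := mul_one _
  · have := (hN' x.2 (by omega)).le
    rw [dist_zero_right] at this
    calc _ ≤ 1 * (ε / 2) := mul_le_mul (hf _) this (norm_nonneg _) (by positivity)
      _ = _ := one_mul _

/-- The ring `O = {∑_r a(r) γ^{(n+1) r} t^r : a(r) ∈ O_q, a(r) → 0}`, as an `O_q`-algebra. -/
def RingO : Subalgebra π.integers (SeriesT p) where
  carrier := {ξ | (∀ r, normCoeff π n ξ r ∈ π.integers) ∧
    Tendsto (normCoeff π n ξ) atTop (𝓝 0)}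
  mul_mem' {ξ η} hξ hη := by
    constructor
    · intro r
      rw [normCoeff_mul]
      exact sum_mem fun x _ => mul_mem (hξ.1 _) (hη.1 _)
    · have := tendsto_conv (fun i => (hξ.1 i).2) (fun i => (hη.1 i).2) hξ.2 hη.2
      exact this.congr fun r => (normCoeff_mul π n ξ η r).symm
  add_mem' {ξ η} hξ hη := by
    constructor
    · intro r
      rw [normCoeff_add]
      exact add_mem (hξ.1 _) (hη.1 _)
    · have := hξ.2.add hη.2
      rw [add_zero] at this
      exact this.congr fun r => (normCoeff_add π n ξ η r).symm
  algebraMap_mem' c := by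
    rw [PowerSeries.algebraMap_apply]
    change (∀ r, normCoeff π n (PowerSeries.C (c : PadicAlgCl p)) r ∈ π.integers) ∧
      Tendsto (normCoeff π n (PowerSeries.C (c : PadicAlgCl p))) atTop (𝓝 0)
    constructor
    · intro r
      rw [normCoeff_C]
      split_ifs
      · exact c.2
      · exact zero_mem _
    · refine tendsto_const_nhds.congr' (eventually_atTop.2 ⟨1, fun r hr => ?_⟩)
      rw [normCoeff_C, if_neg (by omega)]

/-- `m(u) = max {0, -u_1, …, -u_n}`. -/
def mFun {n : ℕ} (u : Fin n → ℤ) : ℕ := Finset.univ.sup fun l => (-u l).toNat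

/-- `w(u) = u_1 + ⋯ + u_n + (n+1) m(u)`, which is a nonnegative integer. -/
def wFun {n : ℕ} (u : Fin n → ℤ) : ℕ := (∑ l, u l + (n + 1) * mFun u).toNat

theorem neg_le_mFun {n : ℕ} (u : Fin n → ℤ) (l : Fin n) : -u l ≤ mFun u := by
  have h : (-u l).toNat ≤ mFun u :=
    Finset.le_sup (f := fun l => (-u l).toNat) (Finset.mem_univ l)
  have := Int.self_le_toNat (-u l)
  omega

theorem sum_add_nonneg {n : ℕ} (u : Fin n → ℤ) : 0 ≤ ∑ l, (u l + mFun u) :=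
  Finset.sum_nonneg fun l _ => by have := neg_le_mFun u l; omega

theorem wFun_eq {n : ℕ} (u : Fin n → ℤ) :
    (wFun u : ℤ) = ∑ l, u l + (n + 1) * mFun u := by
  rw [wFun, Int.toNat_of_nonneg]
  have h := sum_add_nonneg u
  rw [Finset.sum_add_distrib] at h
  simp only [Finset.sum_const, Finset.card_univ, Fintype.card_fin, nsmul_eq_mul] at h
  nlinarith

theorem wFun_eq' {n : ℕ} (u : Fin n → ℤ) :
    (wFun u : ℤ) = ∑ l, (u l + mFun u) + mFun u := by
  rw [wFun_eq, Finset.sum_add_distrib]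
  simp only [Finset.sum_const, Finset.card_univ, Fintype.card_fin, nsmul_eq_mul]
  ring

theorem finite_wFun_lt {n : ℕ} (W : ℕ) : {u : Fin n → ℤ | wFun u < W}.Finite := by
  refine (Set.Finite.pi' (fun _ : Fin n => Set.finite_Icc (-(W : ℤ)) W)).subset fun u hu l => ?_
  have hw := wFun_eq' u
  have hu' : (wFun u : ℤ) < W := by exact_mod_cast hu
  have h1 : u l + mFun u ≤ ∑ l, (u l + mFun u) :=
    Finset.single_le_sum (f := fun l => u l + (mFun u : ℤ))
      (fun l _ => by have := neg_le_mFun u l; omega) (Finset.mem_univ l)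
  have h2 := sum_add_nonneg u
  have h3 := neg_le_mFun u l
  constructor <;> omega

/-- Formal series `∑_{u ∈ ℤ^n} ζ_u(t) x^u`; the value at `u` is the coefficient of `x^u`. -/
abbrev Laurent (p : ℕ) [Fact p.Prime] (n : ℕ) : Type := (Fin n → ℤ) → SeriesT p

/-- The module
`C = {∑_u ξ(u) γ^{w(u)} t^{m(u)} x^u : ξ(u) ∈ O, ξ(u) → 0 as w(u) → ∞}` over `O`, where
convergence is for the sup-norm `‖∑_r a(r) γ^{(n+1) r} t^r‖ = sup_r |a(r)|` of `O`. -/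
def RelC : Submodule (RingO π n) (Laurent p n) where
  carrier := {ζ | ∃ ξ : (Fin n → ℤ) → SeriesT p, (∀ u, ξ u ∈ RingO π n) ∧
    (∀ ε : ℝ, 0 < ε → ∃ W : ℕ, ∀ u, W ≤ wFun u → ∀ r, ‖normCoeff π n (ξ u) r‖ ≤ ε) ∧
    ∀ u, ζ u = PowerSeries.C (π.gamma ^ wFun u) * PowerSeries.X ^ mFun u * ξ u}
  zero_mem' := ⟨0, fun _ => zero_mem _, fun ε hε => ⟨0, fun u _ r => by
    simp [normCoeff, hε.le]⟩, fun u => by simp⟩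
  add_mem' {ζ ζ'} := by
    rintro ⟨ξ, h1, h2, h3⟩ ⟨ξ', h1', h2', h3'⟩
    refine ⟨ξ + ξ', fun u => add_mem (h1 u) (h1' u), fun ε hε => ?_, fun u => ?_⟩
    · obtain ⟨W, hW⟩ := h2 ε hε
      obtain ⟨W', hW'⟩ := h2' ε hε
      refine ⟨max W W', fun u hu r => ?_⟩
      rw [Pi.add_apply, normCoeff_add]
      exact (IsUltrametricDist.norm_add_le_max _ _).trans
        (max_le (hW u (le_of_max_le_left hu) r) (hW' u (le_of_max_le_right hu) r))
    · rw [Pi.add_apply, Pi.add_apply, h3, h3', mul_add]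
  smul_mem' := by
    rintro c ζ ⟨ξ, h1, h2, h3⟩
    refine ⟨fun u => c * ξ u, fun u => mul_mem c.2 (h1 u), fun ε hε => ?_, fun u => ?_⟩
    · obtain ⟨W, hW⟩ := h2 ε hε
      refine ⟨W, fun u hu r => ?_⟩
      rw [normCoeff_mul]
      refine IsUltrametricDist.norm_sum_le_of_forall_le_of_nonneg hε.le fun x _ => ?_
      rw [norm_mul]
      calc _ ≤ 1 * ε := mul_le_mul (c.2.1 _).2 (hW u hu _) (norm_nonneg _) zero_le_one
        _ = ε := one_mul ε
    · change (c : SeriesT p) * ζ u = _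
      rw [h3]; ring

/-- `O` as a type. -/
def TypeO : Type := RingO π n

instance : CommRing (TypeO π n) := inferInstanceAs (CommRing (RingO π n))
instance : Algebra π.integers (TypeO π n) := inferInstanceAs (Algebra π.integers (RingO π n))

/-- `C` as a type. -/
def TypeC : Type := RelC π n

instance : AddCommGroup (TypeC π n) := inferInstanceAs (AddCommGroup (RelC π n))
instance : Module (TypeO π n) (TypeC π n) := inferInstanceAs (Module (RingO π n) (RelC π n))
instance : Module π.integers (TypeC π n) := inferInstanceAs (Module π.integers (RelC π n))
instance : IsScalarTower π.integers (TypeO π n) (TypeC π n) :=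
  inferInstanceAs (IsScalarTower π.integers (RingO π n) (RelC π n))

/-- The coefficient of `ζ` at `t^s x^u`, divided by the power of `γ` of the same weight. -/
def lCoeff {n : ℕ} (ζ : Laurent p n) (u : Fin n → ℤ) (s : ℕ) : PadicAlgCl p :=
  PowerSeries.coeff s (ζ u) * π.gamma ^ (-((n + 1) * s + ∑ l, u l) : ℤ)

theorem lCoeff_eq {ζ : Laurent p n} {ξ : (Fin n → ℤ) → SeriesT p}
    (h : ∀ u, ζ u = PowerSeries.C (π.gamma ^ wFun u) * PowerSeries.X ^ mFun u * ξ u)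
    (u : Fin n → ℤ) (r : ℕ) : lCoeff π ζ u (mFun u + r) = normCoeff π n (ξ u) r := by
  have hγ := π.gamma_ne_zero
  rw [lCoeff, h, mul_assoc, PowerSeries.coeff_C_mul, add_comm, PowerSeries.coeff_X_pow_mul,
    normCoeff, div_eq_mul_inv, mul_right_comm, mul_comm]
  congr 1
  rw [← zpow_natCast, ← zpow_natCast, ← zpow_add₀ hγ, ← zpow_neg, wFun_eq]
  congr 1
  push_cast
  ring

/-- Membership in `C` in terms of coefficients. -/
theorem mem_RelC_iff (ζ : Laurent p n) : ζ ∈ RelC π n ↔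
    (∀ u s, s < mFun u → PowerSeries.coeff s (ζ u) = 0) ∧ (∀ u s, lCoeff π ζ u s ∈ π.integers) ∧
    ∀ ε : ℝ, 0 < ε → {x : (Fin n → ℤ) × ℕ | ε ≤ ‖lCoeff π ζ x.1 x.2‖}.Finite := by
  have hγ := π.gamma_ne_zero
  constructor
  · rintro ⟨ξ, h1, h2, h3⟩
    have h4 : ∀ u s, s < mFun u → PowerSeries.coeff s (ζ u) = 0 := by
      intro u s hs
      rw [h3, mul_assoc, PowerSeries.coeff_C_mul, PowerSeries.coeff_X_pow_mul',
        if_neg (by omega), mul_zero]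
    refine ⟨h4, fun u s => ?_, fun ε hε => ?_⟩
    · by_cases hs : s < mFun u
      · rw [lCoeff, h4 u s hs, zero_mul]; exact zero_mem _
      · obtain ⟨r, rfl⟩ := Nat.exists_eq_add_of_le (not_lt.1 hs)
        rw [lCoeff_eq π n h3]
        exact (h1 u).1 r
    · obtain ⟨W, hW⟩ := h2 (ε / 2) (by positivity)
      have hfin : ∀ u, {s | ε ≤ ‖lCoeff π ζ u s‖}.Finite := by
        intro u
        obtain ⟨R, hR⟩ := (Metric.tendsto_atTop.1 (h1 u).2) ε hε
        refine (Set.finite_lt_nat (mFun u + R)).subset fun s hs => ?_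
        by_contra hs'
        rw [Set.mem_ofPred_eq, not_lt] at hs'
        obtain ⟨r, rfl⟩ := Nat.exists_eq_add_of_le hs'
        have := hR (R + r) (by omega)
        rw [dist_zero_right, ← lCoeff_eq π n h3, ← add_assoc] at this
        exact absurd hs (not_le.2 this)
      refine ((finite_wFun_lt W).biUnion fun u _ =>
        ((hfin u).image fun s => (u, s))).subset ?_
      rintro ⟨u, s⟩ hx
      rw [Set.mem_ofPred_eq] at hx
      simp only [Set.mem_iUnion]
      refine ⟨u, ?_, s, hx, rfl⟩
      by_contra hu
      rw [Set.mem_ofPred_eq, not_lt] at hu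
      by_cases hs : s < mFun u
      · rw [lCoeff, h4 u s hs, zero_mul, norm_zero] at hx; linarith
      · obtain ⟨r, rfl⟩ := Nat.exists_eq_add_of_le (not_lt.1 hs)
        rw [lCoeff_eq π n h3] at hx
        have := hW u hu r
        linarith
  · rintro ⟨h1, h2, h3⟩
    set ξ : (Fin n → ℤ) → SeriesT p := fun u =>
      PowerSeries.mk fun r => PowerSeries.coeff (mFun u + r) (ζ u) / π.gamma ^ wFun u with hξ
    have h4 : ∀ u, ζ u = PowerSeries.C (π.gamma ^ wFun u) * PowerSeries.X ^ mFun u * ξ u := by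
      intro u
      ext s
      rw [mul_assoc, PowerSeries.coeff_C_mul, PowerSeries.coeff_X_pow_mul']
      split_ifs with hs
      · rw [hξ, PowerSeries.coeff_mk, mul_div_cancel₀ _ (pow_ne_zero _ hγ),
          Nat.add_sub_cancel' hs]
      · rw [h1 u s (by omega), mul_zero]
    have h5 := lCoeff_eq π n h4
    refine ⟨ξ, fun u => ⟨fun r => h5 u r ▸ h2 _ _, ?_⟩, fun ε hε => ?_, h4⟩
    · rw [Metric.tendsto_atTop]
      intro ε hε
      have hf : {r | ε ≤ ‖normCoeff π n (ξ u) r‖}.Finite := by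
        refine ((h3 ε hε).preimage (f := fun r => (u, mFun u + r)) ?_).subset fun r hr => ?_
        · intro r _ r' _ h
          simpa using h
        · change ε ≤ ‖lCoeff π ζ u (mFun u + r)‖
          rw [h5]; exact hr
      obtain ⟨R, hR⟩ := hf.bddAbove
      refine ⟨R + 1, fun r hr => ?_⟩
      rw [dist_zero_right]
      by_contra h
      have := hR (not_lt.1 h)
      omega
    · obtain ⟨W, hW⟩ := ((h3 ε hε).image fun x => wFun x.1).bddAbove
      refine ⟨W + 1, fun u hu r => ?_⟩
      by_contra h
      rw [← h5] at h
      have := hW ⟨(u, mFun u + r), (not_le.1 h).le, rfl⟩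
      simp only at this
      omega
end
end HyperKloosterman

namespace HyperKloosterman
noncomputable section

open Filter Topology

variable {p a : ℕ} [Fact p.Prime] (π : DworkPi p a) (n : ℕ)

/-- The operator `x_l ∂/∂x_l`. -/
def thetaX {n : ℕ} (l : Fin n) : Module.End (PadicAlgCl p) (Laurent p n) where
  toFun ζ u := (u l : PadicAlgCl p) • ζ u
  map_add' ζ ζ' := by ext u : 1; simp
  map_smul' c ζ := by
    ext u : 1; exact smul_comm (u l : PadicAlgCl p) c (ζ u)

/-- The operator `t d/dt` on power series. -/
def thetaPS (p : ℕ) [Fact p.Prime] : Derivation (PadicAlgCl p) (SeriesT p) (SeriesT p) :=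
  (PowerSeries.X : SeriesT p) • PowerSeries.derivative (PadicAlgCl p)

theorem coeff_thetaPS (ξ : SeriesT p) (r : ℕ) :
    PowerSeries.coeff r (thetaPS p ξ) = r * PowerSeries.coeff r ξ := by
  change PowerSeries.coeff r (PowerSeries.X * PowerSeries.derivative (PadicAlgCl p) ξ) = _
  cases r with
  | zero => simp
  | succ r =>
    rw [PowerSeries.coeff_succ_X_mul, PowerSeries.coeff_derivative, mul_comm]
    push_cast; ring

/-- The operator `t ∂/∂t`. -/
def thetaT (p : ℕ) [Fact p.Prime] (n : ℕ) : Module.End (PadicAlgCl p) (Laurent p n) where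
  toFun ζ u := thetaPS p (ζ u)
  map_add' ζ ζ' := by ext u : 1; simp
  map_smul' c ζ := by ext u : 1; simp

/-- Multiplication by the monomial `(t^e x^v)^{p^i}`. -/
def monoMul {n : ℕ} (e : ℕ) (v : Fin n → ℤ) (i : ℕ) : Module.End (PadicAlgCl p) (Laurent p n) where
  toFun ζ u := PowerSeries.X ^ (e * p ^ i) * ζ (u - p ^ i • v)
  map_add' ζ ζ' := by ext u : 1; simp [mul_add]
  map_smul' c ζ := by ext u : 1; simp

/-- Multiplication by `∑_i γ_i p^i (t^e x^v)^{p^i}`, formed coefficient by coefficient. It is used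
for `t^e x^v = x_l` and `t^e x^v = t / (x_1 ⋯ x_n)` on elements of `C`, and then each of the sums
over `i` has only finitely many nonzero terms. -/
def seriesMul {n : ℕ} (e : ℕ) (v : Fin n → ℤ) (ζ : Laurent p n) : Laurent p n := fun u =>
  PowerSeries.mk fun s => ∑ᶠ i : ℕ, π.coef i * PowerSeries.coeff s (monoMul e v i ζ u)

/-- The differential `D_{t,l} = x_l ∂/∂x_l + x_l ∂H/∂x_l`, where
`H = ∑_i γ_i K(t^{p^i}, x^{p^i})` and `K = x_1 + ⋯ + x_n + t / (x_1 ⋯ x_n)`, so that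
`x_l ∂H/∂x_l = ∑_i γ_i p^i (x_l^{p^i} - (t / (x_1 ⋯ x_n))^{p^i})`. -/
def diffX {n : ℕ} (l : Fin n) (ζ : Laurent p n) : Laurent p n :=
  thetaX l ζ + seriesMul π 0 (Pi.single l 1) ζ - seriesMul π 1 (fun _ => -1) ζ

/-- The differential `∂ = t ∂/∂t + t ∂H/∂t`, where
`t ∂H/∂t = ∑_i γ_i p^i (t / (x_1 ⋯ x_n))^{p^i}`. -/
def diffT {n : ℕ} (ζ : Laurent p n) : Laurent p n :=
  thetaT p n ζ + seriesMul π 1 (fun _ => -1) ζ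

/-! The rest of this part checks that these differentials act on `C` and commute. -/

/-- The exponents `(e, v)` of the monomials of `K`. -/
def IsKloExp {n : ℕ} (e : ℕ) (v : Fin n → ℤ) : Prop :=
  (n + 1) * (e : ℤ) + ∑ l, v l = 1 ∧ (∀ l, 0 ≤ e + v l) ∧ (1 ≤ e ∨ ∃ l, 1 ≤ e + v l)

theorem isKloExp_single {n : ℕ} (l : Fin n) : IsKloExp 0 (Pi.single l (1 : ℤ)) := by
  refine ⟨by simp, fun l' => ?_, Or.inr ⟨l, by simp⟩⟩
  by_cases h : l' = l
  · subst h; simp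
  · simp [h]

theorem isKloExp_neg (n : ℕ) : IsKloExp 1 (fun _ : Fin n => (-1 : ℤ)) := by
  refine ⟨by simp, fun l' => by simp, Or.inl le_rfl⟩

/-- The indices at which truncation of the sums at `N` has no effect. -/
def Good {n : ℕ} (N : ℕ) (u : Fin n → ℤ) (s : ℕ) : Prop := s < N ∧ ∀ l, (s : ℤ) + u l < N

theorem Good.mono {n N s s' : ℕ} {u : Fin n → ℤ} (h : Good N u s) (hs : s' ≤ s) :
    Good N u s' :=
  ⟨hs.trans_lt h.1, fun l => by have := h.2 l; omega⟩

theorem exists_good {n : ℕ} (u : Fin n → ℤ) (s : ℕ) : ∃ N, Good N u s := by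
  obtain ⟨S, hS⟩ : ∃ S : ℕ, ∀ l, (u l).toNat ≤ S :=
    ⟨∑ l, (u l).toNat, fun l => Finset.single_le_sum (f := fun l => (u l).toNat)
      (fun _ _ => Nat.zero_le _) (Finset.mem_univ l)⟩
  refine ⟨s + S + 1, by omega, fun l => ?_⟩
  have := hS l
  omega

theorem Good.shift {n N s e i : ℕ} {u v : Fin n → ℤ} (h : Good N u s) (hv : IsKloExp e v)
    (hs : e * p ^ i ≤ s) : Good N (u - p ^ i • v) (s - e * p ^ i) := by
  refine ⟨(Nat.sub_le _ _).trans_lt h.1, fun l => lt_of_le_of_lt ?_ (h.2 l)⟩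
  rw [Pi.sub_apply, Pi.smul_apply, Nat.cast_sub hs, nsmul_eq_mul]
  have := mul_nonneg (Int.natCast_nonneg (p ^ i)) (hv.2.1 l)
  push_cast at *
  linarith

/-- Agreement of two series at all indices where truncation at `N` has no effect. -/
def Agree {n : ℕ} (N : ℕ) (ζ ζ' : Laurent p n) : Prop :=
  ∀ u s, Good N u s → PowerSeries.coeff s (ζ u) = PowerSeries.coeff s (ζ' u)

theorem eq_of_agree {n : ℕ} {ζ ζ' : Laurent p n} (h : ∀ N, Agree N ζ ζ') : ζ = ζ' := by
  ext u s
  obtain ⟨N, hN⟩ := exists_good u s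
  exact h N u s hN

namespace Agree

variable {n N : ℕ} {ζ ζ' η η' : Laurent p n}

theorem symm (h : Agree N ζ ζ') : Agree N ζ' ζ := fun u s hs => (h u s hs).symm

theorem trans {ζ'' : Laurent p n} (h : Agree N ζ ζ') (h' : Agree N ζ' ζ'') : Agree N ζ ζ'' :=
  fun u s hs => (h u s hs).trans (h' u s hs)

theorem add (h : Agree N ζ ζ') (h' : Agree N η η') : Agree N (ζ + η) (ζ' + η') :=
  fun u s hs => by simp [h u s hs, h' u s hs]

theorem sub (h : Agree N ζ ζ') (h' : Agree N η η') : Agree N (ζ - η) (ζ' - η') :=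
  fun u s hs => by simp [h u s hs, h' u s hs]

theorem smul (c : SeriesT p) (h : Agree N ζ ζ') : Agree N (c • ζ) (c • ζ') := fun u s hs => by
  change PowerSeries.coeff s (c * ζ u) = PowerSeries.coeff s (c * ζ' u)
  rw [PowerSeries.coeff_mul, PowerSeries.coeff_mul]
  refine Finset.sum_congr rfl fun x hx => ?_
  rw [Finset.HasAntidiagonal.mem_antidiagonal] at hx
  rw [h u x.2 (hs.mono (by omega))]

theorem thetaX (l : Fin n) (h : Agree N ζ ζ') :
    Agree N (HyperKloosterman.thetaX l ζ) (HyperKloosterman.thetaX l ζ') := fun u s hs => by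
  change PowerSeries.coeff s ((u l : PadicAlgCl p) • ζ u) =
    PowerSeries.coeff s ((u l : PadicAlgCl p) • ζ' u)
  rw [map_smul, map_smul, h u s hs]

theorem thetaT (h : Agree N ζ ζ') :
    Agree N (HyperKloosterman.thetaT p n ζ) (HyperKloosterman.thetaT p n ζ') := fun u s hs => by
  change PowerSeries.coeff s (thetaPS p (ζ u)) = PowerSeries.coeff s (thetaPS p (ζ' u))
  rw [coeff_thetaPS, coeff_thetaPS, h u s hs]

theorem monoMul {e : ℕ} {v : Fin n → ℤ} (hv : IsKloExp e v) (i : ℕ) (h : Agree N ζ ζ') :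
    Agree N (HyperKloosterman.monoMul e v i ζ) (HyperKloosterman.monoMul e v i ζ') :=
  fun u s hs => by
  change PowerSeries.coeff s (PowerSeries.X ^ (e * p ^ i) * ζ (u - p ^ i • v)) =
    PowerSeries.coeff s (PowerSeries.X ^ (e * p ^ i) * ζ' (u - p ^ i • v))
  rw [PowerSeries.coeff_X_pow_mul', PowerSeries.coeff_X_pow_mul']
  split_ifs with h'
  · exact h _ _ (hs.shift hv h')
  · rfl

end Agree

/-- Truncation of `seriesMul`. -/
def truncMul {n : ℕ} (N : ℕ) (e : ℕ) (v : Fin n → ℤ) :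
    Module.End (PadicAlgCl p) (Laurent p n) :=
  ∑ i ∈ Finset.range N, π.coef i • monoMul e v i

theorem coeff_truncMul {n : ℕ} (N : ℕ) (e : ℕ) (v : Fin n → ℤ) (ζ : Laurent p n)
    (u : Fin n → ℤ) (s : ℕ) : PowerSeries.coeff s (truncMul π N e v ζ u) =
      ∑ i ∈ Finset.range N, π.coef i * PowerSeries.coeff s (monoMul e v i ζ u) := by
  rw [truncMul, LinearMap.sum_apply, Finset.sum_apply, map_sum]
  refine Finset.sum_congr rfl fun i _ => ?_
  rw [LinearMap.smul_apply, Pi.smul_apply, map_smul, smul_eq_mul]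

theorem Agree.truncMul {n N : ℕ} {ζ ζ' : Laurent p n} {e : ℕ} {v : Fin n → ℤ}
    (hv : IsKloExp e v) (M : ℕ) (h : Agree N ζ ζ') :
    Agree N (truncMul π M e v ζ) (truncMul π M e v ζ') := fun u s hs => by
  rw [coeff_truncMul, coeff_truncMul]
  exact Finset.sum_congr rfl fun i _ => by rw [h.monoMul hv i u s hs]

/-- Divisibility of the coefficient of `x^u` by `t^{m(u)}`. -/
def Supp {n : ℕ} (ζ : Laurent p n) : Prop := ∀ u s, s < mFun u → PowerSeries.coeff s (ζ u) = 0

theorem Supp.coeff_eq_zero {n : ℕ} {ζ : Laurent p n} (h : Supp ζ) {u : Fin n → ℤ} {s : ℕ}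
    {l : Fin n} (hs : (s : ℤ) + u l < 0) : PowerSeries.coeff s (ζ u) = 0 :=
  h u s (by have := neg_le_mFun u l; omega)

theorem Supp.monoMul_eq_zero {n : ℕ} {ζ : Laurent p n} (h : Supp ζ) {N s e i : ℕ}
    {u v : Fin n → ℤ} (hv : IsKloExp e v) (hs : Good N u s) (hi : N ≤ i) :
    PowerSeries.coeff s (monoMul e v i ζ u) = 0 := by
  have hp := (Fact.out : p.Prime).two_le
  have hpi : i < p ^ i := Nat.lt_pow_self (by omega)
  change PowerSeries.coeff s (PowerSeries.X ^ (e * p ^ i) * ζ (u - p ^ i • v)) = 0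
  rw [PowerSeries.coeff_X_pow_mul']
  split_ifs with h'
  · obtain he | ⟨l, hl⟩ := hv.2.2
    · have := hs.1
      nlinarith
    · refine h.coeff_eq_zero (l := l) ?_
      rw [Pi.sub_apply, Pi.smul_apply, Nat.cast_sub h', nsmul_eq_mul]
      have h1 := hs.2 l
      have h2 : (p ^ i : ℤ) * 1 ≤ p ^ i * (e + v l) := mul_le_mul_of_nonneg_left hl (by positivity)
      have h3 : (N : ℤ) < (p ^ i : ℤ) := by exact_mod_cast (by omega : N < p ^ i)
      push_cast
      linarith
  · rfl

theorem Supp.agree_seriesMul {n : ℕ} {ζ : Laurent p n} (h : Supp ζ) (N : ℕ) {e : ℕ}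
    {v : Fin n → ℤ} (hv : IsKloExp e v) : Agree N (seriesMul π e v ζ) (truncMul π N e v ζ) := by
  intro u s hs
  rw [seriesMul, PowerSeries.coeff_mk, coeff_truncMul]
  refine finsum_eq_sum_of_support_subset _ fun i hi => ?_
  rw [Finset.coe_range, Set.mem_Iio]
  by_contra hi'
  exact hi (by simp only [h.monoMul_eq_zero hv hs (not_lt.1 hi'), mul_zero])

/-- Truncation of `diffX`. -/
def truncX {n : ℕ} (N : ℕ) (l : Fin n) : Module.End (PadicAlgCl p) (Laurent p n) :=
  thetaX l + truncMul π N 0 (Pi.single l 1) - truncMul π N 1 (fun _ => -1)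

/-- Truncation of `diffT`. -/
def truncT {n : ℕ} (N : ℕ) : Module.End (PadicAlgCl p) (Laurent p n) :=
  thetaT p n + truncMul π N 1 (fun _ => -1)

theorem Supp.agree_diffX {n : ℕ} {ζ : Laurent p n} (h : Supp ζ) (N : ℕ) (l : Fin n) :
    Agree N (diffX π l ζ) (truncX π N l ζ) :=
  (Agree.add (fun _ _ _ => rfl) (h.agree_seriesMul π N (isKloExp_single l))).sub
    (h.agree_seriesMul π N (isKloExp_neg n))

theorem Supp.agree_diffT {n : ℕ} {ζ : Laurent p n} (h : Supp ζ) (N : ℕ) :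
    Agree N (diffT π ζ) (truncT π N ζ) :=
  Agree.add (fun _ _ _ => rfl) (h.agree_seriesMul π N (isKloExp_neg n))

theorem Agree.truncX {n N : ℕ} {ζ ζ' : Laurent p n} (l : Fin n) (M : ℕ) (h : Agree N ζ ζ') :
    Agree N (truncX π M l ζ) (truncX π M l ζ') :=
  ((h.thetaX l).add (h.truncMul π (isKloExp_single l) M)).sub (h.truncMul π (isKloExp_neg n) M)

theorem Agree.truncT {n N : ℕ} {ζ ζ' : Laurent p n} (M : ℕ) (h : Agree N ζ ζ') :
    Agree N (truncT π M ζ) (truncT π M ζ') :=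
  h.thetaT.add (h.truncMul π (isKloExp_neg n) M)

theorem monoMul_comm {n : ℕ} (e e' : ℕ) (v v' : Fin n → ℤ) (i j : ℕ) :
    (monoMul e v i * monoMul e' v' j : Module.End (PadicAlgCl p) (Laurent p n)) =
      monoMul e' v' j * monoMul e v i := by
  ext ζ u : 2
  change PowerSeries.X ^ (e * p ^ i) * (PowerSeries.X ^ (e' * p ^ j) * ζ _) =
    PowerSeries.X ^ (e' * p ^ j) * (PowerSeries.X ^ (e * p ^ i) * ζ _)
  rw [sub_right_comm]
  ring

theorem truncMul_comm {n : ℕ} (N : ℕ) (e e' : ℕ) (v v' : Fin n → ℤ) :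
    truncMul π N e v * truncMul π N e' v' = truncMul π N e' v' * truncMul π N e v := by
  have : Commute (truncMul π N e v) (truncMul π N e' v') := by
    unfold truncMul
    refine Commute.sum_left _ _ _ fun i _ => Commute.sum_right _ _ _ fun j _ => ?_
    exact Commute.smul_left (Commute.smul_right (monoMul_comm e e' v v' i j) _) _
  exact this

theorem theta_comm {n : ℕ} (l : Fin n) : thetaX l * thetaT p n = thetaT p n * thetaX l := by
  ext ζ u : 2
  change (u l : PadicAlgCl p) • thetaPS p (ζ u) = thetaPS p ((u l : PadicAlgCl p) • ζ u)
  rw [Derivation.map_smul]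

theorem thetaX_monoMul {n : ℕ} (l : Fin n) (e : ℕ) (v : Fin n → ℤ) (i : ℕ) :
    (thetaX l * monoMul e v i : Module.End (PadicAlgCl p) (Laurent p n)) =
      monoMul e v i * thetaX l + ((p ^ i : PadicAlgCl p) * (v l : PadicAlgCl p)) • monoMul e v i := by
  ext ζ u : 2
  change (u l : PadicAlgCl p) • (PowerSeries.X ^ (e * p ^ i) * ζ (u - p ^ i • v)) =
    PowerSeries.X ^ (e * p ^ i) * (((u - p ^ i • v) l : ℤ) : PadicAlgCl p) • ζ (u - p ^ i • v) +
      ((p ^ i : PadicAlgCl p) * (v l : PadicAlgCl p)) •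
        (PowerSeries.X ^ (e * p ^ i) * ζ (u - p ^ i • v))
  rw [mul_smul_comm, ← add_smul]
  congr 1
  simp

theorem thetaPS_X_pow_mul (m : ℕ) (f : SeriesT p) : thetaPS p (PowerSeries.X ^ m * f) =
    PowerSeries.X ^ m * thetaPS p f + (m : PadicAlgCl p) • (PowerSeries.X ^ m * f) := by
  ext s
  rw [map_add, map_smul, coeff_thetaPS, PowerSeries.coeff_X_pow_mul',
    PowerSeries.coeff_X_pow_mul', smul_eq_mul]
  split_ifs with h
  · rw [coeff_thetaPS, Nat.cast_sub h, ← add_mul, sub_add_cancel]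
  · rw [mul_zero, mul_zero, add_zero]

theorem thetaT_monoMul {n : ℕ} (e : ℕ) (v : Fin n → ℤ) (i : ℕ) :
    (thetaT p n * monoMul e v i : Module.End (PadicAlgCl p) (Laurent p n)) =
      monoMul e v i * thetaT p n + ((e * p ^ i : ℕ) : PadicAlgCl p) • monoMul e v i :=
  LinearMap.ext fun ζ => funext fun u => thetaPS_X_pow_mul (e * p ^ i) (ζ (u - p ^ i • v))

theorem trunc_comm {n : ℕ} (N : ℕ) (l : Fin n) :
    truncT π N * truncX π N l = truncX π N l * truncT π N := by
  set Y := truncMul π N 1 (fun _ : Fin n => (-1 : ℤ)) with hY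
  set P := truncMul π N 0 (Pi.single l (1 : ℤ)) with hP
  set Z := ∑ i ∈ Finset.range N,
    (π.coef i * (p ^ i : PadicAlgCl p)) • (monoMul 1 (fun _ : Fin n => (-1 : ℤ)) i :
      Module.End (PadicAlgCl p) (Laurent p n)) with hZ
  have h1 : thetaX l * Y = Y * thetaX l - Z := by
    rw [hY, hZ, truncMul, Finset.mul_sum, Finset.sum_mul, ← Finset.sum_sub_distrib]
    refine Finset.sum_congr rfl fun i _ => ?_
    rw [mul_smul_comm, thetaX_monoMul, smul_mul_assoc, smul_add, smul_smul, sub_eq_add_neg]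
    congr 1
    rw [Int.cast_neg, Int.cast_one, mul_neg_one, mul_neg]
    exact neg_smul _ _
  have h2 : thetaT p n * Y = Y * thetaT p n + Z := by
    rw [hY, hZ, truncMul, Finset.mul_sum, Finset.sum_mul, ← Finset.sum_add_distrib]
    refine Finset.sum_congr rfl fun i _ => ?_
    rw [mul_smul_comm, thetaT_monoMul, smul_mul_assoc, smul_add, smul_smul, one_mul, Nat.cast_pow]
  have h3 : thetaT p n * P = P * thetaT p n := by
    rw [hP, truncMul, Finset.mul_sum, Finset.sum_mul]
    refine Finset.sum_congr rfl fun i _ => ?_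
    rw [mul_smul_comm, thetaT_monoMul, smul_mul_assoc]
    rw [zero_mul, Nat.cast_zero, zero_smul, add_zero]
  have h4 : Y * P = P * Y := truncMul_comm π N _ _ _ _
  have h5 := theta_comm (p := p) l
  rw [truncT, truncX, ← hY, ← hP]
  simp only [mul_add, add_mul, sub_mul, mul_sub, h1, h2, h3, h4, h5]
  abel

theorem lCoeff_smul {n : ℕ} (c : PadicAlgCl p) (ζ : Laurent p n) (u : Fin n → ℤ) (s : ℕ) :
    lCoeff π (c • ζ) u s = c * lCoeff π ζ u s := by
  rw [lCoeff, lCoeff, Pi.smul_apply, map_smul, smul_eq_mul, mul_assoc]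

theorem lCoeff_monoMul {n : ℕ} {e : ℕ} {v : Fin n → ℤ} (hv : IsKloExp e v) (i : ℕ)
    (ζ : Laurent p n) (u : Fin n → ℤ) (s : ℕ) :
    lCoeff π (monoMul e v i ζ) u s = if e * p ^ i ≤ s then
      (π.gamma ^ p ^ i)⁻¹ * lCoeff π ζ (u - p ^ i • v) (s - e * p ^ i) else 0 := by
  have hγ := π.gamma_ne_zero
  have h0 : PowerSeries.coeff s (monoMul e v i ζ u) =
    PowerSeries.coeff s (PowerSeries.X ^ (e * p ^ i) * ζ (u - p ^ i • v)) := rfl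
  rw [lCoeff, h0, PowerSeries.coeff_X_pow_mul']
  split_ifs with h
  · rw [lCoeff, mul_left_comm]
    congr 1
    rw [← zpow_natCast, ← zpow_neg, ← zpow_add₀ hγ]
    congr 1
    have h1 : ∀ l, (u - p ^ i • v) l = u l - (p ^ i : ℤ) * v l := fun l => by
      rw [Pi.sub_apply, Pi.smul_apply, nsmul_eq_mul]; push_cast; rfl
    simp only [h1, Finset.sum_sub_distrib, ← Finset.mul_sum]
    rw [Nat.cast_sub h]
    push_cast
    linear_combination (-(p : ℤ) ^ i) * hv.1
  · rw [zero_mul]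

theorem Supp.lCoeff_seriesMul {n : ℕ} {ζ : Laurent p n} (h : Supp ζ) {e : ℕ}
    {v : Fin n → ℤ} (hv : IsKloExp e v) {N s : ℕ} {u : Fin n → ℤ} (hs : Good N u s) :
    lCoeff π (seriesMul π e v ζ) u s = ∑ i ∈ Finset.range N, if e * p ^ i ≤ s then
      π.coef i / π.gamma ^ p ^ i * lCoeff π ζ (u - p ^ i • v) (s - e * p ^ i) else 0 := by
  rw [lCoeff, h.agree_seriesMul π N hv u s hs, coeff_truncMul, Finset.sum_mul]
  refine Finset.sum_congr rfl fun i _ => ?_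
  have h1 := lCoeff_monoMul π hv i ζ u s
  rw [lCoeff] at h1
  rw [mul_assoc, h1]
  split_ifs
  · ring
  · rw [mul_zero]

theorem seriesMul_mem {n : ℕ} {ζ : Laurent p n} (h : ζ ∈ RelC π n) {e : ℕ} {v : Fin n → ℤ}
    (hv : IsKloExp e v) : seriesMul π e v ζ ∈ RelC π n := by
  rw [mem_RelC_iff] at *
  obtain ⟨h1, h2, h3⟩ := h
  have hS : Supp ζ := h1
  refine ⟨fun u s hs => ?_, fun u s => ?_, fun ε hε => ?_⟩
  · rw [seriesMul, PowerSeries.coeff_mk]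
    refine finsum_eq_zero_of_forall_eq_zero fun i => ?_
    have h0 : PowerSeries.coeff s (monoMul e v i ζ u) =
      PowerSeries.coeff s (PowerSeries.X ^ (e * p ^ i) * ζ (u - p ^ i • v)) := rfl
    rw [h0, PowerSeries.coeff_X_pow_mul']
    split_ifs with h'
    · obtain ⟨l, hl⟩ : ∃ l, (s : ℤ) < -u l := by
        by_contra! hcon
        have : mFun u ≤ s := Finset.sup_le fun l _ => by have := hcon l; omega
        omega
      rw [hS.coeff_eq_zero (l := l), mul_zero]
      rw [Pi.sub_apply, Pi.smul_apply, Nat.cast_sub h', nsmul_eq_mul]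
      have := mul_nonneg (Int.natCast_nonneg (p ^ i)) (hv.2.1 l)
      push_cast at *
      linarith
    · rw [mul_zero]
  · obtain ⟨N, hN⟩ := exists_good u s
    rw [hS.lCoeff_seriesMul π hv hN]
    refine sum_mem fun i _ => ?_
    split_ifs
    · exact mul_mem (π.coef_div_mem i) (h2 _ _)
    · exact zero_mem _
  · obtain ⟨M, hM⟩ := (Metric.tendsto_atTop.1 π.tendsto_coef_div) ε hε
    refine ((Finset.range M).finite_toSet.biUnion fun i _ =>
      ((h3 ε hε).image fun x => (x.1 + p ^ i • v, x.2 + e * p ^ i))).subset ?_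
    rintro ⟨u, s⟩ hx
    rw [Set.mem_ofPred_eq] at hx
    simp only at hx
    obtain ⟨N, hN⟩ := exists_good u s
    by_contra hcon
    simp only [Set.mem_iUnion, not_exists] at hcon
    refine absurd hx (not_le.2 ?_)
    have key : ∀ i, ‖(if e * p ^ i ≤ s then
        π.coef i / π.gamma ^ p ^ i * lCoeff π ζ (u - p ^ i • v) (s - e * p ^ i) else 0 :
          PadicAlgCl p)‖ < ε := by
      intro i
      split_ifs with h'
      · rw [norm_mul]
        have b1 := (π.coef_div_mem i).2
        have b2 := (h2 (u - p ^ i • v) (s - e * p ^ i)).2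
        by_cases hi : i < M
        · have b3 : ‖lCoeff π ζ (u - p ^ i • v) (s - e * p ^ i)‖ < ε := by
            by_contra hb
            refine hcon i (by simpa using hi) ⟨(u - p ^ i • v, s - e * p ^ i), not_lt.1 hb, ?_⟩
            simp [Nat.sub_add_cancel h']
          exact (mul_le_of_le_one_left (norm_nonneg _) b1).trans_lt b3
        · have b3 := hM i (not_lt.1 hi)
          rw [dist_zero_right, norm_norm] at b3
          exact (mul_le_of_le_one_right (norm_nonneg _) b2).trans_lt b3
      · rwa [norm_zero]
    rw [hS.lCoeff_seriesMul π hv hN]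
    obtain ⟨i, -, hi⟩ := IsUltrametricDist.exists_norm_finsetSum_le (Finset.range N) (fun i =>
      (if e * p ^ i ≤ s then
        π.coef i / π.gamma ^ p ^ i * lCoeff π ζ (u - p ^ i • v) (s - e * p ^ i) else 0 :
          PadicAlgCl p))
    exact hi.trans_lt (key i)

/-- Multiplying coefficients by elements of `O_q` preserves `C`. -/
theorem coeffMul_mem {n : ℕ} {ζ η : Laurent p n} (h : ζ ∈ RelC π n)
    (c : (Fin n → ℤ) → ℕ → PadicAlgCl p) (hc : ∀ u s, c u s ∈ π.integers)
    (hη : ∀ u s, PowerSeries.coeff s (η u) = c u s * PowerSeries.coeff s (ζ u)) :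
    η ∈ RelC π n := by
  rw [mem_RelC_iff] at *
  obtain ⟨h1, h2, h3⟩ := h
  have h4 : ∀ u s, lCoeff π η u s = c u s * lCoeff π ζ u s := fun u s => by
    rw [lCoeff, lCoeff, hη, mul_assoc]
  refine ⟨fun u s hs => by rw [hη, h1 u s hs, mul_zero], fun u s => ?_, fun ε hε => ?_⟩
  · rw [h4]; exact mul_mem (hc u s) (h2 u s)
  · refine (h3 ε hε).subset fun x hx => ?_
    refine le_trans (show ε ≤ _ from hx) ?_
    rw [h4, norm_mul]
    exact mul_le_of_le_one_left (norm_nonneg _) (hc _ _).2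

theorem diffX_mem {n : ℕ} {ζ : Laurent p n} (h : ζ ∈ RelC π n) (l : Fin n) :
    diffX π l ζ ∈ RelC π n :=
  sub_mem (add_mem (coeffMul_mem π h (fun u _ => (u l : PadicAlgCl p))
    (fun _ _ => intCast_mem _ _) (fun u s => by
      change PowerSeries.coeff s ((u l : PadicAlgCl p) • ζ u) = _
      rw [map_smul, smul_eq_mul])) (seriesMul_mem π h (isKloExp_single l)))
    (seriesMul_mem π h (isKloExp_neg n))

theorem diffT_mem {n : ℕ} {ζ : Laurent p n} (h : ζ ∈ RelC π n) : diffT π ζ ∈ RelC π n :=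
  add_mem (coeffMul_mem π h (fun _ s => (s : PadicAlgCl p)) (fun _ _ => natCast_mem _ _)
    (fun u s => coeff_thetaPS (ζ u) s)) (seriesMul_mem π h (isKloExp_neg n))

theorem supp_of_mem {n : ℕ} {ζ : Laurent p n} (h : ζ ∈ RelC π n) : Supp ζ :=
  ((mem_RelC_iff π n ζ).1 h).1

theorem diff_comm {n : ℕ} {ζ : Laurent p n} (h : ζ ∈ RelC π n) (l : Fin n) :
    diffT π (diffX π l ζ) = diffX π l (diffT π ζ) := by
  refine eq_of_agree fun N => ?_
  have h1 := (supp_of_mem π (diffX_mem π h l)).agree_diffT π N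
  have h2 := ((supp_of_mem π h).agree_diffX π N l).truncT π N
  have h3 := (supp_of_mem π (diffT_mem π h)).agree_diffX π N l
  have h4 := ((supp_of_mem π h).agree_diffT π N).truncX π l N
  have h5 : truncT π N (truncX π N l ζ) = truncX π N l (truncT π N ζ) :=
    LinearMap.congr_fun (trunc_comm π N l) ζ
  exact (h1.trans h2).trans (h5 ▸ (h3.trans h4).symm)

end
end HyperKloosterman

namespace HyperKloosterman
noncomputable section

open Filter Topology

variable {p a : ℕ} [Fact p.Prime] (π : DworkPi p a) (n : ℕ)

theorem monoMul_smul {n : ℕ} (e : ℕ) (v : Fin n → ℤ) (i : ℕ) (c : SeriesT p)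
    (ζ : Laurent p n) : monoMul e v i (c • ζ) = c • monoMul e v i ζ :=
  funext fun u => mul_left_comm (PowerSeries.X ^ (e * p ^ i)) c (ζ (u - p ^ i • v))

theorem truncMul_smul {n : ℕ} (N e : ℕ) (v : Fin n → ℤ) (c : SeriesT p)
    (ζ : Laurent p n) : truncMul π N e v (c • ζ) = c • truncMul π N e v ζ := by
  rw [truncMul, LinearMap.sum_apply, LinearMap.sum_apply, Finset.smul_sum]
  refine Finset.sum_congr rfl fun i _ => ?_
  rw [LinearMap.smul_apply, LinearMap.smul_apply, monoMul_smul]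
  exact smul_comm (π.coef i) c (monoMul e v i ζ)

theorem truncX_smul {n : ℕ} (N : ℕ) (l : Fin n) (c : SeriesT p) (ζ : Laurent p n) :
    truncX π N l (c • ζ) = c • truncX π N l ζ := by
  have h : thetaX l (c • ζ) = c • thetaX l ζ :=
    funext fun u => smul_comm (u l : PadicAlgCl p) c (ζ u)
  rw [truncX, LinearMap.sub_apply, LinearMap.add_apply, LinearMap.sub_apply, LinearMap.add_apply,
    truncMul_smul, truncMul_smul, h, smul_sub, smul_add]

theorem truncT_smul {n : ℕ} (N : ℕ) (c : SeriesT p) (ζ : Laurent p n) :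
    truncT π N (c • ζ) = thetaPS p c • ζ + c • truncT π N ζ := by
  have h : thetaT p n (c • ζ) = thetaPS p c • ζ + c • thetaT p n ζ :=
    funext fun u => by
      change thetaPS p (c * ζ u) = thetaPS p c * ζ u + c * thetaPS p (ζ u)
      rw [Derivation.leibniz, smul_eq_mul, smul_eq_mul, add_comm, mul_comm (ζ u)]
  rw [truncT, LinearMap.add_apply, LinearMap.add_apply, truncMul_smul, h, smul_add, add_assoc]

theorem diffX_add {n : ℕ} {ζ ζ' : Laurent p n} (h : ζ ∈ RelC π n) (h' : ζ' ∈ RelC π n)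
    (l : Fin n) : diffX π l (ζ + ζ') = diffX π l ζ + diffX π l ζ' :=
  eq_of_agree fun N => by
    have h1 := (supp_of_mem π (add_mem h h')).agree_diffX π N l
    rw [map_add] at h1
    exact h1.trans (((supp_of_mem π h).agree_diffX π N l).add
      ((supp_of_mem π h').agree_diffX π N l)).symm

theorem diffX_smul {n : ℕ} {ζ : Laurent p n} (h : ζ ∈ RelC π n) (c : RingO π n) (l : Fin n) :
    diffX π l ((c : SeriesT p) • ζ) = (c : SeriesT p) • diffX π l ζ :=
  eq_of_agree fun N => by
    have h1 := (supp_of_mem π ((RelC π n).smul_mem c h)).agree_diffX π N l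
    change Agree N (diffX π l ((c : SeriesT p) • ζ)) (truncX π N l ((c : SeriesT p) • ζ)) at h1
    rw [truncX_smul] at h1
    exact h1.trans (((supp_of_mem π h).agree_diffX π N l).smul _).symm

theorem diffT_add {n : ℕ} {ζ ζ' : Laurent p n} (h : ζ ∈ RelC π n) (h' : ζ' ∈ RelC π n) :
    diffT π (ζ + ζ') = diffT π ζ + diffT π ζ' :=
  eq_of_agree fun N => by
    have h1 := (supp_of_mem π (add_mem h h')).agree_diffT π N
    rw [map_add] at h1
    exact h1.trans (((supp_of_mem π h).agree_diffT π N).add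
      ((supp_of_mem π h').agree_diffT π N)).symm

theorem diffT_smul {n : ℕ} {ζ : Laurent p n} (h : ζ ∈ RelC π n) (c : RingO π n) :
    diffT π ((c : SeriesT p) • ζ) =
      thetaPS p (c : SeriesT p) • ζ + (c : SeriesT p) • diffT π ζ :=
  eq_of_agree fun N => by
    have h1 := (supp_of_mem π ((RelC π n).smul_mem c h)).agree_diffT π N
    change Agree N (diffT π ((c : SeriesT p) • ζ)) (truncT π N ((c : SeriesT p) • ζ)) at h1
    rw [truncT_smul] at h1
    exact h1.trans (Agree.add (fun _ _ _ => rfl)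
      (((supp_of_mem π h).agree_diffT π N).smul _)).symm

theorem normCoeff_thetaPS (ξ : SeriesT p) (r : ℕ) :
    normCoeff π n (thetaPS p ξ) r = r * normCoeff π n ξ r := by
  rw [normCoeff, normCoeff, coeff_thetaPS, mul_div_assoc]

theorem thetaPS_mem {ξ : SeriesT p} (h : ξ ∈ RingO π n) : thetaPS p ξ ∈ RingO π n := by
  refine ⟨fun r => ?_, ?_⟩
  · rw [normCoeff_thetaPS]; exact mul_mem (natCast_mem _ _) (h.1 r)
  · refine squeeze_zero_norm (fun r => ?_) (tendsto_zero_iff_norm_tendsto_zero.1 h.2)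
    rw [normCoeff_thetaPS, norm_mul]
    exact mul_le_of_le_one_left (norm_nonneg _) (natCast_mem π.integers r).2

/-- The derivation `t d/dt` of `O` over `O_q`. -/
def thetaO : Derivation π.integers (TypeO π n) (TypeO π n) :=
  Derivation.mk'
    { toFun := fun ξ => ⟨thetaPS p ξ.1, thetaPS_mem π n ξ.2⟩
      map_add' := fun ξ η => Subtype.ext (map_add (thetaPS p) ξ.1 η.1)
      map_smul' := fun c ξ => Subtype.ext
        ((thetaPS p).map_smul (c : PadicAlgCl p) ξ.1) }
    fun ξ η => Subtype.ext ((thetaPS p).leibniz ξ.1 η.1)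

/-- `D_{t,l}` as an `O`-linear endomorphism of `C`. -/
def relDiff (l : Fin n) : TypeC π n →ₗ[TypeO π n] TypeC π n where
  toFun ζ := ⟨diffX π l ζ.1, diffX_mem π ζ.2 l⟩
  map_add' ζ ζ' := Subtype.ext (diffX_add π ζ.2 ζ'.2 l)
  map_smul' c ζ := Subtype.ext (diffX_smul π ζ.2 c l)

/-- `∂` as an `O_q`-linear endomorphism of `C`. -/
def relConn : TypeC π n →ₗ[π.integers] TypeC π n where
  toFun ζ := ⟨diffT π ζ.1, diffT_mem π ζ.2⟩
  map_add' ζ ζ' := Subtype.ext (diffT_add π ζ.2 ζ'.2)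
  map_smul' c ζ := Subtype.ext (by
    have h := diffT_smul π ζ.2 (algebraMap π.integers (TypeO π n) c)
    have h0 : thetaPS p (algebraMap π.integers (TypeO π n) c).1 = 0 :=
      congrArg Subtype.val ((thetaO π n).map_algebraMap c)
    rw [h0, zero_smul, zero_add] at h
    have h1 : ∀ η : Laurent p n,
        (algebraMap π.integers (TypeO π n) c).1 • η = c • η :=
      fun η => algebraMap_smul (RingO π n) c η
    rw [h1, h1] at h
    exact h)

/-- The submodule `∑_l D_{t,l} C`. -/
def relBoundary : Submodule (TypeO π n) (TypeC π n) := ⨆ l, LinearMap.range (relDiff π n l)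

/-- The top cohomology `H^n(C, D_t) = C / ∑_l D_{t,l} C` of the Koszul complex of
`D_{t,1}, …, D_{t,n}` on `C`. -/
def RelH : Type := TypeC π n ⧸ relBoundary π n

instance : AddCommGroup (RelH π n) :=
  inferInstanceAs (AddCommGroup (TypeC π n ⧸ relBoundary π n))
instance : Module (TypeO π n) (RelH π n) :=
  inferInstanceAs (Module (TypeO π n) (TypeC π n ⧸ relBoundary π n))
instance : Module π.integers (RelH π n) :=
  inferInstanceAs (Module π.integers (TypeC π n ⧸ relBoundary π n))
instance : IsScalarTower π.integers (TypeO π n) (RelH π n) :=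
  inferInstanceAs (IsScalarTower π.integers (TypeO π n) (TypeC π n ⧸ relBoundary π n))

/-- The class in `H^n(C, D_t)` of an element of `C`. -/
def RelH.mk : TypeC π n →ₗ[TypeO π n] RelH π n := (relBoundary π n).mkQ

theorem relConn_boundary {ζ : TypeC π n} (h : ζ ∈ relBoundary π n) :
    relConn π n ζ ∈ relBoundary π n := by
  unfold relBoundary at *
  induction h using Submodule.iSup_induction' with
  | mem l x hx =>
    obtain ⟨y, rfl⟩ := hx
    refine Submodule.mem_iSup_of_mem l ⟨relConn π n y, Subtype.ext ?_⟩
    exact (diff_comm π y.2 l).symm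
  | zero => rw [map_zero]; exact zero_mem _
  | add x y _ _ hx hy => rw [map_add]; exact add_mem hx hy

/-- The connection induced by `∂` on `H^n(C, D_t)`. -/
def relHConn : RelH π n →ₗ[π.integers] RelH π n where
  toFun x := Quotient.map' (relConn π n) (fun x y h => by
    rw [Submodule.quotientRel_def] at h ⊢
    have := relConn_boundary π n h
    rwa [map_sub] at this) x
  map_add' x y := by
    obtain ⟨x, rfl⟩ := Submodule.mkQ_surjective (relBoundary π n) x
    obtain ⟨y, rfl⟩ := Submodule.mkQ_surjective (relBoundary π n) y
    exact congrArg (Submodule.mkQ (relBoundary π n)) ((relConn π n).map_add x y)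
  map_smul' c x := by
    obtain ⟨x, rfl⟩ := Submodule.mkQ_surjective (relBoundary π n) x
    exact congrArg (Submodule.mkQ (relBoundary π n)) ((relConn π n).map_smul c x)

theorem relHConn_mk (ζ : TypeC π n) : relHConn π n (RelH.mk π n ζ) = RelH.mk π n (relConn π n ζ) :=
  rfl

theorem relHConn_smul (c : TypeO π n) (x : RelH π n) :
    relHConn π n (c • x) = thetaO π n c • x + c • relHConn π n x := by
  obtain ⟨x, rfl⟩ := Submodule.mkQ_surjective (relBoundary π n) x
  have h : relConn π n (c • x) = thetaO π n c • x + c • relConn π n x :=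
    Subtype.ext (diffT_smul π x.2 c)
  change RelH.mk π n (relConn π n (c • x)) = thetaO π n c • RelH.mk π n x +
    c • RelH.mk π n (relConn π n x)
  rw [h, map_add, map_smul, map_smul]

/-- The exponent of `x_1 ⋯ x_j`. -/
def prefixVec (j : Fin (n + 1)) : Fin n → ℤ := fun l => if (l : ℕ) < j then 1 else 0

theorem gamma_pow_single_mem (j : Fin (n + 1)) :
    (Pi.single (prefixVec n j) (PowerSeries.C (π.gamma ^ (j : ℕ))) : Laurent p n) ∈ RelC π n := by
  have hm : mFun (prefixVec n j) = 0 := by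
    rw [mFun, ← Nat.bot_eq_zero, Finset.sup_eq_bot_iff]
    intro l _
    rw [prefixVec]
    split_ifs <;> simp
  have hw : wFun (prefixVec n j) = j := by
    have h := wFun_eq (prefixVec n j)
    rw [hm] at h
    have h2 : ∑ l, prefixVec n j l = (j : ℕ) := by
      simp only [prefixVec]
      rw [Finset.sum_boole, Fin.card_filter_val_lt, min_eq_right (by omega)]
    rw [h2] at h
    simp only [Nat.cast_zero, mul_zero, add_zero] at h
    exact_mod_cast h
  refine ⟨Pi.single (prefixVec n j) 1, fun u => ?_, fun ε hε => ⟨n + 1, fun u hu r => ?_⟩,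
    fun u => ?_⟩
  · by_cases h : u = prefixVec n j
    · subst h; rw [Pi.single_eq_same]; exact one_mem _
    · rw [Pi.single_eq_of_ne h]; exact zero_mem _
  · have h : u ≠ prefixVec n j := by
      rintro rfl
      rw [hw] at hu
      omega
    rw [Pi.single_eq_of_ne h, normCoeff, map_zero, zero_div, norm_zero]
    exact hε.le
  · by_cases h : u = prefixVec n j
    · subst h; rw [Pi.single_eq_same, Pi.single_eq_same, hm, hw, pow_zero, mul_one, mul_one]
    · rw [Pi.single_eq_of_ne h, Pi.single_eq_of_ne h, mul_zero]

/-- The classes `e_0 = 1` and `e_j = γ^j x_1 ⋯ x_j` in `H^n(C, D_t)`. -/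
def eVec (j : Fin (n + 1)) : RelH π n := RelH.mk π n ⟨_, gamma_pow_single_mem π n j⟩

/-- `S_k = Sym^k_O H^n(C, D_t)`. -/
abbrev SymH (k : ℕ) : Submodule (TypeO π n) (SymmetricAlgebra (TypeO π n) (RelH π n)) :=
  SymPow (TypeO π n) (RelH π n) k

/-- The connection `∂` on `S_k`, extending `∂` on `H^n(C, D_t)` by the Leibniz rule. -/
def symHConn (k : ℕ) : SymH π n k →ₗ[π.integers] SymH π n k :=
  symConn (thetaO π n) (relHConn π n) (relHConn_smul π n) k

/-- The element `γ^{(n+1) r} t^r` of `O`. -/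
def tMonomial (r : ℕ) : TypeO π n :=
  ⟨PowerSeries.monomial r (π.gamma ^ ((n + 1) * r)), by
    have hγ := π.gamma_ne_zero
    have h : ∀ s, normCoeff π n (PowerSeries.monomial r (π.gamma ^ ((n + 1) * r))) s =
        if s = r then 1 else 0 := fun s => by
      rw [normCoeff, PowerSeries.coeff_monomial]
      split_ifs with h
      · rw [h, div_self (pow_ne_zero _ hγ)]
      · rw [zero_div]
    refine ⟨fun s => ?_, ?_⟩
    · rw [h]; split_ifs
      · exact one_mem _
      · exact zero_mem _
    · refine tendsto_const_nhds.congr' (eventually_atTop.2 ⟨r + 1, fun s hs => ?_⟩)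
      rw [h, if_neg (by omega)]⟩

/-- `Fil^N S_k`, the `O_q`-module generated by the `γ^{(n+1) r} t^r e^i` with
`(n+1) r + w(i) ≤ N`. -/
def FilS (k N : ℕ) : Submodule π.integers (SymH π n k) :=
  Submodule.span π.integers {x | ∃ (r : ℕ) (i : SymIdx n k), (n + 1) * r + i.weight ≤ N ∧
    x = tMonomial π n r • symMonomial (R := TypeO π n) (eVec π n) i}

section Reduced

variable (F : Type*) [Field F]

/-- The matrix over `F[t]` of `ē_j ↦ ē_{j+1}` for `j < n` and `ē_n ↦ t ē_0`. -/
def redMatrix : Matrix (Fin (n + 1)) (Fin (n + 1)) (Polynomial F) :=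
  Matrix.of fun i j => if (i : ℕ) = j + 1 then 1 else
    if (j : ℕ) = n ∧ (i : ℕ) = 0 then Polynomial.X else 0

/-- The `F[t]`-linear map `∇` on `Sym^k` of the free `F[t]`-module on `ē_0, …, ē_n` which extends
`redMatrix` by the Leibniz rule, viewed as an `F`-linear map. -/
def redConn (k : ℕ) : SymPow (Polynomial F) (Fin (n + 1) → Polynomial F) k →ₗ[F]
    SymPow (Polynomial F) (Fin (n + 1) → Polynomial F) k :=
  symConn (0 : Derivation F (Polynomial F) (Polynomial F))
    ((Matrix.toLin' (redMatrix n F)).restrictScalars F)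
    (fun r m => by
      rw [Derivation.zero_apply, zero_smul, zero_add]
      exact (Matrix.toLin' (redMatrix n F)).map_smul r m) k

/-- The constant vectors `ē^i` with `i ∈ B` form a basis over `F` of the cokernel of `∇`. -/
def IsConstantBasis {k : ℕ} (B : Finset (SymIdx n k)) : Prop :=
  ∃ b : Module.Basis B F (CohOne (redConn n F k)), ∀ i : B,
    b i = Submodule.Quotient.mk (symMonomial (fun j => Pi.single j 1) (i : SymIdx n k))

end Reduced

/-- `d_k(n, p)`, the number of `i` with `i_0 + ⋯ + i_n = k` and `∑_j i_j ζ^j = 0`; here `ζ` is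
a primitive `(n+1)`-th root of unity in an algebraic closure of `𝔽_p`. -/
def dNum (n k : ℕ) (ζ : AlgebraicClosure (ZMod p)) : ℕ :=
  Nat.card {i : SymIdx n k // ∑ j : Fin (n + 1), (i.1 j : AlgebraicClosure (ZMod p)) * ζ ^ (j : ℕ) = 0}

end
end HyperKloosterman

/-!
In the variables `y_0 = γ t / (x_1 ⋯ x_n)` and `y_l = γ x_l`, the module `C` is the module of
restricted power series over `O_q` in `y_0, …, y_n`, and with `E_j = y_j ∂/∂y_j` the operators become
`D_{t,l} = (E_l + ∑_i c_i y_l^{p^i}) - (E_0 + ∑_i c_i y_0^{p^i})` and `∂ = E_0 + ∑_i c_i y_0^{p^i}`,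
where `c_0 = 1` and `p^{p^i - 1}` divides `c_i`. Filter by degree, where a factor `p` lowers the
degree by one. A term with `i ≥ 1` raises the degree by `p^i` and carries `p^i - 1 ≥ 1` factors `p`,
so it raises the filtration by one at most and is divisible by `p`; the terms `E_j` do not raise the
degree. To leading order `D_{t,l}` is therefore multiplication by `y_l - y_0`, and `∂` is
multiplication by `y_0`.

All results follow from two approximation principles for maps between modules of null families over
`O_q`: such a map is onto, compatibly with filtrations, if it is so to leading order
(`exists_preimage_fil`, `exists_preimage`), and it is injective if its leading part is injective
modulo the maximal ideal (`eq_zero_of_map_eq_zero`).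

The `y_l - y_0` form a regular sequence with quotient `O_q[y_0]`, to which each monomial
`γ^{(n+1) r} t^r e_j` contributes the power `y_0^{(n+1) r + j}`. Hence `e_0, …, e_n` is a basis of `H^n`
over `O` (`eBasis`). For the independence, the sum of the images of the commuting `D_{t,l}` is written
as the sum of the `D_{t,l} C_l`, where `C_l` consists of the series without `y_1, …, y_{l-1}`
(`exists_sum_diffY_eq`), and `⨁_l C_l ⊕ ⨁_j O e_j → C` is injective to leading order
(`mem_maximalIdeal_of_topMap`). The same decomposition computes the connection matrix: up to
`p` times terms of controlled filtration it is `e_j ↦ e_{j+1}`, `e_n ↦ γ^{n+1} t e_0`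
(`exists_relHConn_eVec`).

On `S_k` the leading part of `∂` is then the graded map that `∇` induces on the monomials
`t^r e^i` (`connS_unitFun_sub_mem`). If `t` is set to `1`, it becomes the derivation of the symmetric
power that extends the cyclic shift of `e_0, …, e_n`; its eigenvalues are the sums `∑_j i_j ζ^j`, so
the hypothesis `d_k(n, p) = 0` says that it is invertible (`isUnit_shiftMat`). It follows that `∇` is
injective and that its cokernel is spanned by constants; counting dimensions in each weight shows that
the cokernel has dimension `(n + k).choose n / (n + 1)` (`IsComplement.card_mul`). For a constant basis
`B`, the map `(u, c) ↦ ∇ u + ∑_{i ∈ B} c_i e^i` is bijective over the residue field, and by Nakayama's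
lemma in each weight also over `O_q`. The approximation principles, applied to
`(u, c) ↦ ∂ u + ∑_{i ∈ B} c_i e^i` (`cohMap`), give the vanishing of `H^0`, the basis of `H^1`, and the
estimate for the coefficients.
-/

namespace HyperKloosterman

noncomputable section

open Filter Topology

/-! ### Null families over a complete ring and their weight filtration -/

/-- The properties of the pair `(O_q, p)` on which the approximation arguments rest: `A` is
complete and separated for the `ϖ`-adic topology, and divisibility in `A` is a total preorder. -/
structure IsCoeffRing {A : Type*} [CommRing A] (ϖ : A) : Prop where
  complete : ∀ a : ℕ → A, ∃ s, ∀ M, ϖ ^ M ∣ s - ∑ m ∈ Finset.range M, ϖ ^ m * a m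
  separated : ∀ x, (∀ M, ϖ ^ M ∣ x) → x = 0
  ne_zero : ϖ ≠ 0
  not_isUnit : ¬ IsUnit ϖ
  dvd_total : ∀ a b : A, a ∣ b ∨ b ∣ a

section Core

variable {A : Type*} [CommRing A] (ϖ : A)

/-- The `A`-module of families `(f_j)` of elements of `A` that tend `ϖ`-adically to `0`. -/
def NullFun (J : Type*) : Submodule A (J → A) where
  carrier := {f | ∀ m, {j | ¬ ϖ ^ m ∣ f j}.Finite}
  zero_mem' m := by simp
  add_mem' {f g} hf hg m := ((hf m).union (hg m)).subset fun j hj => by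
    by_contra h
    rw [Set.mem_union, not_or] at h
    exact hj (dvd_add (not_not.1 h.1) (not_not.1 h.2))
  smul_mem' c f hf m := (hf m).subset fun j hj h => hj (Dvd.dvd.mul_left h c)

variable {ϖ} {J J₁ J₂ : Type*}

theorem nullFun_of_finite {f : J → A} (h : {j | f j ≠ 0}.Finite) : f ∈ NullFun ϖ J := fun _ =>
  h.subset fun _ hj h0 => hj (h0 ▸ dvd_zero _)

variable (ϖ) in
/-- The family with value `1` at `j` and `0` elsewhere. -/
def unitFun (j : J) : NullFun ϖ J :=
  ⟨fun i => open Classical in if i = j then 1 else 0, nullFun_of_finite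
    ((Set.finite_singleton j).subset fun i hi => by
      by_contra h
      exact hi (if_neg h))⟩

theorem unitFun_self (j : J) : (unitFun ϖ j).1 j = 1 := if_pos rfl

theorem unitFun_of_ne {i j : J} (h : i ≠ j) : (unitFun ϖ j).1 i = 0 := if_neg h

theorem unitFun_apply [DecidableEq J] (i j : J) : (unitFun ϖ j).1 i = if i = j then 1 else 0 := by
  split_ifs with h
  · rw [h, unitFun_self]
  · exact unitFun_of_ne h

/-- Restriction of families along an injective map of index sets. -/
def NullFun.comap (f : J₁ → J) (hf : Function.Injective f) : NullFun ϖ J →ₗ[A] NullFun ϖ J₁ where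
  toFun x := ⟨fun j => x.1 (f j), fun m => (x.2 m).preimage hf.injOn⟩
  map_add' _ _ := rfl
  map_smul' _ _ := rfl

/-- Extension of families by zero along an injective map of index sets. -/
def NullFun.extend (f : J₁ → J) (hf : Function.Injective f) : NullFun ϖ J₁ →ₗ[A] NullFun ϖ J where
  toFun x := ⟨Function.extend f x.1 0, fun m => ((x.2 m).image f).subset fun j hj => by
    by_cases h : ∃ i, f i = j
    · obtain ⟨i, rfl⟩ := h
      rw [Set.mem_ofPred_eq, hf.extend_apply] at hj
      exact ⟨i, hj, rfl⟩
    · rw [Set.mem_ofPred_eq, Function.extend_apply' _ _ _ h] at hj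
      exact absurd (dvd_zero _) hj⟩
  map_add' x y := Subtype.ext (by
    change Function.extend f (x.1 + y.1) 0 = Function.extend f x.1 0 + Function.extend f y.1 0
    rw [← Function.extend_add, add_zero])
  map_smul' c x := Subtype.ext (by
    funext j
    change Function.extend f (c • x.1) 0 j = c • Function.extend f x.1 0 j
    by_cases h : ∃ i, f i = j
    · obtain ⟨i, rfl⟩ := h
      rw [hf.extend_apply, hf.extend_apply, Pi.smul_apply]
    · rw [Function.extend_apply' _ _ _ h, Function.extend_apply' _ _ _ h, Pi.zero_apply, smul_zero])

theorem NullFun.extend_apply (f : J₁ → J) (hf : Function.Injective f) (x : NullFun ϖ J₁) (i : J₁) :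
    (NullFun.extend f hf x).1 (f i) = x.1 i := hf.extend_apply _ _ _

theorem NullFun.extend_apply_of_not (f : J₁ → J) (hf : Function.Injective f) (x : NullFun ϖ J₁)
    {j : J} (h : ¬ ∃ i, f i = j) : (NullFun.extend f hf x).1 j = 0 :=
  Function.extend_apply' _ _ _ h

theorem NullFun.extend_unitFun (f : J₁ → J) (hf : Function.Injective f) (i : J₁) :
    NullFun.extend f hf (unitFun ϖ i) = unitFun ϖ (f i) := by
  ext j
  by_cases h : ∃ i', f i' = j
  · obtain ⟨i', rfl⟩ := h
    rw [NullFun.extend_apply]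
    by_cases h' : i' = i
    · rw [h', unitFun_self, unitFun_self]
    · rw [unitFun_of_ne h', unitFun_of_ne (hf.ne h')]
  · rw [NullFun.extend_apply_of_not f hf _ h, unitFun_of_ne]
    rintro rfl
    exact h ⟨i, rfl⟩

theorem NullFun.comap_unitFun (f : J₁ → J) (hf : Function.Injective f) (i : J₁) :
    NullFun.comap f hf (unitFun ϖ (f i)) = unitFun ϖ i := by
  ext j
  change (unitFun ϖ (f i)).1 (f j) = _
  by_cases h' : j = i
  · rw [h', unitFun_self, unitFun_self]
  · rw [unitFun_of_ne h', unitFun_of_ne (hf.ne h')]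

theorem NullFun.comap_unitFun_of_not (f : J₁ → J) (hf : Function.Injective f) {j : J}
    (h : ¬ ∃ i, f i = j) : NullFun.comap f hf (unitFun ϖ j) = 0 := by
  ext i
  change (unitFun ϖ j).1 (f i) = _
  rw [unitFun_of_ne fun h' => h ⟨i, h'⟩]
  rfl

theorem NullFun.smul_apply (c : A) (x : NullFun ϖ J) (j : J) : (c • x).1 j = c * x.1 j := rfl

theorem NullFun.sum_apply {ι : Type*} (s : Finset ι) (f : ι → NullFun ϖ J) (j : J) :
    (∑ i ∈ s, f i).1 j = ∑ i ∈ s, (f i).1 j := by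
  rw [Submodule.coe_sum, Finset.sum_apply]

variable (ϖ) in
/-- The step `N` of the filtration by a weight function `wt` on families supported in `P`: the
entry at an index of weight `w > N` is divisible by `ϖ ^ (w - N)`. -/
def fil (wt : J → ℕ) (P : Set J) (N : ℕ) : Submodule A (NullFun ϖ J) where
  carrier := {f | (∀ j, ϖ ^ (wt j - N) ∣ f.1 j) ∧ ∀ j, j ∉ P → f.1 j = 0}
  zero_mem' := ⟨fun _ => dvd_zero _, fun _ _ => rfl⟩
  add_mem' hf hg := ⟨fun j => dvd_add (hf.1 j) (hg.1 j), fun j hj => by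
    change _ + _ = (0 : A)
    rw [hf.2 j hj, hg.2 j hj, add_zero]⟩
  smul_mem' c f hf := ⟨fun j => Dvd.dvd.mul_left (hf.1 j) c, fun j hj => by
    rw [NullFun.smul_apply, hf.2 j hj, mul_zero]⟩

variable (ϖ) in
/-- The families in step `N` of the filtration whose entries of weight exactly `N` are also
divisible by `ϖ`. -/
def filStrict (wt : J → ℕ) (P : Set J) (N : ℕ) : Submodule A (NullFun ϖ J) where
  carrier := {f | f ∈ fil ϖ wt P N ∧ ∀ j, wt j = N → ϖ ∣ f.1 j}
  zero_mem' := ⟨zero_mem _, fun _ _ => dvd_zero _⟩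
  add_mem' hf hg := ⟨add_mem hf.1 hg.1, fun j hj => dvd_add (hf.2 j hj) (hg.2 j hj)⟩
  smul_mem' c _ hf := ⟨Submodule.smul_mem _ c hf.1, fun j hj => Dvd.dvd.mul_left (hf.2 j hj) c⟩

theorem fil_mono (wt : J → ℕ) (P : Set J) {M N : ℕ} (h : M ≤ N) : fil ϖ wt P M ≤ fil ϖ wt P N :=
  fun _ hf => ⟨fun j => (pow_dvd_pow ϖ (by omega)).trans (hf.1 j), hf.2⟩

theorem unitFun_mem_fil {wt : J → ℕ} {P : Set J} {j : J} (hj : j ∈ P) {N : ℕ} (h : wt j ≤ N) :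
    unitFun ϖ j ∈ fil ϖ wt P N := by
  refine ⟨fun i => ?_, fun i hi => unitFun_of_ne ?_⟩
  · by_cases hij : i = j
    · rw [hij, Nat.sub_eq_zero_of_le h, pow_zero]; exact one_dvd _
    · rw [unitFun_of_ne hij]; exact dvd_zero _
  · rintro rfl; exact hi hj

theorem fil_lt_le_filStrict (wt : J → ℕ) (P : Set J) {M N : ℕ} (h : M < N) :
    fil ϖ wt P M ≤ filStrict ϖ wt P N := fun f hf =>
  ⟨fil_mono wt P h.le hf, fun j hj => (dvd_pow_self ϖ (by omega)).trans (hf.1 j)⟩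

theorem smul_fil_mem_filStrict {wt : J → ℕ} {P : Set J} {N : ℕ} {x : NullFun ϖ J}
    (h : x ∈ fil ϖ wt P (N + 1)) : ϖ • x ∈ filStrict ϖ wt P N := by
  refine ⟨⟨fun j => ?_, fun j hj => ?_⟩, fun j _ => dvd_mul_right _ _⟩
  · refine (pow_dvd_pow ϖ (show wt j - N ≤ (wt j - (N + 1)) + 1 by omega)).trans ?_
    rw [pow_succ', NullFun.smul_apply]
    exact mul_dvd_mul_left _ (h.1 j)
  · rw [NullFun.smul_apply, h.2 j hj, mul_zero]

theorem sum_smul_unitFun_apply (s : Finset J) (a : J → A) (j : J) :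
    (∑ i ∈ s, a i • unitFun ϖ i).1 j = open Classical in if j ∈ s then a j else 0 := by
  classical
  rw [NullFun.sum_apply]
  simp only [NullFun.smul_apply, unitFun_apply, mul_ite, mul_one, mul_zero]
  rw [Finset.sum_ite_eq]

variable [IsDomain A] (hA : IsCoeffRing ϖ)
include hA

/-- A family divisible by `ϖ` entry by entry is divisible by `ϖ` among null families. -/
theorem exists_smul_eq {x : NullFun ϖ J} (h : ∀ j, ϖ ∣ x.1 j) :
    ∃ y : NullFun ϖ J, x = ϖ • y := by
  choose g hg using h
  refine ⟨⟨g, fun m => (x.2 (m + 1)).subset fun j hj => ?_⟩, Subtype.ext (funext hg)⟩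
  rw [Set.mem_ofPred_eq] at *
  rwa [hg, pow_succ', mul_dvd_mul_iff_left hA.ne_zero]

theorem exists_smul_eq_fil {wt : J → ℕ} {P : Set J} {N : ℕ} {x : NullFun ϖ J}
    (h : ∀ j, ϖ ^ (1 + (wt j - N)) ∣ x.1 j) (hP : ∀ j, j ∉ P → x.1 j = 0) :
    ∃ y ∈ fil ϖ wt P N, x = ϖ • y := by
  obtain ⟨y, rfl⟩ := exists_smul_eq hA fun j => (dvd_pow_self ϖ (by omega)).trans (h j)
  refine ⟨y, ⟨fun j => ?_, fun j hj => ?_⟩, rfl⟩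
  · have := h j
    rwa [add_comm, pow_succ', NullFun.smul_apply, mul_dvd_mul_iff_left hA.ne_zero] at this
  · exact (mul_eq_zero.1 (hP j hj)).resolve_left hA.ne_zero

/-- `ϖ`-adic series of null families converge. -/
theorem exists_nullFun_limit (y : ℕ → NullFun ϖ J) : ∃ s : NullFun ϖ J, ∀ M, ∃ z : NullFun ϖ J,
    s = ∑ m ∈ Finset.range M, ϖ ^ m • y m + ϖ ^ M • z := by
  choose s hs using fun j => hA.complete fun m => (y m).1 j
  have hs' : s ∈ NullFun ϖ J := fun m => by
    refine ((Finset.range m).finite_toSet.biUnion fun i _ => (y i).2 m).subset fun j hj => ?_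
    by_contra hcon
    simp only [Set.mem_iUnion, not_exists, Set.mem_ofPred_eq, not_not] at hcon
    refine hj ((dvd_sub_left (Finset.dvd_sum fun i hi => ?_)).1 (hs j m))
    exact Dvd.dvd.mul_left (hcon i hi) _
  have key : ∀ (M : ℕ) (x : NullFun ϖ J), (∀ j, ϖ ^ M ∣ x.1 j) →
      ∃ z : NullFun ϖ J, x = ϖ ^ M • z := by
    intro M
    induction M with
    | zero => exact fun x _ => ⟨x, by rw [pow_zero, one_smul]⟩
    | succ M ih =>
      intro x hx
      obtain ⟨x', rfl⟩ := exists_smul_eq hA fun j => (dvd_pow_self ϖ (by omega)).trans (hx j)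
      obtain ⟨z, rfl⟩ := ih x' fun j => by
        have := hx j
        rwa [pow_succ', NullFun.smul_apply, mul_dvd_mul_iff_left hA.ne_zero] at this
      exact ⟨z, by rw [pow_succ', mul_smul]⟩
  refine ⟨⟨s, hs'⟩, fun M => ?_⟩
  obtain ⟨z, hz⟩ := key M (⟨s, hs'⟩ - ∑ m ∈ Finset.range M, ϖ ^ m • y m) fun j => by
    have : (⟨s, hs'⟩ - ∑ m ∈ Finset.range M, ϖ ^ m • y m : NullFun ϖ J).1 j =
        s j - ∑ m ∈ Finset.range M, ϖ ^ m * (y m).1 j := by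
      change s j - (∑ m ∈ Finset.range M, ϖ ^ m • y m : NullFun ϖ J).1 j = _
      rw [NullFun.sum_apply]
      rfl
    rw [this]
    exact hs j M
  exact ⟨z, by rw [← hz]; abel⟩

theorem eq_zero_of_forall_smul {x : NullFun ϖ J} (h : ∀ M : ℕ, ∃ z : NullFun ϖ J, x = ϖ ^ M • z) :
    x = 0 := by
  ext j
  refine hA.separated _ fun M => ?_
  obtain ⟨z, rfl⟩ := h M
  exact dvd_mul_right _ _

/-- Successive approximation: if modulo `ϖ` every element of `S m` lies in the image of `E m`, with
a remainder `ϖ x'` for some `x'` in `S (m + 1)`, then every element of `S 0` is the image of a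
`ϖ`-adic series `∑ ϖ ^ m y_m` with `y_m` in `E m`. -/
theorem exists_preimage_of_approx (Φ : NullFun ϖ J₁ →ₗ[A] NullFun ϖ J₂)
    (E : ℕ → Set (NullFun ϖ J₁)) (S : ℕ → Set (NullFun ϖ J₂))
    (h : ∀ m, ∀ x ∈ S m, ∃ y ∈ E m, ∃ x' ∈ S (m + 1), x = Φ y + ϖ • x') {x : NullFun ϖ J₂}
    (hx : x ∈ S 0) : ∃ (s : NullFun ϖ J₁) (y : ℕ → NullFun ϖ J₁), Φ s = x ∧ (∀ m, y m ∈ E m) ∧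
      ∀ M, ∃ z : NullFun ϖ J₁, s = ∑ m ∈ Finset.range M, ϖ ^ m • y m + ϖ ^ M • z := by
  choose! f hf g hg hfg using h
  let r : ℕ → NullFun ϖ J₂ := fun m => Nat.rec x (fun m z => g m z) m
  have hr : ∀ m, r m ∈ S m := fun m => by
    induction m with
    | zero => exact hx
    | succ m ih => exact hg m _ ih
  have hsum : ∀ M, x = Φ (∑ m ∈ Finset.range M, ϖ ^ m • f m (r m)) + ϖ ^ M • r M := fun M => by
    induction M with
    | zero => simp [r]
    | succ M ih =>
      have h1 := hfg M _ (hr M)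
      conv_lhs => rw [ih, h1]
      rw [Finset.sum_range_succ, map_add, map_smul, smul_add, ← mul_smul, ← pow_succ, add_assoc]
  obtain ⟨s, hs⟩ := exists_nullFun_limit hA fun m => f m (r m)
  refine ⟨s, fun m => f m (r m), ?_, fun m => hf m _ (hr m), hs⟩
  rw [← sub_eq_zero]
  refine eq_zero_of_forall_smul hA fun M => ?_
  obtain ⟨z, hz⟩ := hs M
  refine ⟨Φ z - r M, ?_⟩
  conv_lhs => rw [hsum M, hz]
  rw [map_add, map_smul, smul_sub]
  abel

theorem mem_fil_of_limit {wt : J → ℕ} {P : Set J} {N : ℕ} {s : NullFun ϖ J} {y : ℕ → NullFun ϖ J}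
    (hy : ∀ m, y m ∈ fil ϖ wt P (N + m))
    (hs : ∀ M, ∃ z : NullFun ϖ J, s = ∑ m ∈ Finset.range M, ϖ ^ m • y m + ϖ ^ M • z) :
    s ∈ fil ϖ wt P N := by
  refine ⟨fun j => ?_, fun j hj => hA.separated _ fun M => ?_⟩
  · obtain ⟨z, rfl⟩ := hs (wt j - N)
    refine dvd_add ?_ (dvd_mul_right _ _)
    rw [NullFun.sum_apply]
    refine Finset.dvd_sum fun m _ => ?_
    refine (pow_dvd_pow ϖ (show wt j - N ≤ m + (wt j - (N + m)) by omega)).trans ?_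
    rw [pow_add]
    exact mul_dvd_mul_left _ ((hy m).1 j)
  · obtain ⟨z, rfl⟩ := hs M
    refine dvd_add ?_ (dvd_mul_right _ _)
    rw [NullFun.sum_apply]
    refine Finset.dvd_sum fun m _ => ?_
    rw [NullFun.smul_apply, (hy m).2 j hj, mul_zero]
    exact dvd_zero _

/-- An element of `fil N` is, up to `ϖ • fil (N + 1)`, a finite combination of unit families of
weight at most `N`. -/
theorem exists_eq_sum_add_smul {wt : J → ℕ} (hfin : ∀ N, {j | wt j ≤ N}.Finite) {P : Set J} {N : ℕ}
    {x : NullFun ϖ J} (hx : x ∈ fil ϖ wt P N) : ∃ (s : Finset J), (∀ j ∈ s, wt j ≤ N ∧ j ∈ P) ∧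
      ∃ x' ∈ fil ϖ wt P (N + 1), x = ∑ j ∈ s, x.1 j • unitFun ϖ j + ϖ • x' := by
  classical
  set s := (hfin N).toFinset.filter (· ∈ P) with hs
  have hmem : ∀ j, j ∈ s ↔ wt j ≤ N ∧ j ∈ P := fun j => by simp [hs]
  have happ : ∀ j, (x - ∑ j ∈ s, x.1 j • unitFun ϖ j).1 j = if j ∈ s then 0 else x.1 j := by
    intro j
    change x.1 j - (∑ j ∈ s, x.1 j • unitFun ϖ j).1 j = _
    rw [sum_smul_unitFun_apply]
    split_ifs <;> simp
  obtain ⟨y, hy, hxy⟩ := exists_smul_eq_fil hA (wt := wt) (P := P) (N := N + 1)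
    (x := x - ∑ j ∈ s, x.1 j • unitFun ϖ j)
    (fun j => by
      rw [happ]
      split_ifs with hj
      · exact dvd_zero _
      · by_cases hP : j ∈ P
        · have hw : ¬ wt j ≤ N := fun h => hj ((hmem j).2 ⟨h, hP⟩)
          rw [show 1 + (wt j - (N + 1)) = wt j - N by omega]
          exact hx.1 j
        · rw [hx.2 j hP]; exact dvd_zero _)
    (fun j hj => by
      rw [happ]
      split_ifs
      · rfl
      · exact hx.2 j hj)
  exact ⟨s, fun j hj => (hmem j).1 hj, y, hy, by rw [← hxy]; abel⟩

/-- Filtered surjectivity: it suffices that every unit family is in the image of the step of the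
filtration given by its weight, up to terms of lower weight and terms divisible by `ϖ`. -/
theorem exists_preimage_fil {wt₁ : J₁ → ℕ} {wt₂ : J₂ → ℕ}
    (hfin : ∀ N, {j | wt₂ j ≤ N}.Finite) (Φ : NullFun ϖ J₁ →ₗ[A] NullFun ϖ J₂) (Q : Set J₁)
    (P : Set J₂)
    (hS : ∀ j ∈ P, ∃ y ∈ fil ϖ wt₁ Q (wt₂ j), Φ y - unitFun ϖ j ∈ filStrict ϖ wt₂ P (wt₂ j))
    {N : ℕ} {x : NullFun ϖ J₂} (hx : x ∈ fil ϖ wt₂ P N) : ∃ y ∈ fil ϖ wt₁ Q N, Φ y = x := by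
  classical
  -- `x` is in the image up to a multiple of `ϖ`, provided that this holds for unit families
  have hcomb : ∀ N, (∀ j ∈ P, wt₂ j ≤ N → ∃ y ∈ fil ϖ wt₁ Q N, ∃ x' ∈ fil ϖ wt₂ P (N + 1),
      unitFun ϖ j = Φ y + ϖ • x') → ∀ x ∈ fil ϖ wt₂ P N, ∃ y ∈ fil ϖ wt₁ Q N,
      ∃ x' ∈ fil ϖ wt₂ P (N + 1), x = Φ y + ϖ • x' := by
    intro N hN x hx
    obtain ⟨s, hs, x', hx', hxs⟩ := exists_eq_sum_add_smul hA hfin hx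
    choose! f hf g hg hfg using hN
    refine ⟨∑ j ∈ s, x.1 j • f j, sum_mem fun j hj => Submodule.smul_mem _ _
      (hf j (hs j hj).2 (hs j hj).1), ∑ j ∈ s, x.1 j • g j + x', add_mem (sum_mem fun j hj =>
      Submodule.smul_mem _ _ (hg j (hs j hj).2 (hs j hj).1)) hx', ?_⟩
    conv_lhs => rw [hxs]
    rw [map_sum, smul_add, ← add_assoc, Finset.smul_sum, ← Finset.sum_add_distrib]
    congr 1
    refine Finset.sum_congr rfl fun j hj => ?_
    rw [map_smul, smul_comm ϖ, ← smul_add, ← hfg j (hs j hj).2 (hs j hj).1]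
  have hunit : ∀ N, ∀ j ∈ P, wt₂ j ≤ N → ∃ y ∈ fil ϖ wt₁ Q N, ∃ x' ∈ fil ϖ wt₂ P (N + 1),
      unitFun ϖ j = Φ y + ϖ • x' := by
    intro N
    induction N using Nat.strong_induction_on with
    | _ N ih =>
      intro j hj hjN
      obtain ⟨y, hy, hr⟩ := hS j hj
      set r := Φ y - unitFun ϖ j with hrdef
      have hsplit : ∃ y' ∈ fil ϖ wt₁ Q N, ∃ x' ∈ fil ϖ wt₂ P (N + 1), r = Φ y' + ϖ • x' := by
        set w := wt₂ j with hw
        -- the part of `r` of weight less than `w` is handled by induction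
        have hlow : ∃ r₁ r₂, r = r₁ + ϖ • r₂ ∧ r₂ ∈ fil ϖ wt₂ P (w + 1) ∧
            (r₁ = 0 ∨ ∃ M < w, r₁ ∈ fil ϖ wt₂ P M) := by
          set s := (hfin w).toFinset.filter (fun j => j ∈ P ∧ wt₂ j < w) with hs
          have hmem : ∀ j, j ∈ s ↔ j ∈ P ∧ wt₂ j < w := fun j => by
            simp only [hs, Finset.mem_filter, Set.Finite.mem_toFinset, Set.mem_ofPred_eq]
            exact ⟨fun h => h.2, fun h => ⟨h.2.le, h⟩⟩
          obtain ⟨y₂, hy₂, hry⟩ := exists_smul_eq_fil hA (wt := wt₂) (P := P) (N := w + 1)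
            (x := r - ∑ j ∈ s, r.1 j • unitFun ϖ j)
            (fun i => by
              change _ ∣ r.1 i - (∑ j ∈ s, r.1 j • unitFun ϖ j).1 i
              rw [sum_smul_unitFun_apply]
              split_ifs with hi
              · rw [sub_self]; exact dvd_zero _
              · rw [sub_zero]
                by_cases hP : i ∈ P
                · have hiw : w ≤ wt₂ i := by
                    by_contra hcon
                    exact hi ((hmem i).2 ⟨hP, by omega⟩)
                  rcases hiw.eq_or_lt with h1 | h1
                  · rw [← h1, Nat.sub_eq_zero_of_le (by omega), add_zero, pow_one]
                    exact hr.2 i h1.symm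
                  · rw [show 1 + (wt₂ i - (w + 1)) = wt₂ i - w by omega]
                    exact hr.1.1 i
                · rw [hr.1.2 i hP]; exact dvd_zero _)
            (fun i hi => by
              change r.1 i - (∑ j ∈ s, r.1 j • unitFun ϖ j).1 i = 0
              rw [sum_smul_unitFun_apply, hr.1.2 i hi, ite_self, sub_zero])
          refine ⟨∑ j ∈ s, r.1 j • unitFun ϖ j, y₂, by rw [← hry]; abel, hy₂, ?_⟩
          by_cases hs0 : s = ∅
          · left; rw [hs0, Finset.sum_empty]
          · right
            obtain ⟨i, hi⟩ := Finset.nonempty_iff_ne_empty.2 hs0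
            have hi' := ((hmem i).1 hi).2
            refine ⟨w - 1, by omega, sum_mem fun j hj => Submodule.smul_mem _ _
              (unitFun_mem_fil ((hmem j).1 hj).1 ?_)⟩
            have := ((hmem j).1 hj).2
            omega
        obtain ⟨r₁, r₂, hr12, hr₂, h0 | ⟨M, hM, hr₁⟩⟩ := hlow
        · exact ⟨0, zero_mem _, r₂, fil_mono _ _ (by omega) hr₂, by rw [hr12, h0, map_zero]⟩
        · obtain ⟨y', hy', x', hx', e⟩ := hcomb M (ih M (by omega)) r₁ hr₁
          exact ⟨y', fil_mono _ _ (by omega) hy', x' + r₂, add_mem (fil_mono _ _ (by omega) hx')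
            (fil_mono _ _ (by omega) hr₂), by rw [hr12, e, smul_add]; abel⟩
      obtain ⟨y', hy', x', hx', e⟩ := hsplit
      refine ⟨y - y', sub_mem (fil_mono _ _ hjN hy) hy', -x', neg_mem hx', ?_⟩
      have : unitFun ϖ j = Φ y - r := by rw [hrdef]; abel
      rw [this, e, map_sub, smul_neg]
      abel
  obtain ⟨s, y, h1, h2, h3⟩ := exists_preimage_of_approx hA Φ (fun m => fil ϖ wt₁ Q (N + m))
    (fun m => fil ϖ wt₂ P (N + m)) (fun m x hx => hcomb (N + m) (hunit _) x hx)
    (x := x) (by simpa using hx)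
  exact ⟨s, mem_fil_of_limit hA h2 h3, h1⟩

/-- Under the hypothesis of `exists_preimage_fil`, all null families supported in `P` are in the
image. -/
theorem exists_preimage {wt₁ : J₁ → ℕ} {wt₂ : J₂ → ℕ}
    (hfin : ∀ N, {j | wt₂ j ≤ N}.Finite) (Φ : NullFun ϖ J₁ →ₗ[A] NullFun ϖ J₂) (Q : Set J₁)
    (P : Set J₂)
    (hS : ∀ j ∈ P, ∃ y ∈ fil ϖ wt₁ Q (wt₂ j), Φ y - unitFun ϖ j ∈ filStrict ϖ wt₂ P (wt₂ j))
    {x : NullFun ϖ J₂} (hx : ∀ j, j ∉ P → x.1 j = 0) :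
    ∃ y : NullFun ϖ J₁, (∀ j, j ∉ Q → y.1 j = 0) ∧ Φ y = x := by
  classical
  obtain ⟨s, y, h1, h2, h3⟩ := exists_preimage_of_approx hA Φ
    (fun _ => {y | ∀ j, j ∉ Q → y.1 j = 0}) (fun _ => {x | ∀ j, j ∉ P → x.1 j = 0})
    (fun m x hx => by
      set T := (x.2 1).toFinset with hT
      obtain ⟨x', hx'⟩ := exists_smul_eq hA (x := x - ∑ j ∈ T, x.1 j • unitFun ϖ j) fun j => by
        change _ ∣ x.1 j - (∑ j ∈ T, x.1 j • unitFun ϖ j).1 j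
        rw [sum_smul_unitFun_apply]
        split_ifs with hj
        · rw [sub_self]; exact dvd_zero _
        · rw [hT, Set.Finite.mem_toFinset, Set.mem_ofPred_eq, not_not, pow_one] at hj
          rwa [sub_zero]
      have hTP : ∀ j ∈ T, j ∈ P := fun j hj => by
        by_contra hcon
        rw [hT, Set.Finite.mem_toFinset, Set.mem_ofPred_eq, hx j hcon] at hj
        exact hj (dvd_zero _)
      have hfil : ∑ j ∈ T, x.1 j • unitFun ϖ j ∈ fil ϖ wt₂ P (T.sup wt₂) :=
        sum_mem fun j hj => Submodule.smul_mem _ _ (unitFun_mem_fil (hTP j hj) (Finset.le_sup hj))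
      obtain ⟨y, hy, hyx⟩ := exists_preimage_fil hA hfin Φ Q P hS hfil
      refine ⟨y, hy.2, x', fun j hj => ?_, by rw [hyx, ← hx']; abel⟩
      have h0 : (ϖ • x').1 j = 0 := by
        rw [← hx']
        change x.1 j - (∑ j ∈ T, x.1 j • unitFun ϖ j).1 j = 0
        rw [hx j hj, hfil.2 j hj, sub_zero]
      exact (mul_eq_zero.1 h0).resolve_left hA.ne_zero) hx
  refine ⟨s, fun j hj => hA.separated _ fun M => ?_, h1⟩
  obtain ⟨z, rfl⟩ := h3 M
  refine dvd_add ?_ (dvd_mul_right _ _)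
  rw [NullFun.sum_apply]
  refine Finset.dvd_sum fun m _ => ?_
  rw [NullFun.smul_apply, h2 m j hj, mul_zero]
  exact dvd_zero _

/-- A nonzero null family is a scalar multiple of one that has a unit among its entries. -/
theorem exists_smul_unit {x : NullFun ϖ J} (hx : x ≠ 0) :
    ∃ (c : A) (y : NullFun ϖ J) (j : J), c ≠ 0 ∧ x = c • y ∧ IsUnit (y.1 j) := by
  classical
  have h0 : ∃ j, x.1 j ≠ 0 := by
    by_contra! h
    exact hx (Subtype.ext (funext h))
  obtain ⟨j₀, hj₀⟩ := h0
  obtain ⟨m, hm⟩ : ∃ m, ¬ ϖ ^ m ∣ x.1 j₀ := by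
    by_contra! h
    exact hj₀ (hA.separated _ h)
  set T := (x.2 m).toFinset with hT
  have hmem : ∀ j, j ∈ T ↔ ¬ ϖ ^ m ∣ x.1 j := fun j => by simp [hT]
  have hmin : ∀ T' : Finset J, T'.Nonempty → ∃ j ∈ T', ∀ i ∈ T', x.1 j ∣ x.1 i := by
    intro T' hT'
    induction hT' using Finset.Nonempty.cons_induction with
    | singleton a => exact ⟨a, by simp, by simp⟩
    | cons a s ha hs ih =>
      obtain ⟨j, hj, hji⟩ := ih
      rcases hA.dvd_total (x.1 a) (x.1 j) with h | h
      · refine ⟨a, by simp, fun i hi => ?_⟩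
        rcases Finset.mem_cons.1 hi with rfl | hi
        · exact dvd_rfl
        · exact h.trans (hji i hi)
      · refine ⟨j, by simp [hj], fun i hi => ?_⟩
        rcases Finset.mem_cons.1 hi with rfl | hi
        · exact h
        · exact hji i hi
  obtain ⟨j, hj, hji⟩ := hmin T ⟨j₀, (hmem _).2 hm⟩
  have hjm : x.1 j ∣ ϖ ^ m := (hA.dvd_total _ _).resolve_right ((hmem j).1 hj)
  have hdiv : ∀ i, x.1 j ∣ x.1 i := fun i => by
    by_cases hi : i ∈ T
    · exact hji i hi
    · exact hjm.trans (not_not.1 fun h => hi ((hmem i).2 h))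
  have hxj : x.1 j ≠ 0 := fun h => (hmem j).1 hj (h ▸ dvd_zero _)
  choose g hg using hdiv
  refine ⟨x.1 j, ⟨g, fun l => (x.2 (m + l)).subset fun i hi hd => hi ?_⟩, j, hxj,
    Subtype.ext (funext hg), ?_⟩
  · rw [hg, pow_add] at hd
    have h2 : x.1 j * ϖ ^ l ∣ x.1 j * g i := (mul_dvd_mul_right hjm _).trans hd
    rwa [mul_dvd_mul_iff_left hxj] at h2
  · have : g j = 1 := mul_left_cancel₀ hxj (by rw [← hg, mul_one])
    change IsUnit (g j)
    rw [this]
    exact isUnit_one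

/-- Filtered injectivity: it suffices that the part of `Φ` that preserves weights is injective
modulo the maximal ideal. -/
theorem eq_zero_of_map_eq_zero [IsLocalRing A] {wt₁ : J₁ → ℕ} {wt₂ : J₂ → ℕ}
    (Φ : NullFun ϖ J₁ →ₗ[A] NullFun ϖ J₂) (Q : Set J₁)
    (h1 : ∀ j ∈ Q, Φ (unitFun ϖ j) ∈ fil ϖ wt₂ Set.univ (wt₁ j))
    (h2 : ∀ (N : ℕ) (s : Finset J₁) (a : J₁ → A), (∀ j ∈ s, j ∈ Q ∧ wt₁ j = N) →
      (∀ i, wt₂ i = N → ∑ j ∈ s, a j * (Φ (unitFun ϖ j)).1 i ∈ IsLocalRing.maximalIdeal A) →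
      ∀ j ∈ s, a j ∈ IsLocalRing.maximalIdeal A)
    {x : NullFun ϖ J₁} (hx : ∀ j, j ∉ Q → x.1 j = 0) (h : Φ x = 0) : x = 0 := by
  classical
  by_contra hne
  obtain ⟨c, y, j₀, hc, rfl, hy⟩ := exists_smul_unit hA hne
  have hϖ : ϖ ∈ IsLocalRing.maximalIdeal A := hA.not_isUnit
  have hΦ : Φ y = 0 := by
    ext i
    have := congrArg (fun z : NullFun ϖ J₂ => z.1 i) h
    rw [map_smul] at this
    exact (mul_eq_zero.1 this).resolve_left hc
  have hyQ : ∀ j, j ∉ Q → y.1 j = 0 := fun j hj => (mul_eq_zero.1 (hx j hj)).resolve_left hc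
  set T := (y.2 1).toFinset with hT
  have hmem : ∀ j, j ∈ T ↔ ¬ ϖ ∣ y.1 j := fun j => by simp [hT]
  have hTQ : ∀ j ∈ T, j ∈ Q := fun j hj => by
    by_contra hcon
    exact (hmem j).1 hj (hyQ j hcon ▸ dvd_zero _)
  have hunitT : ∀ j, IsUnit (y.1 j) → j ∈ T := fun j hj => (hmem j).2 fun hd =>
    hA.not_isUnit (isUnit_of_dvd_unit hd hj)
  set U := T.filter fun j => IsUnit (y.1 j) with hU
  obtain ⟨j₁, hj₁, hmax⟩ := U.exists_max_image wt₁ ⟨j₀, Finset.mem_filter.2 ⟨hunitT _ hy, hy⟩⟩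
  set N := wt₁ j₁ with hN
  obtain ⟨y', hy'⟩ := exists_smul_eq hA (x := y - ∑ j ∈ T, y.1 j • unitFun ϖ j) fun j => by
    change _ ∣ y.1 j - (∑ j ∈ T, y.1 j • unitFun ϖ j).1 j
    rw [sum_smul_unitFun_apply]
    split_ifs with hj
    · rw [sub_self]; exact dvd_zero _
    · rw [sub_zero]; exact not_not.1 fun hd => hj ((hmem j).2 hd)
  have hΦT : ∑ j ∈ T, y.1 j • Φ (unitFun ϖ j) = -(ϖ • Φ y') := by
    rw [← map_smul, ← hy', map_sub, hΦ, map_sum, zero_sub, neg_neg]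
    exact Finset.sum_congr rfl fun j _ => (map_smul _ _ _).symm
  have key := h2 N (T.filter fun j => wt₁ j = N) y.1 (fun j hj =>
    ⟨hTQ j (Finset.mem_filter.1 hj).1, (Finset.mem_filter.1 hj).2⟩) (fun i hi => by
    have e := congrArg (fun z : NullFun ϖ J₂ => z.1 i) hΦT
    simp only [NullFun.sum_apply, NullFun.smul_apply] at e
    rw [← Finset.sum_filter_add_sum_filter_not T (fun j => wt₁ j = N)] at e
    rw [eq_sub_of_add_eq e]
    refine sub_mem (neg_mem (Ideal.mul_mem_right _ _ hϖ)) (sum_mem fun j hj => ?_)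
    rw [Finset.mem_filter] at hj
    rcases lt_or_gt_of_ne hj.2 with hlt | hgt
    · refine Ideal.mul_mem_left _ _ (Ideal.mem_of_dvd _ ((dvd_pow_self ϖ ?_).trans
        ((h1 j (hTQ j hj.1)).1 i)) hϖ)
      omega
    · refine Ideal.mul_mem_right _ _ fun hu => ?_
      have := hmax j (Finset.mem_filter.2 ⟨hj.1, hu⟩)
      omega) j₁ (Finset.mem_filter.2 ⟨(Finset.mem_filter.1 hj₁).1, rfl⟩)
  exact key (Finset.mem_filter.1 hj₁).2

end Core

/-! ### The ring of integers `O_q` and the coefficients of the differentials -/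

namespace DworkPi

variable {p a : ℕ} [Fact p.Prime] (π : DworkPi p a)

theorem finiteDimensional_baseField (ha : 1 ≤ a) : FiniteDimensional ℚ_[p] π.baseField := by
  have hp := (Fact.out : p.Prime).two_le
  have hpa : 0 < p ^ a - 1 := by
    have : 1 < p ^ a := Nat.one_lt_pow (by omega) (by omega)
    omega
  have hfin : {x : PadicAlgCl p | x ^ (p ^ a - 1) = 1}.Finite := by
    classical
    refine ((Polynomial.nthRoots (p ^ a - 1) (1 : PadicAlgCl p)).toFinset.finite_toSet).subset
      fun x hx => ?_
    simpa only [Finset.mem_coe, Multiset.mem_toFinset, Polynomial.mem_nthRoots hpa,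
      Set.mem_ofPred_eq] using hx
  have : Finite ↥({x : PadicAlgCl p | x ^ (p ^ a - 1) = 1} ∪ {π.root}) :=
    (hfin.union (Set.finite_singleton _)).to_subtype
  exact IntermediateField.finiteDimensional_adjoin fun x _ =>
    (PadicAlgCl.isAlgebraic p).isAlgebraic x |>.isIntegral

theorem isComplete_baseField (ha : 1 ≤ a) : IsComplete (π.baseField : Set (PadicAlgCl p)) := by
  have := π.finiteDimensional_baseField ha
  have : FiniteDimensional ℚ_[p] (Subalgebra.toSubmodule π.baseField.toSubalgebra) := this
  exact Submodule.complete_of_finiteDimensional (𝕜 := ℚ_[p])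
    (Subalgebra.toSubmodule π.baseField.toSubalgebra)

theorem dvd_iff_norm_le (x y : π.integers) :
    y ∣ x ↔ ‖(x : PadicAlgCl p)‖ ≤ ‖(y : PadicAlgCl p)‖ := by
  constructor
  · rintro ⟨z, rfl⟩
    rw [Subring.coe_mul, norm_mul]
    exact mul_le_of_le_one_right (norm_nonneg _) z.2.2
  · intro h
    by_cases hy : (y : PadicAlgCl p) = 0
    · rw [hy, norm_zero] at h
      have hx : x = 0 := Subtype.ext (norm_le_zero_iff.1 h)
      rw [hx]; exact dvd_zero _
    · refine ⟨⟨(x : PadicAlgCl p) / y, div_mem x.2.1 y.2.1, ?_⟩, Subtype.ext ?_⟩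
      · rw [norm_div]; exact div_le_one_of_le₀ h (norm_nonneg _)
      · exact (mul_div_cancel₀ _ hy).symm

theorem norm_natCast_pow (m : ℕ) :
    ‖(((p : π.integers) ^ m : π.integers) : PadicAlgCl p)‖ = ((p : ℝ)⁻¹) ^ m := by
  rw [Subring.coe_pow, norm_pow, Subring.coe_natCast, norm_p]

theorem pow_dvd_iff (m : ℕ) (x : π.integers) :
    (p : π.integers) ^ m ∣ x ↔ ‖(x : PadicAlgCl p)‖ ≤ ((p : ℝ)⁻¹) ^ m := by
  rw [dvd_iff_norm_le, norm_natCast_pow]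

theorem inv_prime_pos (p : ℕ) [Fact p.Prime] : (0 : ℝ) < (p : ℝ)⁻¹ :=
  inv_pos.2 (by exact_mod_cast (Fact.out : p.Prime).pos)

theorem inv_prime_lt_one (p : ℕ) [Fact p.Prime] : (p : ℝ)⁻¹ < 1 :=
  inv_lt_one_of_one_lt₀ (by exact_mod_cast (Fact.out : p.Prime).one_lt)

theorem exists_pow_lt {ε : ℝ} (hε : 0 < ε) : ∃ m : ℕ, ((p : ℝ)⁻¹) ^ m < ε :=
  exists_pow_lt_of_lt_one hε (inv_prime_lt_one p)

theorem not_isUnit_natCast : ¬ IsUnit (p : π.integers) := by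
  rw [isUnit_integers_iff, Subring.coe_natCast, norm_p]
  exact (inv_prime_lt_one p).ne

theorem natCast_mem_maximalIdeal : (p : π.integers) ∈ IsLocalRing.maximalIdeal π.integers :=
  π.not_isUnit_natCast

theorem natCast_ne_zero : (p : π.integers) ≠ 0 := fun h => by
  have := congrArg (fun x : π.integers => ‖(x : PadicAlgCl p)‖) h
  simp only [Subring.coe_natCast, norm_p, Subring.coe_zero, norm_zero] at this
  exact (inv_prime_pos p).ne' this

/-- `O_q` is complete, because `ℚ_q(γ^{1/q})` is finite over `ℚ_p`. -/
theorem isCoeffRing (ha : 1 ≤ a) : IsCoeffRing (p : π.integers) where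
  complete b := by
    have h0 := inv_prime_pos p
    have hterm : ∀ m, ‖(((p : π.integers) ^ m * b m : π.integers) : PadicAlgCl p)‖ ≤
        ((p : ℝ)⁻¹) ^ m := fun m => (π.pow_dvd_iff m _).1 (dvd_mul_right _ _)
    set S : ℕ → π.integers := fun M => ∑ m ∈ Finset.range M, (p : π.integers) ^ m * b m with hS
    have hdiff : ∀ M N, M ≤ N → ‖(S N : PadicAlgCl p) - S M‖ ≤ ((p : ℝ)⁻¹) ^ M := by
      intro M N h
      change ‖((S N - S M : π.integers) : PadicAlgCl p)‖ ≤ _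
      simp only [hS]
      rw [← Finset.sum_range_add_sum_Ico _ h, add_sub_cancel_left]
      refine (π.pow_dvd_iff M _).1 (Finset.dvd_sum fun m hm => ?_)
      exact Dvd.dvd.mul_right (pow_dvd_pow _ (Finset.mem_Ico.1 hm).1) _
    have hc : CauchySeq fun M => (S M : PadicAlgCl p) := by
      refine cauchySeq_of_le_geometric _ 1 (inv_prime_lt_one p) fun M => ?_
      rw [one_mul, dist_comm, dist_eq_norm]
      exact hdiff M (M + 1) (by omega)
    obtain ⟨s, hs, hlim⟩ := cauchySeq_tendsto_of_isComplete (π.isComplete_baseField ha)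
      (fun M => (S M).2.1) hc
    have hbound : ∀ M, ‖s - S M‖ ≤ ((p : ℝ)⁻¹) ^ M := fun M =>
      le_of_tendsto (hlim.sub_const _).norm (eventually_atTop.2 ⟨M, fun N hN => hdiff M N hN⟩)
    have hs1 : ‖s‖ ≤ 1 := by simpa [hS] using hbound 0
    exact ⟨⟨s, hs, hs1⟩, fun M => (π.pow_dvd_iff M _).2 (hbound M)⟩
  separated x hx := by
    refine Subtype.ext (norm_le_zero_iff.1 (le_of_forall_pos_le_add fun ε hε => ?_))
    obtain ⟨m, hm⟩ := exists_pow_lt (p := p) hε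
    rw [zero_add]
    exact ((π.pow_dvd_iff m x).1 (hx m)).trans hm.le
  ne_zero := π.natCast_ne_zero
  not_isUnit := π.not_isUnit_natCast
  dvd_total x y := by
    rw [dvd_iff_norm_le, dvd_iff_norm_le]
    exact le_total _ _

instance charP_residueField : CharP (IsLocalRing.ResidueField π.integers) p := by
  refine (CharP.charP_iff_prime_eq_zero Fact.out).2 ?_
  rw [← map_natCast (IsLocalRing.residue π.integers), IsLocalRing.residue_eq_zero_iff]
  exact π.natCast_mem_maximalIdeal

/-- The coefficient `c_i = γ_i p^i / γ^{p^i}` of `(γ x_l)^{p^i}` in `x_l ∂H/∂x_l`. -/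
def unitCoef (i : ℕ) : π.integers := ⟨_, π.coef_div_mem i⟩

theorem unitCoef_zero : π.unitCoef 0 = 1 := by
  refine Subtype.ext ?_
  change π.coef 0 / π.gamma ^ p ^ 0 = 1
  rw [coef, gammaSum]
  simp [π.gamma_ne_zero]

/-- The valuation of `c_i` is at least `p ^ i - 1`: a factor `(γ x_l)^{p^i}` of weight `p ^ i`
comes with as many factors `p` as its weight exceeds `1`. -/
theorem pow_dvd_unitCoef (i : ℕ) : (p : π.integers) ^ (p ^ i - 1) ∣ π.unitCoef i := by
  have hp := (Fact.out : p.Prime).two_le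
  have hp0 : (0 : ℝ) < p := by exact_mod_cast (by omega : 0 < p)
  have hg : 0 < ‖π.gamma‖ := norm_pos_iff.2 π.gamma_ne_zero
  have hterm : ∀ d, 1 ≤ d → ‖π.gamma ^ p ^ (i + d) / (p : PadicAlgCl p) ^ (i + d)‖ *
      ((p : ℝ)⁻¹) ^ i ≤ ‖π.gamma‖ ^ p ^ i * ((p : ℝ)⁻¹) ^ (p ^ i - 1) := by
    intro d hd
    have hG : (p - 1) * ∑ e ∈ Finset.range d, p ^ e + 1 = p ^ d := by
      have h := Nat.geomSum_eq hp d
      have hdvd : p - 1 ∣ p ^ d - 1 := by simpa using Nat.sub_dvd_pow_sub_pow p 1 d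
      rw [h, Nat.mul_div_cancel' hdvd]
      have : 0 < p ^ d := by positivity
      omega
    set G := ∑ e ∈ Finset.range d, p ^ e with hGdef
    have hGd : d ≤ G := by
      calc d = ∑ e ∈ Finset.range d, 1 := by simp
        _ ≤ G := Finset.sum_le_sum fun e _ => Nat.one_le_pow _ _ (by omega)
    have hpi : 1 ≤ p ^ i := Nat.one_le_pow _ _ (by omega)
    have hexp : (i + d) + (p ^ i - 1) ≤ i + p ^ i * G := by
      obtain ⟨q, hq⟩ := Nat.exists_eq_add_of_le hpi
      rw [hq]
      have : 1 + q - 1 = q := by omega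
      rw [this]
      nlinarith
    obtain ⟨R, hR⟩ := Nat.exists_eq_add_of_le hexp
    have h1 : p ^ (i + d) = p ^ i + (p - 1) * (p ^ i * G) := by
      rw [pow_add, ← hG]; ring
    rw [norm_div, norm_pow, norm_pow, norm_p, h1, pow_add, pow_mul, norm_gamma_pow,
      div_eq_mul_inv]
    have h2 : ((p : ℝ)⁻¹) ^ (i + p ^ i * G) * ((((p : ℝ)⁻¹) ^ (i + d))⁻¹) ≤
        ((p : ℝ)⁻¹) ^ (p ^ i - 1) := by
      have e : ((p : ℝ)⁻¹) ^ (i + p ^ i * G) * ((((p : ℝ)⁻¹) ^ (i + d))⁻¹) =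
          ((p : ℝ)⁻¹) ^ (p ^ i - 1) * ((p : ℝ)⁻¹) ^ R := by
        have h0 : ((p : ℝ)⁻¹) ^ (i + d) ≠ 0 := by positivity
        rw [hR, pow_add _ (i + d + (p ^ i - 1)), pow_add _ (i + d), mul_assoc, mul_assoc]
        rw [mul_comm (((p : ℝ)⁻¹) ^ (i + d)), mul_assoc, mul_assoc, inv_mul_cancel₀ h0, mul_one]
      rw [e]
      refine mul_le_of_le_one_right (by positivity) (pow_le_one₀ (by positivity) ?_)
      exact (inv_prime_lt_one p).le
    calc _ = ‖π.gamma‖ ^ p ^ i *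
          (((p : ℝ)⁻¹) ^ (i + p ^ i * G) * ((((p : ℝ)⁻¹) ^ (i + d))⁻¹)) := by
            rw [pow_add ((p : ℝ)⁻¹) i]; ring
      _ ≤ _ := by gcongr
  set f : ℕ → PadicAlgCl p := fun j => π.gamma ^ p ^ j / (p : PadicAlgCl p) ^ j with hf
  have hs : Tendsto (fun M => ∑ j ∈ Finset.range M, f j) atTop (𝓝 0) :=
    π.hasSum_root.tendsto_sum_nat
  have ht : Tendsto (fun M => ‖π.gammaSum i - ∑ j ∈ Finset.range M, f j‖ * ((p : ℝ)⁻¹) ^ i) atTop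
      (𝓝 (‖π.gammaSum i - 0‖ * ((p : ℝ)⁻¹) ^ i)) :=
    ((tendsto_const_nhds.sub hs).norm).mul_const _
  have hb : ∀ M ≥ i + 1, ‖π.gammaSum i - ∑ j ∈ Finset.range M, f j‖ * ((p : ℝ)⁻¹) ^ i ≤
      ‖π.gamma‖ ^ p ^ i * ((p : ℝ)⁻¹) ^ (p ^ i - 1) := by
    intro M hM
    have h1 : ∑ j ∈ Finset.range M, f j = π.gammaSum i + ∑ j ∈ Finset.Ico (i + 1) M, f j := by
      rw [gammaSum, Finset.sum_range_add_sum_Ico _ hM]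
    have hq : 0 < ((p : ℝ)⁻¹) ^ i := by positivity
    rw [h1, sub_add_cancel_left, norm_neg, ← le_div_iff₀ hq]
    refine IsUltrametricDist.norm_sum_le_of_forall_le_of_nonneg (by positivity) fun j hj => ?_
    rw [Finset.mem_Ico] at hj
    rw [le_div_iff₀ hq]
    have := hterm (j - i) (by omega)
    rwa [show i + (j - i) = j by omega] at this
  have key := le_of_tendsto ht (eventually_atTop.2 ⟨i + 1, hb⟩)
  rw [sub_zero] at key
  rw [pow_dvd_iff]
  change ‖π.gammaSum i * (p : PadicAlgCl p) ^ i / π.gamma ^ p ^ i‖ ≤ _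
  rw [norm_div, norm_mul, norm_pow, norm_pow, norm_p, div_le_iff₀ (by positivity)]
  rw [mul_comm (((p : ℝ)⁻¹) ^ (p ^ i - 1))]
  exact key

end DworkPi

/-! ### Monomial bases of symmetric powers -/

section SymmetricPowers

instance (n k : ℕ) : Fintype (SymIdx n k) :=
  Fintype.ofEquiv _ (Sym.equivNatSumOfFintype (Fin (n + 1)) k)

theorem card_symIdx (n k : ℕ) : Fintype.card (SymIdx n k) = (n + k).choose n := by
  rw [← Fintype.card_congr (Sym.equivNatSumOfFintype (Fin (n + 1)) k), Sym.card_sym_eq_choose,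
    Fintype.card_fin, show n + 1 + k - 1 = n + k by omega, Nat.choose_symm_add]

instance (n k : ℕ) : DecidableEq (SymIdx n k) := Classical.decEq _

variable {n k : ℕ}

/-- The index of `e^i · e_l / e_j`. If `e_j` does not divide `e^i`, it is `i`. -/
def moveIdx (i : SymIdx n k) (j l : Fin (n + 1)) : SymIdx n k :=
  if h : i.1 j = 0 then i else
    ⟨fun m => i.1 m - (if m = j then 1 else 0) + (if m = l then 1 else 0), by
      have h1 : ∑ m, (i.1 m - (if m = j then 1 else 0)) + ∑ m, (if m = j then 1 else 0) =
          ∑ m, i.1 m := by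
        rw [← Finset.sum_add_distrib]
        refine Finset.sum_congr rfl fun m _ => ?_
        split_ifs with hm
        · subst hm; omega
        · rfl
      rw [i.2, Finset.sum_ite_eq' Finset.univ j fun _ => 1, if_pos (Finset.mem_univ j)] at h1
      rw [Finset.sum_add_distrib, Finset.sum_ite_eq' Finset.univ l fun _ => 1,
        if_pos (Finset.mem_univ l), h1]⟩

theorem moveIdx_apply {i : SymIdx n k} {j : Fin (n + 1)} (h : i.1 j ≠ 0) (l m : Fin (n + 1)) :
    (moveIdx i j l).1 m = i.1 m - (if m = j then 1 else 0) + (if m = l then 1 else 0) := by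
  rw [moveIdx, dif_neg h]

theorem moveIdx_self (i : SymIdx n k) (j : Fin (n + 1)) : moveIdx i j j = i := by
  by_cases h : i.1 j = 0
  · rw [moveIdx, dif_pos h]
  · refine Subtype.ext (funext fun m => ?_)
    rw [moveIdx_apply h]
    split_ifs with hm
    · subst hm; omega
    · rfl

theorem weight_moveIdx {i : SymIdx n k} {j : Fin (n + 1)} (h : i.1 j ≠ 0) (l : Fin (n + 1)) :
    (moveIdx i j l).weight + j = i.weight + l := by
  have hj : (j : ℕ) = ∑ m : Fin (n + 1), (m : ℕ) * (if m = j then 1 else 0) := by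
    simp
  have hl : (l : ℕ) = ∑ m : Fin (n + 1), (m : ℕ) * (if m = l then 1 else 0) := by
    simp
  rw [SymIdx.weight, SymIdx.weight]
  conv_lhs => rw [hj, ← Finset.sum_add_distrib]
  conv_rhs => rw [hl, ← Finset.sum_add_distrib]
  refine Finset.sum_congr rfl fun m _ => ?_
  rw [moveIdx_apply h, ← mul_add, ← mul_add]
  congr 1
  split_ifs with h1 h2 h2
  · subst h1; omega
  · subst h1; omega
  · omega
  · omega

theorem weight_le (i : SymIdx n k) : i.weight ≤ n * k := by
  conv_rhs => rw [← i.2, Finset.mul_sum]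
  exact Finset.sum_le_sum fun j _ => Nat.mul_le_mul_right _ (by omega)

section Basis

variable {R M : Type*} [CommRing R] [AddCommGroup M] [Module R M]

theorem linearIndependent_symMonomial (e : Module.Basis (Fin (n + 1)) R M) :
    LinearIndependent R (symMonomial (R := R) (k := k) e) := by
  have h1 : LinearIndependent R fun i : SymIdx n k =>
      MvPolynomial.basisMonomials (Fin (n + 1)) R (Finsupp.equivFunOnFinite.symm i.1) :=
    (MvPolynomial.basisMonomials (Fin (n + 1)) R).linearIndependent.comp _
      (Finsupp.equivFunOnFinite.symm.injective.comp Subtype.val_injective)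
  refine LinearIndependent.of_comp ((SymmetricAlgebra.equivMvPolynomial e).toLinearMap ∘ₗ
    (SymPow R M k).subtype) ?_
  have h2 : (fun i : SymIdx n k => SymmetricAlgebra.equivMvPolynomial e
      (symMonomial (R := R) e i).1) = fun i : SymIdx n k =>
      MvPolynomial.basisMonomials (Fin (n + 1)) R (Finsupp.equivFunOnFinite.symm i.1) := by
    funext i
    rw [MvPolynomial.coe_basisMonomials]
    simp only [MvPolynomial.monomial_eq]
    change SymmetricAlgebra.equivMvPolynomial e (∏ j, SymmetricAlgebra.ι R M (e j) ^ i.1 j) = _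
    rw [map_prod, map_one, one_mul, Finsupp.prod_fintype _ _ fun _ => pow_zero _]
    refine Finset.prod_congr rfl fun j _ => ?_
    rw [map_pow, SymmetricAlgebra.equivMvPolynomial_ι_apply]
    rfl
  rw [← h2] at h1
  exact h1

open scoped Pointwise in
theorem span_symMonomial (e : Module.Basis (Fin (n + 1)) R M) :
    ⊤ ≤ Submodule.span R (Set.range (symMonomial (R := R) (k := k) e)) := by
  have hspan : ∀ k : ℕ, SymPow R M k ≤ Submodule.span R
      (Set.range fun i : SymIdx n k => ∏ j, SymmetricAlgebra.ι R M (e j) ^ i.1 j) := by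
    intro k
    have hr : LinearMap.range (SymmetricAlgebra.ι R M) =
        Submodule.span R (Set.range fun j => SymmetricAlgebra.ι R M (e j)) := by
      rw [LinearMap.range_eq_map, ← e.span_eq, Submodule.map_span, ← Set.range_comp]
      rfl
    rw [SymPow, hr, Submodule.span_pow]
    refine Submodule.span_mono ?_
    induction k with
    | zero =>
      rw [pow_zero, Set.one_subset]
      refine ⟨⟨0, by simp⟩, by simp⟩
    | succ k ih =>
      rw [pow_succ]
      rintro _ ⟨x, hx, _, ⟨l, rfl⟩, rfl⟩
      obtain ⟨i, rfl⟩ := ih hx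
      refine ⟨⟨i.1 + Pi.single l 1, ?_⟩, ?_⟩
      · simp [Finset.sum_add_distrib, i.2]
      · simp only [Pi.add_apply, pow_add, Finset.prod_mul_distrib]
        congr 1
        rw [Finset.prod_eq_single l]
        · simp
        · intro j _ hj
          simp [hj]
        · simp
  rintro ⟨x, hx⟩ -
  have hx' := hspan k hx
  have hmap : Submodule.span R
      (Set.range fun i : SymIdx n k => ∏ j, SymmetricAlgebra.ι R M (e j) ^ i.1 j) =
      (Submodule.span R (Set.range (symMonomial (R := R) (k := k) e))).map
        (SymPow R M k).subtype := by
    rw [Submodule.map_span, ← Set.range_comp]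
    rfl
  rw [hmap] at hx'
  obtain ⟨y, hy, rfl⟩ := hx'
  exact hy

/-- A basis `e` of `M` gives the basis of monomials `e^i` of `Sym^k M`. -/
def symBasis (k : ℕ) (e : Module.Basis (Fin (n + 1)) R M) :
    Module.Basis (SymIdx n k) R (SymPow R M k) :=
  Module.Basis.mk (linearIndependent_symMonomial e) (span_symMonomial e)

theorem symBasis_apply (e : Module.Basis (Fin (n + 1)) R M) (i : SymIdx n k) :
    symBasis k e i = symMonomial (R := R) e i := Module.Basis.mk_apply _ _ i

end Basis

section Leibniz

variable {S R M : Type*} [CommRing S] [CommRing R] [Algebra S R] [AddCommGroup M] [Module R M]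
  [Module S M] [IsScalarTower S R M] (δ : Derivation S R R) (nabla : M →ₗ[S] M)
  (h : ∀ (r : R) (m : M), nabla (r • m) = δ r • m + r • nabla m)

theorem symDeriv_one : symDeriv δ nabla h 1 = 0 := by
  rw [← map_one (algebraMap R (SymmetricAlgebra R M)), symDeriv_algebraMap]
  simp

theorem symDeriv_pow (x : SymmetricAlgebra R M) (m : ℕ) :
    symDeriv δ nabla h (x ^ m) = (m : SymmetricAlgebra R M) * x ^ (m - 1) *
      symDeriv δ nabla h x := by
  induction m with
  | zero => rw [pow_zero, symDeriv_one]; simp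
  | succ m ih =>
    rw [pow_succ, symDeriv_mul, ih, Nat.add_sub_cancel]
    cases m with
    | zero => simp
    | succ m =>
      rw [Nat.add_sub_cancel, pow_succ]
      push_cast
      ring

theorem symDeriv_prod_pow {J : Type*} [DecidableEq J] (x : J → SymmetricAlgebra R M) (i : J → ℕ)
    (s : Finset J) : symDeriv δ nabla h (∏ j ∈ s, x j ^ i j) = ∑ j ∈ s, (i j : SymmetricAlgebra R M) *
      (∏ m ∈ s, x m ^ (i m - if m = j then 1 else 0)) * symDeriv δ nabla h (x j) := by
  induction s using Finset.induction_on with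
  | empty => rw [Finset.prod_empty, Finset.sum_empty, symDeriv_one]
  | insert b s hb ih =>
    rw [Finset.prod_insert hb, symDeriv_mul, ih, symDeriv_pow, Finset.sum_insert hb, add_comm,
      Finset.prod_insert hb, if_pos rfl, Finset.mul_sum]
    congr 1
    · have : ∏ m ∈ s, x m ^ (i m - if m = b then 1 else 0) = ∏ m ∈ s, x m ^ i m :=
        Finset.prod_congr rfl fun m hm => by
          rw [if_neg (ne_of_mem_of_not_mem hm hb), Nat.sub_zero]
      rw [this]
      ring
    · refine Finset.sum_congr rfl fun j hj => ?_
      rw [Finset.prod_insert hb, if_neg (ne_of_mem_of_not_mem hj hb).symm, Nat.sub_zero]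
      ring

theorem symConn_smul_add (k : ℕ) (r : R) (x : SymPow R M k) :
    symConn δ nabla h k (r • x) = δ r • x + r • symConn δ nabla h k x := by
  refine Subtype.ext ?_
  change symDeriv δ nabla h (r • x.1) = δ r • x.1 + r • symDeriv δ nabla h x.1
  rw [Algebra.smul_def, symDeriv_mul, symDeriv_algebraMap, Algebra.smul_def, Algebra.smul_def,
    mul_comm x.1, add_comm]

/-- The Leibniz rule on a monomial, for a connection with matrix `H` on the family `e`. -/
theorem symConn_symMonomial (e : Fin (n + 1) → M) (H : Fin (n + 1) → Fin (n + 1) → R)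
    (he : ∀ j, nabla (e j) = ∑ l, H l j • e l) (i : SymIdx n k) :
    symConn δ nabla h k (symMonomial (R := R) e i) =
      ∑ j, ∑ l, ((i.1 j : R) * H l j) • symMonomial (R := R) e (moveIdx i j l) := by
  refine Subtype.ext ?_
  change symDeriv δ nabla h (∏ j, SymmetricAlgebra.ι R M (e j) ^ i.1 j) =
    (SymPow R M k).subtype (∑ j, ∑ l, _)
  rw [symDeriv_prod_pow, map_sum]
  refine Finset.sum_congr rfl fun j _ => ?_
  rw [symDeriv_ι, he, map_sum, Finset.mul_sum, map_sum]
  refine Finset.sum_congr rfl fun l _ => ?_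
  change _ = ((i.1 j : R) * H l j) • ∏ m, SymmetricAlgebra.ι R M (e m) ^ (moveIdx i j l).1 m
  by_cases hj : i.1 j = 0
  · rw [hj]; simp
  · simp only [moveIdx_apply hj, pow_add, Finset.prod_mul_distrib]
    have : ∏ m, SymmetricAlgebra.ι R M (e m) ^ (if m = l then 1 else 0) =
        SymmetricAlgebra.ι R M (e l) := by
      rw [Finset.prod_eq_single l]
      · simp
      · intro m _ hm
        simp [hm]
      · simp
    rw [this, map_smul, Algebra.smul_def, Algebra.smul_def, map_mul, map_natCast]
    ring

end Leibniz

end SymmetricPowers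

/-! ### The symmetric power of the cyclic shift -/

/-- The matrix, on the monomials `e^i` of degree `k`, of the derivation that extends the cyclic
shift `e_j ↦ e_{j+1}`, `e_n ↦ e_0`. -/
def shiftMat (n k : ℕ) (R : Type*) [CommRing R] : Matrix (SymIdx n k) (SymIdx n k) R :=
  Matrix.of fun i' i => ∑ j, if moveIdx i j (j + 1) = i' then (i.1 j : R) else 0

theorem shiftMat_map (n k : ℕ) {R S : Type*} [CommRing R] [CommRing S] (φ : R →+* S) :
    φ.mapMatrix (shiftMat n k R) = shiftMat n k S := by
  ext i' i
  change φ (∑ j, if moveIdx i j (j + 1) = i' then (i.1 j : R) else 0) = _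
  rw [map_sum]
  refine Finset.sum_congr rfl fun j _ => ?_
  rw [apply_ite φ, map_natCast, map_zero]

theorem shiftMat_mulVec_single (n k : ℕ) {R : Type*} [CommRing R] (i : SymIdx n k) :
    (shiftMat n k R).mulVec (Pi.single i 1) =
      ∑ j, (i.1 j : R) • Pi.single (moveIdx i j (j + 1)) 1 := by
  rw [Matrix.mulVec_single_one]
  funext i'
  change (∑ j, if moveIdx i j (j + 1) = i' then (i.1 j : R) else 0) = _
  simp only [Finset.sum_apply]
  refine Finset.sum_congr rfl fun j _ => ?_
  rw [Pi.smul_apply, Pi.single_apply, smul_eq_mul, mul_ite, mul_one, mul_zero]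
  exact if_congr eq_comm rfl rfl

section Eigenvalues

variable {K : Type*} [Field K] (n k : ℕ)

/-- The cyclic shift `e_j ↦ e_{j+1}` of `K^{n+1}`. -/
def cyclicShift (K : Type*) [Field K] (n : ℕ) : (Fin (n + 1) → K) →ₗ[K] (Fin (n + 1) → K) :=
  LinearMap.funLeft K K (· - 1)

theorem cyclicShift_single (j : Fin (n + 1)) :
    cyclicShift K n (Pi.single j 1) = Pi.single (j + 1) 1 := by
  funext l
  change (Pi.single j 1 : Fin (n + 1) → K) (l - 1) = _
  rw [Pi.single_apply, Pi.single_apply]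
  exact if_congr sub_eq_iff_eq_add rfl rfl

variable {n} {ζ : K} (hζ : IsPrimitiveRoot ζ (n + 1))
include hζ

/-- The eigenvector `∑_l ζ^{-al} e_l`, with the exponent written as `a * n * l`. -/
theorem hasEigenvector_cyclicShift (a : Fin (n + 1)) :
    Module.End.HasEigenvector (cyclicShift K n) (ζ ^ (a : ℕ))
      (fun l : Fin (n + 1) => ζ ^ ((a : ℕ) * n * l)) := by
  have h0 : ζ ≠ 0 := hζ.ne_zero (by omega)
  have h1 : ζ ^ (n + 1) = 1 := hζ.pow_eq_one
  refine ⟨Module.End.mem_eigenspace_iff.2 (funext fun l => ?_), fun h => ?_⟩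
  · obtain ⟨m, rfl⟩ : ∃ m, l = m + 1 := ⟨l - 1, by simp⟩
    change ζ ^ ((a : ℕ) * n * ((m + 1 - 1 : Fin (n + 1)) : ℕ)) =
      ζ ^ (a : ℕ) * ζ ^ ((a : ℕ) * n * ((m + 1 : Fin (n + 1)) : ℕ))
    rw [add_sub_cancel_right, Fin.val_add_one]
    split_ifs with hm
    · subst hm
      rw [Fin.val_last, mul_zero, pow_zero, mul_one]
      refine mul_right_cancel₀ (pow_ne_zero ((a : ℕ) * n) h0) ?_
      rw [← pow_add, ← pow_add, show (a : ℕ) * n * n + a * n = (n + 1) * (a * n) by ring,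
        show (a : ℕ) + a * n = (n + 1) * a by ring]
      simp only [pow_mul, h1, one_pow]
    · rw [← pow_add, show (a : ℕ) + a * n * (m + 1) = a * n * m + (n + 1) * a by ring, pow_add,
        pow_mul ζ (n + 1), h1, one_pow, mul_one]
  · have := congrFun h 0
    simp at this

/-- In an eigenbasis of the cyclic shift its extension to the symmetric power is diagonal with
entries `∑_j i_j ζ^j`. -/
theorem det_shiftMat_ne_zero (hd : ∀ i : SymIdx n k, ∑ j, (i.1 j : K) * ζ ^ (j : ℕ) ≠ 0) :
    (shiftMat n k K).det ≠ 0 := by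
  have hinj : Function.Injective fun a : Fin (n + 1) => ζ ^ (a : ℕ) := fun a b hab =>
    Fin.ext (hζ.pow_inj a.2 b.2 hab)
  have hli := Module.End.eigenvectors_linearIndependent' (cyclicShift K n) _ hinj _
    (hasEigenvector_cyclicShift hζ)
  set f := basisOfLinearIndependentOfCardEqFinrank hli (by simp) with hf
  have hcomm : ∀ (r : K) (m : Fin (n + 1) → K),
      cyclicShift K n (r • m) = (0 : Derivation K K K) r • m + r • cyclicShift K n m := fun r m => by
    rw [map_smul, Derivation.zero_apply, zero_smul, zero_add]
  set L := symConn (0 : Derivation K K K) (cyclicShift K n) hcomm k with hL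
  have hdiag : ∀ i, L (symBasis k f i) = (∑ j, (i.1 j : K) * ζ ^ (j : ℕ)) • symBasis k f i := by
    intro i
    rw [symBasis_apply, hL, symConn_symMonomial _ _ _ f
      (fun l j => if l = j then ζ ^ (j : ℕ) else 0) (fun j => by
        simp only [ite_smul, zero_smul, Finset.sum_ite_eq', Finset.mem_univ, if_true]
        rw [hf, coe_basisOfLinearIndependentOfCardEqFinrank]
        exact Module.End.mem_eigenspace_iff.1 (hasEigenvector_cyclicShift hζ j).1), Finset.sum_smul]
    refine Finset.sum_congr rfl fun j _ => ?_
    simp only [mul_ite, mul_zero, ite_smul, zero_smul, Finset.sum_ite_eq', Finset.mem_univ, if_true,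
      moveIdx_self]
  have hLinj : ∀ x, L x = 0 → x = 0 := by
    intro x hx
    refine (symBasis k f).ext_elem fun i => ?_
    have h1 := congrArg (fun y => (symBasis k f).repr y i) hx
    rw [← (symBasis k f).sum_repr x] at h1
    simp only [map_sum, map_smul, hdiag, map_zero, Finsupp.coe_finsetSum, Finset.sum_apply,
      Finsupp.smul_apply, Module.Basis.repr_self, smul_eq_mul, Finsupp.single_apply,
      Finsupp.zero_apply, mul_ite, mul_one, mul_zero, Finset.sum_ite_eq', Finset.mem_univ,
      if_true] at h1
    rw [map_zero, Finsupp.zero_apply]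
    exact (mul_eq_zero.1 h1).resolve_right (hd i)
  intro hdet
  obtain ⟨v, hv, hv0⟩ := Matrix.exists_mulVec_eq_zero_iff.2 hdet
  set e := Pi.basisFun K (Fin (n + 1)) with he
  have hstd : ∀ v : SymIdx n k → K, L (∑ i, v i • symBasis k e i) =
      ∑ i', (shiftMat n k K).mulVec v i' • symBasis k e i' := by
    intro v
    have hv : v = ∑ i, v i • Pi.single i 1 := by
      funext i
      simp [Finset.sum_apply, Pi.single_apply]
    have hR : (shiftMat n k K).mulVec v =
        ∑ i, v i • ∑ j, (i.1 j : K) • Pi.single (moveIdx i j (j + 1)) 1 := by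
      conv_lhs => rw [hv]
      rw [Matrix.mulVec_sum]
      refine Finset.sum_congr rfl fun i _ => ?_
      rw [Matrix.mulVec_smul, shiftMat_mulVec_single]
    rw [hR, map_sum]
    simp only [Finset.sum_apply, Pi.smul_apply, Finset.sum_smul, smul_eq_mul]
    rw [Finset.sum_comm]
    refine Finset.sum_congr rfl fun i _ => ?_
    rw [map_smul, symBasis_apply, hL, symConn_symMonomial _ _ _ e
      (fun l j => if l = j + 1 then 1 else 0) (fun j => by
        simp only [ite_smul, one_smul, zero_smul, Finset.sum_ite_eq', Finset.mem_univ, if_true]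
        rw [he, Pi.basisFun_apply, Pi.basisFun_apply, cyclicShift_single])]
    simp only [mul_ite, mul_one, mul_zero, ite_smul, zero_smul, Finset.sum_ite_eq', Finset.mem_univ,
      if_true, Finset.mul_sum, Finset.sum_smul]
    rw [Finset.sum_comm, Finset.smul_sum]
    refine Finset.sum_congr rfl fun j _ => ?_
    simp only [Pi.single_apply, mul_ite, mul_one, mul_zero, ite_smul, zero_smul,
      Finset.sum_ite_eq', Finset.mem_univ, if_true, symBasis_apply, mul_smul]
  have h0 := hLinj _ (by rw [hstd v, hv0]; simp)
  refine hv (funext fun i => ?_)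
  have := congrArg (fun y => (symBasis k e).repr y i) h0
  simpa [Finsupp.single_apply] using this

end Eigenvalues

theorem isUnit_shiftMat (n k : ℕ) {p : ℕ} [Fact p.Prime] {ζ : AlgebraicClosure (ZMod p)}
    (hζ : IsPrimitiveRoot ζ (n + 1)) (hd : dNum n k ζ = 0) (F : Type*) [Field F] [CharP F p] :
    IsUnit (shiftMat n k F) := by
  let _ : Algebra (ZMod p) (AlgebraicClosure F) :=
    ((algebraMap F (AlgebraicClosure F)).comp (ZMod.castHom dvd_rfl F)).toAlgebra
  let φ : AlgebraicClosure (ZMod p) →ₐ[ZMod p] AlgebraicClosure F := IsAlgClosed.lift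
  have hd' : ∀ i : SymIdx n k,
      ∑ j : Fin (n + 1), (i.1 j : AlgebraicClosure (ZMod p)) * ζ ^ (j : ℕ) ≠ 0 := by
    intro i hi
    have hfin : Finite {i : SymIdx n k //
      ∑ j : Fin (n + 1), (i.1 j : AlgebraicClosure (ZMod p)) * ζ ^ (j : ℕ) = 0} := inferInstance
    rw [dNum, Nat.card_eq_zero] at hd
    rcases hd with h | h
    · exact h.false ⟨i, hi⟩
    · exact h.not_finite hfin
  have h1 := det_shiftMat_ne_zero k (hζ.map_of_injective (f := φ) φ.toRingHom.injective)
    (fun i h => hd' i (φ.toRingHom.injective (by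
      rw [map_zero, ← h, map_sum]
      refine Finset.sum_congr rfl fun j _ => ?_
      rw [map_mul, map_natCast, map_pow]
      rfl)))
  rw [Matrix.isUnit_iff_isUnit_det, isUnit_iff_ne_zero]
  intro h
  rw [← shiftMat_map n k (algebraMap F (AlgebraicClosure F)), ← RingHom.map_det, h, map_zero] at h1
  exact h1 rfl

/-! ### The graded connection on monomials -/

section Graded

variable {n k : ℕ}

/-- The weight `(n+1) r + w(i)` of `t^r e^i`. -/
def tWeight (x : ℕ × SymIdx n k) : ℕ := (n + 1) * x.1 + x.2.weight

/-- The index of the monomial obtained from `t^r e^i` by replacing one factor `e_j` by `e_{j+1}`,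
or one factor `e_n` by `t e_0`. -/
def nextIdx (x : ℕ × SymIdx n k) (j : Fin (n + 1)) : ℕ × SymIdx n k :=
  (x.1 + if j = Fin.last n then 1 else 0, moveIdx x.2 j (j + 1))

theorem tWeight_nextIdx {x : ℕ × SymIdx n k} {j : Fin (n + 1)} (h : x.2.1 j ≠ 0) :
    tWeight (nextIdx x j) = tWeight x + 1 := by
  have h1 := weight_moveIdx h (j + 1)
  have h2 := Fin.val_add_one j
  rw [tWeight, tWeight, nextIdx]
  simp only
  split_ifs at h2 ⊢ with hj
  · rw [h2] at h1
    rw [hj, Fin.val_last] at h1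
    rw [hj]
    nlinarith
  · rw [h2] at h1
    rw [add_zero]
    omega

theorem finite_tWeight_le (N : ℕ) : {x : ℕ × SymIdx n k | tWeight x ≤ N}.Finite := by
  refine ((Set.finite_le_nat N).prod (Set.finite_univ (α := SymIdx n k))).subset fun x hx => ?_
  refine ⟨?_, Set.mem_univ _⟩
  have h : tWeight x ≤ N := hx
  rw [tWeight] at h
  change x.1 ≤ N
  nlinarith

variable (n k) in
/-- The `R`-linear map `t^r e^i ↦ ∑_j i_j t^r e^i e_{j+1} / e_j`, where `e_{n+1} = t e_0`, on the
module with basis the monomials `t^r e^i`. It raises weights by `1`. -/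
def gradedConn (R : Type*) [CommRing R] :
    (ℕ × SymIdx n k →₀ R) →ₗ[R] (ℕ × SymIdx n k →₀ R) :=
  Finsupp.linearCombination R fun x => ∑ j, Finsupp.single (nextIdx x j) (x.2.1 j : R)

variable (n k) in
/-- The constant vector `∑_{i ∈ B} c_i e^i`. -/
def constVec {R : Type*} [CommRing R] (B : Finset (SymIdx n k)) (c : SymIdx n k → R) :
    ℕ × SymIdx n k →₀ R := ∑ i ∈ B, Finsupp.single (0, i) (c i)

variable {R : Type*} [CommRing R]

theorem gradedConn_single (x : ℕ × SymIdx n k) (c : R) : gradedConn n k R (Finsupp.single x c) =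
    ∑ j, Finsupp.single (nextIdx x j) (c * (x.2.1 j : R)) := by
  rw [gradedConn, Finsupp.linearCombination_single, Finset.smul_sum]
  simp only [Finsupp.smul_single, smul_eq_mul]

theorem constVec_apply (B : Finset (SymIdx n k)) (c : SymIdx n k → R) (x : ℕ × SymIdx n k) :
    constVec n k B c x = if x.1 = 0 ∧ x.2 ∈ B then c x.2 else 0 := by
  rw [constVec, Finsupp.finsetSum_apply]
  obtain ⟨r, i⟩ := x
  simp only [Finsupp.single_apply, Prod.mk.injEq]
  by_cases hr : r = 0
  · subst hr
    simp [Finset.sum_ite_eq']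
  · have : ∀ i', ¬ (0 = r ∧ i' = i) := fun i' h => hr h.1.symm
    simp [this, hr]

/-- The homogeneous part of weight `N`, with `t` set equal to `1`. -/
def gradedPiece (N : ℕ) : (ℕ × SymIdx n k →₀ R) →ₗ[R] (SymIdx n k → R) :=
  Finsupp.linearCombination R fun x => if tWeight x = N then Pi.single x.2 1 else 0

theorem gradedPiece_single (N : ℕ) (x : ℕ × SymIdx n k) (c : R) :
    gradedPiece N (Finsupp.single x c) = if tWeight x = N then Pi.single x.2 c else 0 := by
  rw [gradedPiece, Finsupp.linearCombination_single]
  split_ifs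
  · rw [← Pi.single_smul, smul_eq_mul, mul_one]
  · rw [smul_zero]

theorem gradedPiece_apply (y : ℕ × SymIdx n k →₀ R) (x : ℕ × SymIdx n k) :
    gradedPiece (tWeight x) y x.2 = y x := by
  induction y using Finsupp.induction_linear with
  | zero => rw [map_zero]; rfl
  | add y z hy hz => rw [map_add, Pi.add_apply, hy, hz, Finsupp.add_apply]
  | single w c =>
    rw [gradedPiece_single, Finsupp.single_apply]
    by_cases hwx : w = x
    · subst hwx; simp
    · rw [if_neg hwx]
      split_ifs with h
      · rw [Pi.single_apply, if_neg]
        intro h2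
        refine hwx (Prod.ext ?_ h2.symm)
        rw [tWeight, tWeight, h2] at h
        have h3 : (n + 1) * w.1 = (n + 1) * x.1 := by omega
        exact Nat.eq_of_mul_eq_mul_left (by omega) h3
      · rfl

theorem gradedPiece_gradedConn (N : ℕ) (y : ℕ × SymIdx n k →₀ R) :
    gradedPiece (N + 1) (gradedConn n k R y) = (shiftMat n k R).mulVec (gradedPiece N y) := by
  induction y using Finsupp.induction_linear with
  | zero => simp
  | add y z hy hz => rw [map_add, map_add, hy, hz, map_add, Matrix.mulVec_add]
  | single x c =>
    rw [gradedConn_single, map_sum, gradedPiece_single]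
    have hterm : ∀ j, gradedPiece (N + 1) (Finsupp.single (nextIdx x j) (c * (x.2.1 j : R))) =
        if tWeight x = N then c • (x.2.1 j : R) • Pi.single (moveIdx x.2 j (j + 1)) 1 else 0 := by
      intro j
      rw [gradedPiece_single]
      by_cases hj : x.2.1 j = 0
      · simp [hj]
      · rw [tWeight_nextIdx hj]
        simp only [Nat.add_right_cancel_iff]
        split_ifs
        · rw [← Pi.single_smul, ← Pi.single_smul, smul_eq_mul, smul_eq_mul, mul_one]
          rfl
        · rfl
    rw [Finset.sum_congr rfl fun j _ => hterm j]
    split_ifs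
    · rw [← Finset.smul_sum, ← shiftMat_mulVec_single, ← Matrix.mulVec_smul, ← Pi.single_smul,
        smul_eq_mul, mul_one]
    · simp

theorem gradedPiece_zero_gradedConn (y : ℕ × SymIdx n k →₀ R) :
    gradedPiece 0 (gradedConn n k R y) = 0 := by
  induction y using Finsupp.induction_linear with
  | zero => simp
  | add y z hy hz => rw [map_add, map_add, hy, hz, add_zero]
  | single x c =>
    rw [gradedConn_single, map_sum]
    refine Finset.sum_eq_zero fun j _ => ?_
    rw [gradedPiece_single]
    by_cases hj : x.2.1 j = 0
    · simp [hj]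
    · rw [tWeight_nextIdx hj, if_neg (by omega)]

theorem gradedConn_filter (M : ℕ) (y : ℕ × SymIdx n k →₀ R) :
    gradedConn n k R (y.filter fun x => tWeight x + 1 = M) =
      (gradedConn n k R y).filter fun x => tWeight x = M := by
  induction y using Finsupp.induction_linear with
  | zero => rw [Finsupp.filter_zero, map_zero, Finsupp.filter_zero]
  | add y z hy hz => rw [Finsupp.filter_add, map_add, hy, hz, map_add, Finsupp.filter_add]
  | single x c =>
    have hterm : ∀ j, (Finsupp.single (nextIdx x j) (c * (x.2.1 j : R))).filter
        (fun x => tWeight x = M) =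
        if tWeight x + 1 = M then Finsupp.single (nextIdx x j) (c * (x.2.1 j : R)) else 0 := by
      intro j
      by_cases hj : x.2.1 j = 0
      · simp only [hj, Nat.cast_zero, mul_zero, Finsupp.single_zero, Finsupp.filter_zero, ite_self]
      · split_ifs with h
        · exact Finsupp.filter_single_of_pos _ (by rw [tWeight_nextIdx hj]; exact h)
        · exact Finsupp.filter_single_of_neg _ (by rw [tWeight_nextIdx hj]; exact h)
    rw [gradedConn_single, Finsupp.filter_sum, Finset.sum_congr rfl fun j _ => hterm j]
    split_ifs with h
    · rw [Finsupp.filter_single_of_pos (fun x => tWeight x + 1 = M) h, gradedConn_single]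
    · rw [Finsupp.filter_single_of_neg (fun x => tWeight x + 1 = M) h, map_zero,
        Finset.sum_const_zero]

theorem constVec_filter (M : ℕ) (B : Finset (SymIdx n k)) (c : SymIdx n k → R) :
    (constVec n k B c).filter (fun x => tWeight x = M) =
      constVec n k B fun i => if i.weight = M then c i else 0 := by
  rw [constVec, constVec, Finsupp.filter_sum]
  refine Finset.sum_congr rfl fun i _ => ?_
  have h0 : tWeight (0, i) = i.weight := by rw [tWeight, mul_zero, zero_add]
  split_ifs with h
  · exact Finsupp.filter_single_of_pos _ (h0.trans h)
  · rw [Finsupp.single_zero]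
    exact Finsupp.filter_single_of_neg _ fun h' => h (h0.symm.trans h')

/-- The graded connection is injective when the extension of the cyclic shift is invertible. -/
theorem gradedConn_injective (h : IsUnit (shiftMat n k R)) {y : ℕ × SymIdx n k →₀ R}
    (hy : gradedConn n k R y = 0) : y = 0 := by
  have hdet := (Matrix.isUnit_iff_isUnit_det _).1 h
  ext x
  have h1 := gradedPiece_gradedConn (tWeight x) y
  rw [hy, map_zero] at h1
  have h2 : gradedPiece (tWeight x) y = 0 := by
    have := congrArg ((shiftMat n k R)⁻¹.mulVec) h1
    rwa [Matrix.mulVec_zero, Matrix.mulVec_mulVec, Matrix.nonsing_inv_mul _ hdet,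
      Matrix.one_mulVec, eq_comm] at this
  rw [← gradedPiece_apply, h2]
  rfl

/-- Modulo the image of the graded connection every monomial is constant in `t`: in weight `N + 1`,
solve the equation with `t` set equal to `1`, and keep the part of the solution that comes from
weight `N`. The error involves only `e^i` of weight at least `N + 1`, which have no room for a
factor `t`. -/
theorem exists_eq_gradedConn_add_const (h : IsUnit (shiftMat n k R)) (x : ℕ × SymIdx n k) :
    ∃ (y : ℕ × SymIdx n k →₀ R) (c : SymIdx n k → R),
      Finsupp.single x 1 = gradedConn n k R y + constVec n k Finset.univ c := by
  have hdet := (Matrix.isUnit_iff_isUnit_det _).1 h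
  suffices hz : ∃ y : ℕ × SymIdx n k →₀ R, ∀ x' : ℕ × SymIdx n k, x'.1 ≠ 0 →
      (Finsupp.single x (1 : R) - gradedConn n k R y) x' = 0 by
    obtain ⟨y, hy⟩ := hz
    refine ⟨y, fun i => (Finsupp.single x (1 : R) - gradedConn n k R y) (0, i), ?_⟩
    rw [← sub_eq_iff_eq_add']
    ext x'
    rw [constVec_apply]
    by_cases h0 : x'.1 = 0
    · rw [if_pos ⟨h0, Finset.mem_univ _⟩, ← h0]
    · rw [hy x' h0, if_neg fun h => h0 h.1]
  rcases Nat.eq_zero_or_pos (tWeight x) with h0 | hpos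
  · refine ⟨0, fun x' hx' => ?_⟩
    rw [map_zero, sub_zero, Finsupp.single_apply, if_neg]
    rintro rfl
    rw [tWeight] at h0
    have : 0 < (n + 1) * x.1 := Nat.mul_pos (by omega) (Nat.pos_of_ne_zero hx')
    omega
  obtain ⟨N, hN⟩ := Nat.exists_eq_succ_of_ne_zero hpos.ne'
  rw [Nat.succ_eq_add_one] at hN
  set u := (shiftMat n k R)⁻¹.mulVec (Pi.single x.2 1) with hu
  have hPu : (shiftMat n k R).mulVec u = Pi.single x.2 1 := by
    rw [hu, Matrix.mulVec_mulVec, Matrix.mul_nonsing_inv _ hdet, Matrix.one_mulVec]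
  let ok : SymIdx n k → Prop := fun i => i.weight ≤ N ∧ (n + 1) ∣ N - i.weight
  classical
  set u' : SymIdx n k → R := fun i => if ok i then u i else 0 with hu'
  set y : ℕ × SymIdx n k →₀ R :=
    ∑ i, Finsupp.single ((N - i.weight) / (n + 1), i) (u' i) with hy
  have hpiece : ∀ M, gradedPiece M y = if M = N then u' else 0 := by
    intro M
    rw [hy, map_sum]
    have hterm : ∀ i, gradedPiece M (Finsupp.single ((N - i.weight) / (n + 1), i) (u' i)) =
        if M = N then Pi.single i (u' i) else 0 := by
      intro i
      rw [gradedPiece_single]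
      by_cases hi : ok i
      · have hw : tWeight ((N - i.weight) / (n + 1), i) = N := by
          rw [tWeight, Nat.mul_div_cancel' hi.2]
          have := hi.1
          simp only
          omega
        rw [hw]
        exact if_congr eq_comm rfl rfl
      · have : u' i = 0 := if_neg hi
        rw [this, Pi.single_zero, ite_self, ite_self]
    rw [Finset.sum_congr rfl fun i _ => hterm i]
    split_ifs
    · exact Finset.univ_sum_single u'
    · exact Finset.sum_const_zero
  refine ⟨y, fun x' hx' => ?_⟩
  rw [← gradedPiece_apply, map_sub, gradedPiece_single, hN]
  rcases Nat.eq_zero_or_pos (tWeight x') with h0 | hpos'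
  · rw [h0, gradedPiece_zero_gradedConn, if_neg (by omega), sub_zero]
    rfl
  obtain ⟨M, hM⟩ := Nat.exists_eq_succ_of_ne_zero hpos'.ne'
  rw [Nat.succ_eq_add_one] at hM
  rw [hM, gradedPiece_gradedConn, hpiece]
  by_cases hMN : M = N
  · subst hMN
    rw [if_pos rfl, if_pos rfl, ← hPu, ← Matrix.mulVec_sub]
    change ∑ i, shiftMat n k R x'.2 i * (u - u') i = 0
    refine Finset.sum_eq_zero fun i _ => ?_
    by_cases hi : ok i
    · have : (u - u') i = 0 := by rw [Pi.sub_apply, hu']; simp [hi]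
      rw [this, mul_zero]
    · have : shiftMat n k R x'.2 i = 0 := by
        change (∑ j, if moveIdx i j (j + 1) = x'.2 then (i.1 j : R) else 0) = 0
        refine Finset.sum_eq_zero fun j _ => ?_
        split_ifs with hmove
        · by_cases hj : i.1 j = 0
          · rw [hj, Nat.cast_zero]
          · exfalso
            refine hi ?_
            have h1 := weight_moveIdx hj (j + 1)
            rw [hmove, Fin.val_add_one] at h1
            obtain ⟨r, hr⟩ := Nat.exists_eq_succ_of_ne_zero hx'
            rw [tWeight, hr, Nat.succ_eq_add_one, mul_add, mul_one] at hM
            split_ifs at h1 with hl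
            · rw [hl, Fin.val_last] at h1
              refine ⟨by omega, r, by omega⟩
            · refine ⟨by omega, r + 1, ?_⟩
              rw [mul_add, mul_one]
              omega
        · rfl
      rw [this, zero_mul]
  · rw [if_neg (by omega), if_neg hMN, Matrix.mulVec_zero, sub_zero]
    rfl

/-- The constants `e^i` with `i ∈ B` are a basis of a complement of the image of the graded
connection, and this connection is injective. -/
structure IsComplement (R : Type*) [CommRing R] (B : Finset (SymIdx n k)) : Prop where
  exists_eq : ∀ x : ℕ × SymIdx n k, ∃ (y : ℕ × SymIdx n k →₀ R) (c : SymIdx n k → R),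
    Finsupp.single x 1 = gradedConn n k R y + constVec n k B c
  eq_zero : ∀ (y : ℕ × SymIdx n k →₀ R) (c : SymIdx n k → R),
    gradedConn n k R y + constVec n k B c = 0 → y = 0 ∧ ∀ i ∈ B, c i = 0

theorem IsComplement.exists_eq_homogeneous {B : Finset (SymIdx n k)} (h : IsComplement R B)
    (x : ℕ × SymIdx n k) : ∃ (y : ℕ × SymIdx n k →₀ R) (c : SymIdx n k → R),
      (∀ x', y x' ≠ 0 → tWeight x' + 1 = tWeight x) ∧ (∀ i, c i ≠ 0 → i.weight = tWeight x) ∧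
      Finsupp.single x 1 = gradedConn n k R y + constVec n k B c := by
  obtain ⟨y, c, hyc⟩ := h.exists_eq x
  refine ⟨y.filter fun x' => tWeight x' + 1 = tWeight x, fun i => if i.weight = tWeight x then c i
    else 0, fun x' hx' => ?_, fun i hi => ?_, ?_⟩
  · by_contra hcon
    exact hx' (Finsupp.filter_apply_neg _ _ hcon)
  · by_contra hcon
    exact hi (if_neg hcon)
  · have := congrArg (Finsupp.filter fun x' => tWeight x' = tWeight x) hyc
    rwa [Finsupp.filter_single_of_pos (fun x' => tWeight x' = tWeight x) rfl, Finsupp.filter_add,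
      ← gradedConn_filter, constVec_filter] at this

end Graded

/-! ### Constant bases -/

section Reduced

variable {n k : ℕ} (F : Type*) [Field F]

theorem redMatrix_apply (l j : Fin (n + 1)) : redMatrix n F l j =
    if l = j + 1 then (if j = Fin.last n then Polynomial.X else 1) else 0 := by
  have h1 := Fin.val_add_one j
  have h2 : (l = j + 1) ↔ (l : ℕ) = ((j + 1 : Fin (n + 1)) : ℕ) := Fin.ext_iff
  have h3 : (j = Fin.last n) ↔ (j : ℕ) = n := Fin.ext_iff
  have hl := l.2
  change (if (l : ℕ) = j + 1 then 1 else if (j : ℕ) = n ∧ (l : ℕ) = 0 then Polynomial.X else 0) = _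
  split_ifs at * <;> first | rfl | omega

variable (n k) in
/-- The basis `t^r e^i` over `F` of the symmetric power of the free `F[t]`-module. -/
def redBasis : Module.Basis (ℕ × SymIdx n k) F
    (SymPow (Polynomial F) (Fin (n + 1) → Polynomial F) k) :=
  (Polynomial.basisMonomials F).smulTower
    (symBasis k (Pi.basisFun (Polynomial F) (Fin (n + 1))))

theorem redBasis_apply (x : ℕ × SymIdx n k) : redBasis n k F x = Polynomial.monomial x.1 (1 : F) •
    symMonomial (R := Polynomial F) (fun j => Pi.single j 1) x.2 := by
  rw [redBasis, Module.Basis.smulTower_apply, symBasis_apply, Polynomial.coe_basisMonomials]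
  congr 2
  funext j
  exact Pi.basisFun_apply _ _ _

theorem redConn_redBasis (x : ℕ × SymIdx n k) : redConn n F k (redBasis n k F x) =
    ∑ j, (x.2.1 j : F) • redBasis n k F (nextIdx x j) := by
  rw [redBasis_apply, redConn, symConn_smul_add, Derivation.zero_apply, zero_smul, zero_add,
    symConn_symMonomial _ _ _ _ (redMatrix n F) (fun j => by
      change Matrix.toLin' (redMatrix n F) (Pi.single j 1) = _
      rw [Matrix.toLin'_apply, Matrix.mulVec_single_one]
      funext l
      simp only [Finset.sum_apply, Pi.smul_apply, Pi.single_apply, smul_eq_mul, mul_ite, mul_one,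
        mul_zero, Finset.sum_ite_eq, Finset.mem_univ, if_true]
      rfl), Finset.smul_sum]
  refine Finset.sum_congr rfl fun j _ => ?_
  simp only [redMatrix_apply, mul_ite, mul_zero, ite_smul, zero_smul, Finset.sum_ite_eq',
    Finset.mem_univ, if_true]
  rw [redBasis_apply, nextIdx]
  simp only
  rw [← algebraMap_smul (Polynomial F) (x.2.1 j : F), map_natCast]
  split_ifs
  · rw [smul_smul, smul_smul, mul_left_comm, Polynomial.monomial_mul_X]
  · rw [smul_smul, smul_smul, mul_one, mul_comm, add_zero]

theorem redConn_repr_symm (y : ℕ × SymIdx n k →₀ F) :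
    redConn n F k ((redBasis n k F).repr.symm y) =
      (redBasis n k F).repr.symm (gradedConn n k F y) := by
  induction y using Finsupp.induction_linear with
  | zero => simp
  | add y z hy hz => rw [map_add, map_add, hy, hz, map_add, map_add]
  | single x c =>
    rw [gradedConn_single, Module.Basis.repr_symm_single, map_smul, redConn_redBasis, map_sum,
      Finset.smul_sum]
    refine Finset.sum_congr rfl fun j _ => ?_
    rw [Module.Basis.repr_symm_single, mul_smul]

theorem redBasis_zero (i : SymIdx n k) : redBasis n k F (0, i) =
    symMonomial (R := Polynomial F) (fun j => Pi.single j 1) i := by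
  rw [redBasis_apply]
  simp only [Polynomial.monomial_zero_one, one_smul]

theorem repr_symm_constVec (B : Finset (SymIdx n k)) (c : SymIdx n k → F) :
    (redBasis n k F).repr.symm (constVec n k B c) =
      ∑ i ∈ B, c i • symMonomial (R := Polynomial F) (fun j => Pi.single j 1) i := by
  rw [constVec, map_sum]
  refine Finset.sum_congr rfl fun i _ => ?_
  rw [Module.Basis.repr_symm_single, redBasis_zero]

variable {F}

theorem IsConstantBasis.isComplement {B : Finset (SymIdx n k)} (hB : IsConstantBasis n F B)
    (h : IsUnit (shiftMat n k F)) : IsComplement F B := by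
  obtain ⟨b, hb⟩ := hB
  have hsum : ∀ c : SymIdx n k → F, (Submodule.Quotient.mk ((redBasis n k F).repr.symm
      (constVec n k B c)) : CohOne (redConn n F k)) = ∑ i : B, c i • b i := by
    intro c
    rw [repr_symm_constVec, ← Finset.sum_coe_sort B, ← Submodule.mkQ_apply, map_sum]
    refine Finset.sum_congr rfl fun i _ => ?_
    rw [map_smul, hb, Submodule.mkQ_apply]
  refine ⟨fun x => ?_, fun y c hyc => ?_⟩
  · set z : CohOne (redConn n F k) := Submodule.Quotient.mk (redBasis n k F x) with hz
    let c : SymIdx n k → F := fun i => if hi : i ∈ B then b.repr z ⟨i, hi⟩ else 0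
    have hzc : z = Submodule.Quotient.mk ((redBasis n k F).repr.symm (constVec n k B c)) := by
      rw [hsum]
      conv_lhs => rw [← b.sum_repr z]
      refine Finset.sum_congr rfl fun i _ => ?_
      have hci : c i = b.repr z i := dif_pos i.2
      rw [hci]
    rw [hz, Submodule.Quotient.eq] at hzc
    obtain ⟨w, hw⟩ := hzc
    refine ⟨(redBasis n k F).repr w, c, (redBasis n k F).repr.symm.injective ?_⟩
    rw [map_add, ← redConn_repr_symm, LinearEquiv.symm_apply_apply, hw, sub_add_cancel,
      Module.Basis.repr_symm_single_one]
  · have h1 := congrArg (redBasis n k F).repr.symm hyc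
    rw [map_add, ← redConn_repr_symm, map_zero] at h1
    have h2 : ∑ i : B, c i • b i = 0 := by
      rw [← hsum, Submodule.Quotient.mk_eq_zero]
      exact ⟨-(redBasis n k F).repr.symm y, by rw [map_neg]; exact neg_eq_of_add_eq_zero_right h1⟩
    have hc : ∀ i ∈ B, c i = 0 := fun i hi =>
      Fintype.linearIndependent_iff.1 b.linearIndependent (fun i : B => c i) h2 ⟨i, hi⟩
    refine ⟨gradedConn_injective h ?_, hc⟩
    have h0 : constVec n k B c = 0 := Finset.sum_eq_zero fun i hi => by
      rw [hc i hi, Finsupp.single_zero]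
    rwa [h0, add_zero] at hyc

theorem exists_isConstantBasis (h : IsUnit (shiftMat n k F)) :
    ∃ B : Finset (SymIdx n k), IsConstantBasis n F B := by
  classical
  let v : SymIdx n k → CohOne (redConn n F k) := fun i =>
    Submodule.Quotient.mk (symMonomial (R := Polynomial F) (fun j => Pi.single j 1) i)
  have hv : ⊤ ≤ Submodule.span F (Set.range v) := by
    rintro z -
    obtain ⟨w, rfl⟩ := Submodule.Quotient.mk_surjective _ z
    rw [← (redBasis n k F).linearCombination_repr w, Finsupp.linearCombination_apply, Finsupp.sum,
      ← Submodule.mkQ_apply, map_sum]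
    refine sum_mem fun x _ => ?_
    rw [map_smul]
    refine Submodule.smul_mem _ _ ?_
    obtain ⟨y, c, hyc⟩ := exists_eq_gradedConn_add_const h x
    have h1 := congrArg (redBasis n k F).repr.symm hyc
    rw [map_add, ← redConn_repr_symm, Module.Basis.repr_symm_single_one, repr_symm_constVec] at h1
    rw [h1, map_add, Submodule.mkQ_apply, (Submodule.Quotient.mk_eq_zero _).2
      (LinearMap.mem_range_self _ _), zero_add,
      map_sum]
    refine sum_mem fun i _ => ?_
    rw [map_smul]
    exact Submodule.smul_mem _ _ (Submodule.subset_span ⟨i, rfl⟩)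
  obtain ⟨κ, f, hf, hspan, hli⟩ := exists_linearIndependent' F v
  have : Finite κ := Finite.of_injective f hf
  let _ := Fintype.ofFinite κ
  let B : Finset (SymIdx n k) := Finset.univ.image f
  let e : κ ≃ B := Equiv.ofBijective (fun j => ⟨f j, Finset.mem_image_of_mem f (Finset.mem_univ j)⟩)
    ⟨fun i j hij => hf (congrArg Subtype.val hij), fun i => by
      obtain ⟨j, -, hj⟩ := Finset.mem_image.1 i.2
      exact ⟨j, Subtype.ext hj⟩⟩
  refine ⟨B, (Module.Basis.mk hli (by rw [hspan]; exact hv)).reindex e, fun i => ?_⟩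
  rw [Module.Basis.reindex_apply, Module.Basis.mk_apply]
  have : f (e.symm i) = i := congrArg Subtype.val (e.apply_symm_apply i)
  change v (f (e.symm i)) = _
  rw [this]

/-- Comparing dimensions in weights at most `N` and at most `N + 1`. -/
theorem IsComplement.card_add {B : Finset (SymIdx n k)} (h : IsComplement F B) {N : ℕ}
    (hN : n * k ≤ N + 1) : Nat.card {x : ℕ × SymIdx n k // tWeight x ≤ N} + B.card =
      Nat.card {x : ℕ × SymIdx n k // tWeight x ≤ N + 1} := by
  classical
  let _ : ∀ N, Fintype {x : ℕ × SymIdx n k // tWeight x ≤ N} := fun N =>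
    (finite_tWeight_le N).fintype
  let v : {x : ℕ × SymIdx n k // tWeight x ≤ N} ⊕ B → (ℕ × SymIdx n k →₀ F) :=
    Sum.elim (fun x => gradedConn n k F (Finsupp.single x.1 1)) (fun i => Finsupp.single (0, i.1) 1)
  let s : {x : ℕ × SymIdx n k // tWeight x ≤ N + 1} → (ℕ × SymIdx n k →₀ F) :=
    fun x => Finsupp.single x.1 1
  have hs : LinearIndependent F s := by
    have h1 := (Finsupp.basisSingleOne (R := F) (ι := ℕ × SymIdx n k)).linearIndependent.comp
      (Subtype.val : {x : ℕ × SymIdx n k // tWeight x ≤ N + 1} → _) Subtype.val_injective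
    rwa [Finsupp.coe_basisSingleOne] at h1
  have hv : LinearIndependent F v := by
    rw [Fintype.linearIndependent_iff]
    intro g hg
    let y : ℕ × SymIdx n k →₀ F :=
      ∑ x : {x : ℕ × SymIdx n k // tWeight x ≤ N}, Finsupp.single x.1 (g (Sum.inl x))
    let c : SymIdx n k → F := fun i => if hi : i ∈ B then g (Sum.inr ⟨i, hi⟩) else 0
    have hc : ∀ i : B, c i = g (Sum.inr i) := fun i => dif_pos i.2
    have hyc : gradedConn n k F y + constVec n k B c = 0 := by
      rw [← hg, Fintype.sum_sum_type, map_sum, constVec, ← Finset.sum_coe_sort B]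
      congr 1
      · refine Finset.sum_congr rfl fun x _ => ?_
        change _ = g (Sum.inl x) • gradedConn n k F (Finsupp.single x.1 1)
        rw [← map_smul, Finsupp.smul_single, smul_eq_mul, mul_one]
      · refine Finset.sum_congr rfl fun i _ => ?_
        change _ = g (Sum.inr i) • Finsupp.single (0, i.1) (1 : F)
        rw [Finsupp.smul_single, smul_eq_mul, mul_one, hc]
    obtain ⟨hy0, hc0⟩ := h.eq_zero y c hyc
    rintro (x | i)
    · have h2 := DFunLike.congr_fun hy0 x.1
      rw [Finsupp.finsetSum_apply, Finset.sum_eq_single x] at h2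
      · rwa [Finsupp.single_eq_same] at h2
      · intro x' _ hx'
        exact Finsupp.single_eq_of_ne (fun h => hx' (Subtype.ext h.symm))
      · intro hx'
        exact absurd (Finset.mem_univ x) hx'
    · rw [← hc]
      exact hc0 i i.2
  have hmem : ∀ x : ℕ × SymIdx n k, tWeight x ≤ N + 1 →
      Finsupp.single x (1 : F) ∈ Submodule.span F (Set.range s) := fun x hx =>
    Submodule.subset_span ⟨⟨x, hx⟩, rfl⟩
  have hsingle : ∀ (x : ℕ × SymIdx n k) (a : F), Finsupp.single x a = a • Finsupp.single x 1 :=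
    fun x a => by rw [Finsupp.smul_single, smul_eq_mul, mul_one]
  have hspan : Submodule.span F (Set.range v) = Submodule.span F (Set.range s) := by
    refine le_antisymm (Submodule.span_le.2 ?_) (Submodule.span_le.2 ?_)
    · rintro _ ⟨x | i, rfl⟩
      · change gradedConn n k F (Finsupp.single x.1 1) ∈ Submodule.span F (Set.range s)
        rw [gradedConn_single]
        refine sum_mem fun j _ => ?_
        by_cases hj : x.1.2.1 j = 0
        · rw [hj, Nat.cast_zero, mul_zero, Finsupp.single_zero]; exact zero_mem _
        · rw [hsingle]
          refine Submodule.smul_mem _ _ (hmem _ ?_)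
          rw [tWeight_nextIdx hj]
          exact Nat.succ_le_succ x.2
      · refine hmem _ ?_
        rw [tWeight, mul_zero, zero_add]
        exact (weight_le _).trans hN
    · rintro _ ⟨x, rfl⟩
      obtain ⟨y, c, hy, -, hyc⟩ := h.exists_eq_homogeneous x.1
      change Finsupp.single x.1 1 ∈ Submodule.span F (Set.range v)
      rw [hyc]
      refine add_mem ?_ (sum_mem fun i hi => ?_)
      · rw [← Finsupp.sum_single y, Finsupp.sum, map_sum]
        refine sum_mem fun x' hx' => ?_
        rw [hsingle, map_smul]
        refine Submodule.smul_mem _ _ (Submodule.subset_span ⟨Sum.inl ⟨x', ?_⟩, rfl⟩)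
        have := hy x' (Finsupp.mem_support_iff.1 hx')
        have := x.2
        omega
      · rw [hsingle]
        exact Submodule.smul_mem _ _ (Submodule.subset_span ⟨Sum.inr ⟨i, hi⟩, rfl⟩)
  have h1 := finrank_span_eq_card hv
  rw [hspan, finrank_span_eq_card hs, Fintype.card_sum, Fintype.card_coe] at h1
  rw [Nat.card_eq_fintype_card, Nat.card_eq_fintype_card]
  exact h1.symm

theorem IsComplement.card_mul {B : Finset (SymIdx n k)} (h : IsComplement F B) :
    (n + 1) * B.card = (n + k).choose n := by
  have hfin : ∀ N, Finite {x : ℕ × SymIdx n k // tWeight x ≤ N} := fun N => finite_tWeight_le N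
  have h1 : ∀ m, Nat.card {x : ℕ × SymIdx n k // tWeight x ≤ n * k + m} =
      Nat.card {x : ℕ × SymIdx n k // tWeight x ≤ n * k} + m * B.card := by
    intro m
    induction m with
    | zero => simp
    | succ m ih => rw [← add_assoc, ← h.card_add (by omega), ih]; ring
  -- every monomial of weight at most `N + n + 1` is constant or `t` times one of weight at most `N`
  let e : {x : ℕ × SymIdx n k // tWeight x ≤ n * k + (n + 1)} ≃
      {x : ℕ × SymIdx n k // tWeight x ≤ n * k} ⊕ SymIdx n k :=
    { toFun := fun x => match x with
        | ⟨(0, i), _⟩ => Sum.inr i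
        | ⟨(r + 1, i), h⟩ => Sum.inl ⟨(r, i), by rw [tWeight] at *; simp only at *; linarith⟩
      invFun := fun y => match y with
        | Sum.inl ⟨(r, i), h⟩ => ⟨(r + 1, i), by rw [tWeight] at *; simp only at *; linarith⟩
        | Sum.inr i => ⟨(0, i), by
            rw [tWeight, mul_zero, zero_add]
            exact (weight_le i).trans (by omega)⟩
      left_inv := by rintro ⟨⟨_ | r, i⟩, h⟩ <;> rfl
      right_inv := by rintro (⟨⟨r, i⟩, h⟩ | i) <;> rfl }
  have h2 := Nat.card_congr e
  rw [Nat.card_sum, h1, Nat.card_eq_fintype_card (α := SymIdx n k), card_symIdx] at h2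
  omega

end Reduced

section Lift

variable {n k : ℕ} {A : Type*} [CommRing A] [IsLocalRing A]

/-- Reduction of coefficients modulo the maximal ideal. -/
def residueMap : (ℕ × SymIdx n k →₀ A) →+ (ℕ × SymIdx n k →₀ IsLocalRing.ResidueField A) :=
  Finsupp.mapRange.addMonoidHom (IsLocalRing.residue A).toAddMonoidHom

theorem residueMap_apply (y : ℕ × SymIdx n k →₀ A) (x : ℕ × SymIdx n k) :
    residueMap y x = IsLocalRing.residue A (y x) := rfl

theorem residueMap_single (x : ℕ × SymIdx n k) (a : A) :
    residueMap (Finsupp.single x a) = Finsupp.single x (IsLocalRing.residue A a) :=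
  Finsupp.mapRange_single (hf := map_zero (IsLocalRing.residue A))

theorem residueMap_gradedConn (y : ℕ × SymIdx n k →₀ A) :
    residueMap (gradedConn n k A y) = gradedConn n k _ (residueMap y) := by
  induction y using Finsupp.induction_linear with
  | zero => simp
  | add y z hy hz => rw [map_add, map_add, hy, hz, map_add, map_add]
  | single x c =>
    rw [gradedConn_single, residueMap_single, gradedConn_single, map_sum]
    refine Finset.sum_congr rfl fun j _ => ?_
    rw [residueMap_single, map_mul, map_natCast]

theorem residueMap_constVec (B : Finset (SymIdx n k)) (c : SymIdx n k → A) :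
    residueMap (constVec n k B c) = constVec n k B fun i => IsLocalRing.residue A (c i) := by
  rw [constVec, constVec, map_sum]
  exact Finset.sum_congr rfl fun i _ => residueMap_single _ _

theorem residueMap_eq_zero_iff (y : ℕ × SymIdx n k →₀ A) :
    residueMap y = 0 ↔ ∀ x, y x ∈ IsLocalRing.maximalIdeal A := by
  rw [Finsupp.ext_iff]
  refine forall_congr' fun x => ?_
  rw [residueMap_apply, Finsupp.zero_apply, IsLocalRing.residue_eq_zero_iff]

theorem IsComplement.mem_maximalIdeal {B : Finset (SymIdx n k)}
    (h : IsComplement (IsLocalRing.ResidueField A) B) {y : ℕ × SymIdx n k →₀ A}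
    {c : SymIdx n k → A}
    (hyc : ∀ x, (gradedConn n k A y + constVec n k B c) x ∈ IsLocalRing.maximalIdeal A) :
    (∀ x, y x ∈ IsLocalRing.maximalIdeal A) ∧ ∀ i ∈ B, c i ∈ IsLocalRing.maximalIdeal A := by
  rw [← residueMap_eq_zero_iff, map_add, residueMap_gradedConn, residueMap_constVec] at hyc
  obtain ⟨h1, h2⟩ := h.eq_zero _ _ hyc
  exact ⟨(residueMap_eq_zero_iff y).1 h1, fun i hi => (IsLocalRing.residue_eq_zero_iff _).1 (h2 i hi)⟩

/-- By Nakayama's lemma in each weight, a complement over the residue field lifts to a complement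
over the local ring. -/
theorem IsComplement.exists_lift {B : Finset (SymIdx n k)}
    (h : IsComplement (IsLocalRing.ResidueField A) B) (x : ℕ × SymIdx n k) :
    ∃ (y : ℕ × SymIdx n k →₀ A) (c : SymIdx n k → A),
      (∀ x', y x' ≠ 0 → tWeight x' + 1 = tWeight x) ∧
      (∀ i, c i ≠ 0 → i ∈ B ∧ i.weight = tWeight x) ∧
      Finsupp.single x 1 = gradedConn n k A y + constVec n k B c := by
  classical
  set N := tWeight x with hN
  set M : Submodule A (ℕ × SymIdx n k →₀ A) := Finsupp.supported A A {x' | tWeight x' = N} with hM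
  set M₁ : Submodule A (ℕ × SymIdx n k →₀ A) := (Finsupp.supported A A
    {x' | tWeight x' + 1 = N}).map (gradedConn n k A) with hM₁
  set M₂ : Submodule A (ℕ × SymIdx n k →₀ A) := Finsupp.supported A A
    {x' | x'.1 = 0 ∧ x'.2 ∈ B ∧ x'.2.weight = N} with hM₂
  have hfg : M.FG := by
    rw [hM, Finsupp.supported_eq_span_single]
    exact Submodule.fg_span ((((finite_tWeight_le N).subset fun x' hx' => le_of_eq hx')).image _)
  have hle : M ≤ (M₁ ⊔ M₂) ⊔ IsLocalRing.maximalIdeal A • M := by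
    conv_lhs => rw [hM, Finsupp.supported_eq_span_single]
    rw [Submodule.span_le]
    rintro _ ⟨x', hx', rfl⟩
    have hx'N : tWeight x' = N := hx'
    obtain ⟨y', c', hy', hc', hyc'⟩ := h.exists_eq_homogeneous x'
    obtain ⟨g, hg0, hg⟩ : ∃ g : IsLocalRing.ResidueField A → A, g 0 = 0 ∧
        ∀ z, IsLocalRing.residue A (g z) = z := by
      choose g hg using IsLocalRing.residue_surjective (R := A)
      refine ⟨fun z => if z = 0 then 0 else g z, if_pos rfl, fun z => ?_⟩
      change IsLocalRing.residue A (if z = 0 then 0 else g z) = z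
      split_ifs with hz
      · rw [hz, map_zero]
      · exact hg z
    set y : ℕ × SymIdx n k →₀ A := y'.mapRange g hg0 with hy
    set c : SymIdx n k → A := fun i => g (c' i) with hc
    have hyr : residueMap y = y' := by
      ext w
      rw [residueMap_apply, hy, Finsupp.mapRange_apply, hg]
    have hyN : y ∈ Finsupp.supported A A {x' : ℕ × SymIdx n k | tWeight x' + 1 = N} := by
      rw [Finsupp.mem_supported]
      intro w hw
      rw [Finset.mem_coe, Finsupp.mem_support_iff, hy, Finsupp.mapRange_apply] at hw
      rw [Set.mem_ofPred_eq, ← hx'N]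
      exact hy' w fun h0 => hw (by rw [h0, hg0])
    have hcN : constVec n k B c ∈ M₂ := by
      rw [hM₂, Finsupp.mem_supported]
      intro w hw
      rw [Finset.mem_coe, Finsupp.mem_support_iff, constVec_apply] at hw
      split_ifs at hw with hwB
      · refine ⟨hwB.1, hwB.2, ?_⟩
        rw [← hx'N]
        exact hc' w.2 fun h0 => hw (by rw [hc]; simp only; rw [h0, hg0])
      · exact absurd rfl hw
    have hM₁M : M₁ ≤ M := by
      rw [hM₁, Submodule.map_le_iff_le_comap, Finsupp.supported_eq_span_single, Submodule.span_le]
      rintro _ ⟨w, hw, rfl⟩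
      change gradedConn n k A (Finsupp.single w 1) ∈ M
      rw [gradedConn_single]
      refine sum_mem fun j _ => ?_
      by_cases hj : w.2.1 j = 0
      · rw [hj, Nat.cast_zero, mul_zero, Finsupp.single_zero]; exact zero_mem _
      · exact Finsupp.single_mem_supported A _ ((tWeight_nextIdx hj).trans hw)
    have hM₂M : M₂ ≤ M := Finsupp.supported_mono fun w hw => by
      rw [Set.mem_ofPred_eq, tWeight, hw.1, mul_zero, zero_add]
      exact hw.2.2
    set d := Finsupp.single x' (1 : A) - (gradedConn n k A y + constVec n k B c) with hd
    have hdM : d ∈ M := sub_mem (Finsupp.single_mem_supported A _ hx')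
      (add_mem (hM₁M ⟨y, hyN, rfl⟩) (hM₂M hcN))
    have hdm : ∀ w, d w ∈ IsLocalRing.maximalIdeal A := by
      rw [← residueMap_eq_zero_iff, hd, map_sub, map_add, residueMap_gradedConn,
        residueMap_constVec, hyr, residueMap_single, map_one, hyc', hc]
      simp only [hg]
      exact sub_self _
    have hdmM : d ∈ IsLocalRing.maximalIdeal A • M := by
      rw [← Finsupp.sum_single d]
      refine sum_mem fun w hw => ?_
      have : Finsupp.single w (d w) = d w • Finsupp.single w (1 : A) := by
        rw [Finsupp.smul_single, smul_eq_mul, mul_one]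
      rw [this]
      exact Submodule.smul_mem_smul (hdm w)
        (Finsupp.single_mem_supported A _ ((Finsupp.mem_supported A d).1 hdM hw))
    have : Finsupp.single x' (1 : A) = (gradedConn n k A y + constVec n k B c) + d := by
      rw [hd]; abel
    change Finsupp.single x' (1 : A) ∈ _
    rw [this]
    exact Submodule.add_mem_sup (Submodule.add_mem_sup ⟨y, hyN, rfl⟩ hcN) hdmM
  have hfinal := Submodule.le_of_le_smul_of_le_jacobson_bot hfg
    (IsLocalRing.maximalIdeal_le_jacobson _) hle
  obtain ⟨_, ⟨y, hy, rfl⟩, z, hz, hyz⟩ := Submodule.mem_sup.1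
    (hfinal (Finsupp.single_mem_supported A (1 : A) (show x ∈ {x' | tWeight x' = N} from rfl)))
  have hz' := (Finsupp.mem_supported A z).1 hz
  have hy' := (Finsupp.mem_supported A y).1 hy
  refine ⟨y, fun i => z (0, i), fun x' hx' => hy' (Finsupp.mem_support_iff.2 hx'), fun i hi =>
    (hz' (Finsupp.mem_support_iff.2 hi)).2, ?_⟩
  rw [← hyz]
  congr 1
  ext w
  rw [constVec_apply]
  split_ifs with hw
  · rw [← hw.1]
  · by_contra h0
    have := hz' (Finsupp.mem_support_iff.2 h0)
    exact hw ⟨this.1, this.2.1⟩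

end Lift

/-! ### Coordinates on `O` and `C` -/

section Coordinates

variable {p a : ℕ} [Fact p.Prime] (π : DworkPi p a) (n : ℕ)

theorem mem_nullFun_iff {J : Type*} (f : J → π.integers) : f ∈ NullFun (p : π.integers) J ↔
    ∀ ε : ℝ, 0 < ε → {j | ε ≤ ‖(f j : PadicAlgCl p)‖}.Finite := by
  constructor
  · intro h ε hε
    obtain ⟨m, hm⟩ := DworkPi.exists_pow_lt (p := p) hε
    refine (h m).subset fun j hj hd => ?_
    have h1 : ε ≤ ‖(f j : PadicAlgCl p)‖ := hj
    have h2 := (π.pow_dvd_iff m (f j)).1 hd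
    linarith
  · intro h m
    refine (h (((p : ℝ)⁻¹) ^ m) (pow_pos (DworkPi.inv_prime_pos p) m)).subset fun j hj => ?_
    have h1 : ¬ _ ≤ _ := fun h1 => hj ((π.pow_dvd_iff m (f j)).2 h1)
    exact (not_le.1 h1).le

theorem tendsto_zero_iff_finite (f : ℕ → PadicAlgCl p) :
    Tendsto f atTop (𝓝 0) ↔ ∀ ε : ℝ, 0 < ε → {j | ε ≤ ‖f j‖}.Finite := by
  rw [Metric.tendsto_atTop]
  refine forall₂_congr fun ε _ => ?_
  simp only [dist_zero_right]
  constructor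
  · rintro ⟨N, hN⟩
    refine (Set.finite_lt_nat N).subset fun j hj => ?_
    by_contra hcon
    exact absurd (hN j (not_lt.1 hcon)) (not_lt.2 hj)
  · intro h
    obtain ⟨R, hR⟩ := h.bddAbove
    refine ⟨R + 1, fun j hj => ?_⟩
    by_contra hcon
    have := hR (not_lt.1 hcon)
    omega

/-- The coordinates `a(r)` of `∑_r a(r) γ^{(n+1) r} t^r` in `O`. -/
def coordO : TypeO π n ≃ₗ[π.integers] NullFun (p : π.integers) ℕ where
  toFun ξ := ⟨fun r => ⟨normCoeff π n ξ.1 r, ξ.2.1 r⟩,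
    (mem_nullFun_iff π _).2 ((tendsto_zero_iff_finite _).1 ξ.2.2)⟩
  map_add' ξ η := Subtype.ext (funext fun r => Subtype.ext (normCoeff_add π n ξ.1 η.1 r))
  map_smul' c ξ := Subtype.ext (funext fun r => Subtype.ext (by
    have h : (c • ξ : TypeO π n).1 = (c : PadicAlgCl p) • ξ.1 := rfl
    change normCoeff π n (c • ξ : TypeO π n).1 r = (c : PadicAlgCl p) * normCoeff π n ξ.1 r
    rw [h, normCoeff, normCoeff, map_smul, smul_eq_mul, mul_div_assoc]))
  invFun f := ⟨PowerSeries.mk fun r => (f.1 r : PadicAlgCl p) * π.gamma ^ ((n + 1) * r), by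
    have h : ∀ r, normCoeff π n (PowerSeries.mk fun r => (f.1 r : PadicAlgCl p) *
        π.gamma ^ ((n + 1) * r)) r = f.1 r := fun r => by
      rw [normCoeff, PowerSeries.coeff_mk, mul_div_cancel_right₀ _ (pow_ne_zero _ π.gamma_ne_zero)]
    refine ⟨fun r => by rw [h]; exact (f.1 r).2, ?_⟩
    exact ((tendsto_zero_iff_finite _).2 ((mem_nullFun_iff π _).1 f.2)).congr fun r => (h r).symm⟩
  left_inv ξ := Subtype.ext (by
    ext r
    rw [PowerSeries.coeff_mk]
    exact div_mul_cancel₀ _ (pow_ne_zero _ π.gamma_ne_zero))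
  right_inv f := Subtype.ext (funext fun r => Subtype.ext (by
    change normCoeff π n (PowerSeries.mk fun r => (f.1 r : PadicAlgCl p) *
        π.gamma ^ ((n + 1) * r)) r = f.1 r
    rw [normCoeff, PowerSeries.coeff_mk, mul_div_cancel_right₀ _ (pow_ne_zero _ π.gamma_ne_zero)]))

theorem coordO_tMonomial (r : ℕ) : coordO π n (tMonomial π n r) = unitFun _ r := by
  refine Subtype.ext (funext fun s => ?_)
  have h : normCoeff π n (PowerSeries.monomial r (π.gamma ^ ((n + 1) * r))) s =
      if s = r then 1 else 0 := by
    rw [normCoeff, PowerSeries.coeff_monomial]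
    split_ifs with h
    · rw [h, div_self (pow_ne_zero _ π.gamma_ne_zero)]
    · rw [zero_div]
  rw [unitFun_apply]
  refine Subtype.ext (Eq.trans h ?_)
  split_ifs <;> rfl

theorem coordO_symm_unitFun (r : ℕ) : (coordO π n).symm (unitFun _ r) = tMonomial π n r := by
  rw [← coordO_tMonomial, LinearEquiv.symm_apply_apply]

variable {n}

/-- The exponent of `x` in the monomial `y_0^{v_0} ⋯ y_n^{v_n}`, where `y_0 = γ t / (x_1 ⋯ x_n)`
and `y_l = γ x_l`; the exponent of `t` is `v_0`. -/
def xExp (v : Fin (n + 1) → ℕ) : Fin n → ℤ := fun l => (v l.succ : ℤ) - v 0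

/-- The exponents in `y_0, …, y_n` of `t^s x^u`. -/
def yExp (u : Fin n → ℤ) (s : ℕ) : Fin (n + 1) → ℕ := Fin.cons s fun l => (u l + s).toNat

theorem mFun_xExp_le (v : Fin (n + 1) → ℕ) : mFun (xExp v) ≤ v 0 :=
  Finset.sup_le fun l _ => by rw [xExp]; omega

theorem xExp_yExp {u : Fin n → ℤ} {s : ℕ} (h : mFun u ≤ s) : xExp (yExp u s) = u := by
  funext l
  have := neg_le_mFun u l
  rw [xExp, yExp, Fin.cons_succ, Fin.cons_zero]
  omega

theorem yExp_xExp (v : Fin (n + 1) → ℕ) : yExp (xExp v) (v 0) = v := by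
  funext j
  refine Fin.cases ?_ (fun l => ?_) j
  · rfl
  · rw [yExp, Fin.cons_succ, xExp]
    omega

theorem coordC_mem (ζ : TypeC π n) : (fun v : Fin (n + 1) → ℕ =>
    (⟨lCoeff π ζ.1 (xExp v) (v 0), ((mem_RelC_iff π n ζ.1).1 ζ.2).2.1 _ _⟩ : π.integers)) ∈
      NullFun (p : π.integers) (Fin (n + 1) → ℕ) := by
  refine (mem_nullFun_iff π _).2 fun ε hε => ?_
  refine ((((mem_RelC_iff π n ζ.1).1 ζ.2).2.2 ε hε).preimage
    (f := fun v : Fin (n + 1) → ℕ => (xExp v, v 0)) fun v _ v' _ h => ?_).subset fun v hv => hv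
  rw [Prod.mk.injEq] at h
  rw [← yExp_xExp v, ← yExp_xExp v', h.1, h.2]

theorem lCoeff_add (ζ ζ' : Laurent p n) (u : Fin n → ℤ) (s : ℕ) :
    lCoeff π (ζ + ζ') u s = lCoeff π ζ u s + lCoeff π ζ' u s := by
  rw [lCoeff, lCoeff, lCoeff, Pi.add_apply, map_add, add_mul]

theorem lCoeff_sub (ζ ζ' : Laurent p n) (u : Fin n → ℤ) (s : ℕ) :
    lCoeff π (ζ - ζ') u s = lCoeff π ζ u s - lCoeff π ζ' u s := by
  rw [lCoeff, lCoeff, lCoeff, Pi.sub_apply, map_sub, sub_mul]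

/-- The coefficients of an element of `C` with respect to the monomials in `y_0, …, y_n`. -/
def coordCHom : TypeC π n →ₗ[π.integers] NullFun (p : π.integers) (Fin (n + 1) → ℕ) where
  toFun ζ := ⟨_, coordC_mem π ζ⟩
  map_add' ζ ζ' := Subtype.ext (funext fun v => Subtype.ext (lCoeff_add π ζ.1 ζ'.1 _ _))
  map_smul' c ζ := Subtype.ext (funext fun v => Subtype.ext (by
    have h : (c • ζ : TypeC π n).1 = (c : PadicAlgCl p) • ζ.1 := rfl
    change lCoeff π (c • ζ : TypeC π n).1 _ _ = (c : PadicAlgCl p) * lCoeff π ζ.1 _ _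
    rw [h, lCoeff_smul]))

theorem coordCHom_bijective : Function.Bijective (coordCHom π (n := n)) := by
  have hγ := π.gamma_ne_zero
  constructor
  · rw [← LinearMap.ker_eq_bot, LinearMap.ker_eq_bot']
    intro ζ hζ
    refine Subtype.ext (funext fun u => PowerSeries.ext fun s => ?_)
    by_cases hs : s < mFun u
    · exact ((mem_RelC_iff π n ζ.1).1 ζ.2).1 u s hs
    · have h1 : lCoeff π ζ.1 (xExp (yExp u s)) s = 0 := congrArg
        (fun f : NullFun (p : π.integers) (Fin (n + 1) → ℕ) => (f.1 (yExp u s) : PadicAlgCl p)) hζ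
      rw [xExp_yExp (not_lt.1 hs), lCoeff] at h1
      exact (mul_eq_zero.1 h1).resolve_right (zpow_ne_zero _ hγ)
  · intro f
    let η : Laurent p n := fun u => PowerSeries.mk fun s => if mFun u ≤ s then
      (f.1 (yExp u s) : PadicAlgCl p) * π.gamma ^ ((n + 1) * s + ∑ l, u l : ℤ) else 0
    have hη : ∀ u s, lCoeff π η u s = if mFun u ≤ s then (f.1 (yExp u s) : PadicAlgCl p) else 0 := by
      intro u s
      rw [lCoeff]
      change PowerSeries.coeff s (PowerSeries.mk _) * _ = _
      rw [PowerSeries.coeff_mk]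
      split_ifs
      · rw [mul_assoc, ← zpow_add₀ hγ, add_neg_cancel, zpow_zero, mul_one]
      · rw [zero_mul]
    have hmem : η ∈ RelC π n := by
      rw [mem_RelC_iff]
      refine ⟨fun u s hs => ?_, fun u s => ?_, fun ε hε => ?_⟩
      · change PowerSeries.coeff s (PowerSeries.mk _) = _
        rw [PowerSeries.coeff_mk, if_neg (by omega)]
      · rw [hη]
        split_ifs
        · exact (f.1 _).2
        · exact zero_mem _
      · refine (((mem_nullFun_iff π _).1 f.2 ε hε).image fun v => (xExp v, v 0)).subset ?_
        rintro ⟨u, s⟩ hx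
        have hx' : ε ≤ ‖lCoeff π η u s‖ := hx
        rw [hη] at hx'
        split_ifs at hx' with hs
        · exact ⟨yExp u s, hx', Prod.ext (xExp_yExp hs) rfl⟩
        · rw [norm_zero] at hx'; linarith
    refine ⟨⟨η, hmem⟩, Subtype.ext (funext fun v => Subtype.ext ?_)⟩
    change lCoeff π η (xExp v) (v 0) = _
    rw [hη, if_pos (mFun_xExp_le v), yExp_xExp]

/-- The module `C` as the module of restricted power series in `y_0, …, y_n`. -/
def coordC : TypeC π n ≃ₗ[π.integers] NullFun (p : π.integers) (Fin (n + 1) → ℕ) :=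
  LinearEquiv.ofBijective _ (coordCHom_bijective π)

theorem coordC_apply (ζ : TypeC π n) (v : Fin (n + 1) → ℕ) :
    ((coordC π ζ).1 v : PadicAlgCl p) = lCoeff π ζ.1 (xExp v) (v 0) := rfl

/-- The coefficient of `y^v` in `∑_i c_i y_j^{p^i} x`. Terms with `i ≥ v_j` do not contribute, as
`i < p^i`. -/
def mulCoeff (x : (Fin (n + 1) → ℕ) → π.integers) (j : Fin (n + 1)) (v : Fin (n + 1) → ℕ) :
    π.integers :=
  ∑ i ∈ Finset.range (v j), if p ^ i ≤ v j then π.unitCoef i * x (v - Pi.single j (p ^ i)) else 0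

theorem mulCoeff_eq (x : (Fin (n + 1) → ℕ) → π.integers) (j : Fin (n + 1)) (v : Fin (n + 1) → ℕ)
    {N : ℕ} (hN : v j ≤ N) : mulCoeff π x j v =
      ∑ i ∈ Finset.range N, if p ^ i ≤ v j then π.unitCoef i * x (v - Pi.single j (p ^ i)) else 0 := by
  refine Finset.sum_subset (Finset.range_mono hN) fun i _ hi => if_neg fun h => hi ?_
  have : i < p ^ i := Nat.lt_pow_self (Fact.out : p.Prime).one_lt
  exact Finset.mem_range.2 (this.trans_le h)

theorem exists_good_xExp (v : Fin (n + 1) → ℕ) : ∃ N, Good N (xExp v) (v 0) ∧ ∀ j, v j ≤ N := by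
  refine ⟨∑ j, v j + 1, ⟨?_, fun l => ?_⟩, fun j => ?_⟩
  · exact Nat.lt_succ_of_le (Finset.single_le_sum (fun _ _ => Nat.zero_le _) (Finset.mem_univ 0))
  · have : v l.succ ≤ ∑ j, v j :=
      Finset.single_le_sum (fun _ _ => Nat.zero_le _) (Finset.mem_univ l.succ)
    rw [xExp]
    push_cast
    have h2 : ((v l.succ : ℕ) : ℤ) ≤ ((∑ j, v j : ℕ) : ℤ) := by exact_mod_cast this
    push_cast at h2
    linarith
  · exact (Finset.single_le_sum (fun _ _ => Nat.zero_le _) (Finset.mem_univ j)).trans (by omega)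

theorem lCoeff_seriesMul_single (ζ : TypeC π n) (l : Fin n) (v : Fin (n + 1) → ℕ) :
    lCoeff π (seriesMul π 0 (Pi.single l 1) ζ.1) (xExp v) (v 0) =
      mulCoeff π (coordC π ζ).1 l.succ v := by
  have hS : Supp ζ.1 := supp_of_mem π ζ.2
  obtain ⟨N, hN, hvN⟩ := exists_good_xExp v
  rw [hS.lCoeff_seriesMul π (isKloExp_single l) hN, mulCoeff_eq π _ _ _ (hvN _),
    ← Subring.coe_subtype, map_sum]
  refine Finset.sum_congr rfl fun i _ => ?_
  rw [zero_mul, if_pos (Nat.zero_le _), apply_ite π.integers.subtype, map_zero, map_mul]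
  split_ifs with h
  · refine congrArg (fun z => π.coef i / π.gamma ^ p ^ i * z) ?_
    rw [Subring.coe_subtype, coordC_apply]
    have h0 : (v - Pi.single l.succ (p ^ i) : Fin (n + 1) → ℕ) 0 = v 0 := by
      rw [Pi.sub_apply, Pi.single_eq_of_ne (Fin.succ_ne_zero l).symm, Nat.sub_zero]
    rw [h0, Nat.sub_zero]
    congr 1
    funext l'
    rw [Pi.sub_apply, Pi.smul_apply, xExp, xExp, h0, Pi.sub_apply]
    by_cases hl : l' = l
    · subst hl
      rw [Pi.single_eq_same, Pi.single_eq_same, Nat.cast_sub h, nsmul_eq_mul]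
      ring
    · rw [Pi.single_eq_of_ne hl, Pi.single_eq_of_ne ((Fin.succ_injective n).ne hl)]
      simp
  · have hz : lCoeff π ζ.1 (xExp v - p ^ i • Pi.single l 1) (v 0 - 0) = 0 := by
      rw [lCoeff, hS.coeff_eq_zero (l := l), zero_mul]
      rw [Pi.sub_apply, Pi.smul_apply, Pi.single_eq_same, xExp, nsmul_eq_mul, Nat.sub_zero]
      have : (v l.succ : ℤ) < ((p ^ i : ℕ) : ℤ) := by exact_mod_cast not_le.1 h
      linarith
    rw [hz, mul_zero]

theorem lCoeff_seriesMul_neg (ζ : TypeC π n) (v : Fin (n + 1) → ℕ) :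
    lCoeff π (seriesMul π 1 (fun _ => -1) ζ.1) (xExp v) (v 0) =
      mulCoeff π (coordC π ζ).1 0 v := by
  have hS : Supp ζ.1 := supp_of_mem π ζ.2
  obtain ⟨N, hN, hvN⟩ := exists_good_xExp v
  rw [hS.lCoeff_seriesMul π (isKloExp_neg n) hN, mulCoeff_eq π _ _ _ (hvN _),
    ← Subring.coe_subtype, map_sum]
  refine Finset.sum_congr rfl fun i _ => ?_
  rw [one_mul, apply_ite π.integers.subtype, map_zero, map_mul]
  split_ifs with h
  · refine congrArg (fun z => π.coef i / π.gamma ^ p ^ i * z) ?_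
    rw [Subring.coe_subtype, coordC_apply, Pi.sub_apply, Pi.single_eq_same]
    congr 1
    funext l'
    rw [Pi.sub_apply, Pi.smul_apply, xExp, xExp, Pi.sub_apply, Pi.sub_apply, Pi.single_eq_same,
      Pi.single_eq_of_ne (Fin.succ_ne_zero l'), Nat.cast_sub h, nsmul_eq_mul]
    simp
    ring
  · rfl

theorem coordC_relDiff (ζ : TypeC π n) (l : Fin n) (v : Fin (n + 1) → ℕ) :
    (coordC π (relDiff π n l ζ)).1 v = ((v l.succ : π.integers) - v 0) * (coordC π ζ).1 v +
      mulCoeff π (coordC π ζ).1 l.succ v - mulCoeff π (coordC π ζ).1 0 v := by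
  refine Subtype.ext ?_
  change lCoeff π (thetaX l ζ.1 + seriesMul π 0 (Pi.single l 1) ζ.1 -
    seriesMul π 1 (fun _ => -1) ζ.1) (xExp v) (v 0) = ((v l.succ : PadicAlgCl p) - v 0) *
      lCoeff π ζ.1 (xExp v) (v 0) + mulCoeff π (coordC π ζ).1 l.succ v -
        mulCoeff π (coordC π ζ).1 0 v
  rw [lCoeff_sub, lCoeff_add, lCoeff_seriesMul_single, lCoeff_seriesMul_neg]
  congr 2
  rw [lCoeff]
  change PowerSeries.coeff _ ((((xExp v l : ℤ)) : PadicAlgCl p) • ζ.1 (xExp v)) * _ = _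
  rw [map_smul, smul_eq_mul, mul_assoc, xExp]
  push_cast
  rfl

theorem coordC_relConn (ζ : TypeC π n) (v : Fin (n + 1) → ℕ) :
    (coordC π (relConn π n ζ)).1 v = (v 0 : π.integers) * (coordC π ζ).1 v +
      mulCoeff π (coordC π ζ).1 0 v := by
  refine Subtype.ext ?_
  change lCoeff π (thetaT p n ζ.1 + seriesMul π 1 (fun _ => -1) ζ.1) (xExp v) (v 0) =
    (v 0 : PadicAlgCl p) * lCoeff π ζ.1 (xExp v) (v 0) + mulCoeff π (coordC π ζ).1 0 v
  rw [lCoeff_add, lCoeff_seriesMul_neg]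
  congr 1
  rw [lCoeff]
  change PowerSeries.coeff _ (thetaPS p (ζ.1 (xExp v))) * _ = _
  rw [coeff_thetaPS, mul_assoc]
  rfl

theorem truncX_comm (N : ℕ) (l m : Fin n) :
    truncX π N l * truncX π N m = truncX π N m * truncX π N l := by
  by_cases hlm : l = m
  · rw [hlm]
  set Y := truncMul π N 1 (fun _ : Fin n => (-1 : ℤ)) with hY
  set Z := ∑ i ∈ Finset.range N,
    (π.coef i * (p ^ i : PadicAlgCl p)) • (monoMul 1 (fun _ : Fin n => (-1 : ℤ)) i :
      Module.End (PadicAlgCl p) (Laurent p n)) with hZ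
  have h1 : ∀ l : Fin n, thetaX l * Y = Y * thetaX l - Z := fun l => by
    rw [hY, hZ, truncMul, Finset.mul_sum, Finset.sum_mul, ← Finset.sum_sub_distrib]
    refine Finset.sum_congr rfl fun i _ => ?_
    rw [mul_smul_comm, thetaX_monoMul, smul_mul_assoc, smul_add, smul_smul, sub_eq_add_neg]
    congr 1
    rw [Int.cast_neg, Int.cast_one, mul_neg_one, mul_neg]
    exact neg_smul _ _
  have h3 : ∀ l m : Fin n, l ≠ m → thetaX l * truncMul π N 0 (Pi.single m (1 : ℤ)) =
      truncMul π N 0 (Pi.single m (1 : ℤ)) * thetaX l := fun l m hlm => by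
    rw [truncMul, Finset.mul_sum, Finset.sum_mul]
    refine Finset.sum_congr rfl fun i _ => ?_
    rw [mul_smul_comm, thetaX_monoMul, smul_mul_assoc, Pi.single_eq_of_ne hlm, Int.cast_zero,
      mul_zero, zero_smul, add_zero]
  have h4 : ∀ m : Fin n, Y * truncMul π N 0 (Pi.single m (1 : ℤ)) =
      truncMul π N 0 (Pi.single m (1 : ℤ)) * Y := fun m => truncMul_comm π N _ _ _ _
  have h5 : truncMul π N 0 (Pi.single l (1 : ℤ)) * truncMul π N 0 (Pi.single m (1 : ℤ)) =
      truncMul π N 0 (Pi.single m (1 : ℤ)) * truncMul π N 0 (Pi.single l (1 : ℤ)) :=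
    truncMul_comm π N _ _ _ _
  have h6 : (thetaX l * thetaX m : Module.End (PadicAlgCl p) (Laurent p n)) =
      thetaX m * thetaX l := by
    ext ζ u : 2
    change (u l : PadicAlgCl p) • (u m : PadicAlgCl p) • ζ u = _
    exact smul_comm (u l : PadicAlgCl p) (u m : PadicAlgCl p) (ζ u)
  rw [truncX, truncX, ← hY]
  simp only [mul_add, add_mul, sub_mul, mul_sub, h1, h3 l m hlm, h3 m l (Ne.symm hlm), h4, h5, h6]
  abel

theorem relDiff_comm (l m : Fin n) (ζ : TypeC π n) :
    relDiff π n l (relDiff π n m ζ) = relDiff π n m (relDiff π n l ζ) := by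
  refine Subtype.ext (eq_of_agree fun N => ?_)
  have key : ∀ l m : Fin n, Agree N (diffX π l (diffX π m ζ.1))
      (truncX π N l (truncX π N m ζ.1)) := fun l m =>
    ((supp_of_mem π (diffX_mem π ζ.2 m)).agree_diffX π N l).trans
      (((supp_of_mem π ζ.2).agree_diffX π N m).truncX π l N)
  have h5 : truncX π N l (truncX π N m ζ.1) = truncX π N m (truncX π N l ζ.1) :=
    LinearMap.congr_fun (truncX_comm π N l m) ζ.1
  exact (key l m).trans (h5 ▸ (key m l).symm)

end Coordinates

/-! ### Leading terms of the operators -/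

section LeadingTerms

variable {p a : ℕ} [Fact p.Prime] (π : DworkPi p a) {n : ℕ}

theorem nullFun_of_pow_dvd {A J : Type*} [CommRing A] {ϖ : A} {wt : J → ℕ}
    (hfin : ∀ N, {j | wt j ≤ N}.Finite) {N : ℕ} {f : J → A} (h : ∀ j, ϖ ^ (wt j - N) ∣ f j) :
    f ∈ NullFun ϖ J := fun m => (hfin (N + m)).subset fun j hj => by
  by_contra hcon
  have : N + m < wt j := not_le.1 hcon
  exact hj ((pow_dvd_pow ϖ (by omega)).trans (h j))

/-- The total degree of the monomial `y^v`. -/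
def vDeg (v : Fin (n + 1) → ℕ) : ℕ := ∑ j, v j

theorem vDeg_add (v w : Fin (n + 1) → ℕ) : vDeg (v + w) = vDeg v + vDeg w :=
  Finset.sum_add_distrib

theorem vDeg_single (j : Fin (n + 1)) (m : ℕ) : vDeg (Pi.single j m) = m :=
  Fintype.sum_pi_single' j m

theorem finite_vDeg_le (N : ℕ) : {v : Fin (n + 1) → ℕ | vDeg v ≤ N}.Finite :=
  (Set.finite_Iic (fun _ : Fin (n + 1) => N)).subset fun _ hv j =>
    (Finset.single_le_sum (fun _ _ => Nat.zero_le _) (Finset.mem_univ j)).trans hv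

theorem sub_single_eq_iff {v w : Fin (n + 1) → ℕ} {j : Fin (n + 1)} {m : ℕ} (h : m ≤ v j) :
    v - Pi.single j m = w ↔ v = w + Pi.single j m := by
  have h2 : Pi.single j m ≤ v := by
    intro i
    by_cases hi : i = j
    · subst hi; rwa [Pi.single_eq_same]
    · rw [Pi.single_eq_of_ne hi]; exact Nat.zero_le _
  exact tsub_eq_iff_eq_add_of_le h2

/-- Multiplication by `∑_i c_i y_j^{p^i}` maps `y^w` to `y^w y_j`, up to a multiple of `p` whose
terms are as divisible as their degree requires. -/
theorem exists_mulCoeff_unitFun (w : Fin (n + 1) → ℕ) (j : Fin (n + 1))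
    {P : Set (Fin (n + 1) → ℕ)} (hP : ∀ m, w + Pi.single j m ∈ P) :
    ∃ y ∈ fil (p : π.integers) vDeg P (vDeg w + 2), ∀ v,
      mulCoeff π (unitFun (p : π.integers) w).1 j v =
        (unitFun (p : π.integers) (w + Pi.single j 1)).1 v + p * y.1 v := by
  classical
  have hp := (Fact.out : p.Prime).two_le
  -- the terms with `i ≥ 1`
  set g : (Fin (n + 1) → ℕ) → π.integers := fun v => ∑ i ∈ Finset.range (v j),
    if p ^ (i + 1) ≤ v j then π.unitCoef (i + 1) *
      (unitFun (p : π.integers) w).1 (v - Pi.single j (p ^ (i + 1))) else 0 with hg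
  have h0 : ∀ v, mulCoeff π (unitFun (p : π.integers) w).1 j v =
      (unitFun (p : π.integers) (w + Pi.single j 1)).1 v + g v := fun v => by
    rw [mulCoeff_eq π _ j v (Nat.le_succ _), Finset.sum_range_succ', add_comm]
    congr 1
    rw [pow_zero, DworkPi.unitCoef_zero, one_mul, unitFun_apply, unitFun_apply]
    by_cases hv : 1 ≤ v j
    · simp only [if_pos hv, sub_single_eq_iff hv]
    · rw [if_neg hv, if_neg]
      rintro rfl
      simp at hv
  have hterm : ∀ v i, p ^ (i + 1) ≤ v j → v - Pi.single j (p ^ (i + 1)) = w →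
      v ∈ P ∧ (p : π.integers) ^ (1 + (vDeg v - (vDeg w + 2))) ∣ π.unitCoef (i + 1) := by
    intro v i h1 h2
    rw [sub_single_eq_iff h1] at h2
    subst h2
    refine ⟨hP _, (pow_dvd_pow _ ?_).trans (π.pow_dvd_unitCoef (i + 1))⟩
    rw [vDeg_add, vDeg_single]
    have : p ≤ p ^ (i + 1) := Nat.le_self_pow (by omega) p
    omega
  have hdvd : ∀ v, (p : π.integers) ^ (1 + (vDeg v - (vDeg w + 2))) ∣ g v := fun v =>
    Finset.dvd_sum fun i _ => by
      split_ifs with h1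
      · by_cases h2 : v - Pi.single j (p ^ (i + 1)) = w
        · exact Dvd.dvd.mul_right (hterm v i h1 h2).2 _
        · rw [unitFun_of_ne h2, mul_zero]; exact dvd_zero _
      · exact dvd_zero _
  have hsupp : ∀ v, v ∉ P → g v = 0 := fun v hv => Finset.sum_eq_zero fun i _ => by
    split_ifs with h1
    · by_cases h2 : v - Pi.single j (p ^ (i + 1)) = w
      · exact absurd (hterm v i h1 h2).1 hv
      · rw [unitFun_of_ne h2, mul_zero]
    · rfl
  have hnull : g ∈ NullFun (p : π.integers) (Fin (n + 1) → ℕ) :=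
    nullFun_of_pow_dvd (finite_vDeg_le (n := n)) (N := vDeg w + 2)
      fun v => (pow_dvd_pow _ (by omega)).trans (hdvd v)
  choose g' hg' using fun v => (dvd_pow_self (p : π.integers)
    (show 1 + (vDeg v - (vDeg w + 2)) ≠ 0 by omega)).trans (hdvd v)
  have hne := π.natCast_ne_zero
  have hg'dvd : ∀ v, (p : π.integers) ^ (vDeg v - (vDeg w + 2)) ∣ g' v := fun v => by
    have h1 := hdvd v
    rwa [hg', add_comm, pow_succ', mul_dvd_mul_iff_left hne] at h1
  refine ⟨⟨g', nullFun_of_pow_dvd (finite_vDeg_le (n := n)) hg'dvd⟩, ⟨hg'dvd, fun v hv => ?_⟩,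
    fun v => by rw [h0, hg']⟩
  have h1 := hsupp v hv
  rw [hg'] at h1
  exact (mul_eq_zero.1 h1).resolve_left hne

/-- `D_{t,l}` on restricted power series in `y_0, …, y_n`. -/
def diffY (l : Fin n) : NullFun (p : π.integers) (Fin (n + 1) → ℕ) →ₗ[π.integers]
    NullFun (p : π.integers) (Fin (n + 1) → ℕ) :=
  (coordC π).toLinearMap ∘ₗ ((relDiff π n l).restrictScalars π.integers) ∘ₗ
    (coordC π).symm.toLinearMap

/-- `∂` on restricted power series in `y_0, …, y_n`. -/
def connY : NullFun (p : π.integers) (Fin (n + 1) → ℕ) →ₗ[π.integers]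
    NullFun (p : π.integers) (Fin (n + 1) → ℕ) :=
  (coordC π).toLinearMap ∘ₗ (relConn π n) ∘ₗ (coordC π).symm.toLinearMap

theorem diffY_coordC (l : Fin n) (ζ : TypeC π n) :
    diffY π l (coordC π ζ) = coordC π (relDiff π n l ζ) := by
  change coordC π (relDiff π n l ((coordC π).symm (coordC π ζ))) = _
  rw [LinearEquiv.symm_apply_apply]

theorem connY_coordC (ζ : TypeC π n) : connY π (coordC π ζ) = coordC π (relConn π n ζ) := by
  change coordC π (relConn π n ((coordC π).symm (coordC π ζ))) = _
  rw [LinearEquiv.symm_apply_apply]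

theorem diffY_comm (l m : Fin n) (x : NullFun (p : π.integers) (Fin (n + 1) → ℕ)) :
    diffY π l (diffY π m x) = diffY π m (diffY π l x) := by
  obtain ⟨ζ, rfl⟩ := (coordC π).surjective x
  rw [diffY_coordC, diffY_coordC, diffY_coordC, diffY_coordC, relDiff_comm]

theorem diffY_apply (l : Fin n) (x : NullFun (p : π.integers) (Fin (n + 1) → ℕ))
    (v : Fin (n + 1) → ℕ) : (diffY π l x).1 v = ((v l.succ : π.integers) - v 0) * x.1 v +
      mulCoeff π x.1 l.succ v - mulCoeff π x.1 0 v := by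
  obtain ⟨ζ, rfl⟩ := (coordC π).surjective x
  rw [diffY_coordC, coordC_relDiff]

theorem connY_apply (x : NullFun (p : π.integers) (Fin (n + 1) → ℕ)) (v : Fin (n + 1) → ℕ) :
    (connY π x).1 v = (v 0 : π.integers) * x.1 v + mulCoeff π x.1 0 v := by
  obtain ⟨ζ, rfl⟩ := (coordC π).surjective x
  rw [connY_coordC, coordC_relConn]

theorem mul_unitFun_apply {A J : Type*} [CommRing A] {ϖ : A} (f : J → A) (i j : J) :
    f i * (unitFun ϖ j).1 i = f j * (unitFun ϖ j).1 i := by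
  by_cases h : i = j
  · rw [h]
  · rw [unitFun_of_ne h, mul_zero, mul_zero]

theorem exists_diffY_unitFun (l : Fin n) (w : Fin (n + 1) → ℕ) {P : Set (Fin (n + 1) → ℕ)}
    (h1 : ∀ m, w + Pi.single l.succ m ∈ P) (h2 : ∀ m, w + Pi.single 0 m ∈ P) :
    ∃ y ∈ fil (p : π.integers) vDeg P (vDeg w + 2), diffY π l (unitFun _ w) =
      ((w l.succ : π.integers) - w 0) • unitFun _ w + unitFun _ (w + Pi.single l.succ 1) -
        unitFun _ (w + Pi.single 0 1) + (p : π.integers) • y := by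
  obtain ⟨y, hy, hy'⟩ := exists_mulCoeff_unitFun π w l.succ h1
  obtain ⟨z, hz, hz'⟩ := exists_mulCoeff_unitFun π w 0 h2
  refine ⟨y - z, sub_mem hy hz, Subtype.ext (funext fun v => ?_)⟩
  rw [diffY_apply, hy', hz',
    mul_unitFun_apply (fun v : Fin (n + 1) → ℕ => (v l.succ : π.integers) - v 0)]
  change _ = ((w l.succ : π.integers) - w 0) * (unitFun (p : π.integers) w).1 v +
    (unitFun (p : π.integers) (w + Pi.single l.succ 1)).1 v -
      (unitFun (p : π.integers) (w + Pi.single 0 1)).1 v + p * (y.1 v - z.1 v)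
  ring

theorem exists_connY_unitFun (w : Fin (n + 1) → ℕ) :
    ∃ y ∈ fil (p : π.integers) vDeg Set.univ (vDeg w + 2), connY π (unitFun _ w) =
      (w 0 : π.integers) • unitFun _ w + unitFun _ (w + Pi.single 0 1) +
        (p : π.integers) • y := by
  obtain ⟨z, hz, hz'⟩ := exists_mulCoeff_unitFun π w 0 (P := Set.univ) fun _ => Set.mem_univ _
  refine ⟨z, hz, Subtype.ext (funext fun v => ?_)⟩
  rw [connY_apply, hz', mul_unitFun_apply (fun v : Fin (n + 1) → ℕ => (v 0 : π.integers))]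
  exact (add_assoc _ _ _).symm

theorem diffY_unitFun_sub_mem (l : Fin n) (w : Fin (n + 1) → ℕ) {P : Set (Fin (n + 1) → ℕ)}
    (h1 : ∀ m, w + Pi.single l.succ m ∈ P) (h2 : ∀ m, w + Pi.single 0 m ∈ P) :
    diffY π l (unitFun _ w) - (unitFun _ (w + Pi.single l.succ 1) -
      unitFun _ (w + Pi.single 0 1)) ∈ filStrict (p : π.integers) vDeg P (vDeg w + 1) := by
  obtain ⟨y, hy, h⟩ := exists_diffY_unitFun π l w h1 h2
  have hw : w ∈ P := by simpa using h1 0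
  have : diffY π l (unitFun _ w) - (unitFun _ (w + Pi.single l.succ 1) -
      unitFun _ (w + Pi.single 0 1)) =
      ((w l.succ : π.integers) - w 0) • unitFun _ w + (p : π.integers) • y := by
    rw [h]; abel
  rw [this]
  exact add_mem (Submodule.smul_mem _ _ (fil_lt_le_filStrict _ _ (Nat.lt_succ_self _)
    (unitFun_mem_fil hw le_rfl))) (smul_fil_mem_filStrict hy)

end LeadingTerms

/-! ### The top cohomology -/

section TopCohomology

variable {p a : ℕ} [Fact p.Prime] (π : DworkPi p a) {n : ℕ}

/-- The exponents of the monomials in which the variables `y_1, …, y_m` do not occur. -/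
def lowFree (n m : ℕ) : Set (Fin (n + 1) → ℕ) := {v | ∀ l : Fin n, (l : ℕ) < m → v l.succ = 0}

theorem add_single_zero_mem_lowFree {m : ℕ} {w : Fin (n + 1) → ℕ} (hw : w ∈ lowFree n m) (s : ℕ) :
    w + Pi.single 0 s ∈ lowFree n m := fun l hl => by
  rw [Pi.add_apply, hw l hl, Pi.single_eq_of_ne (Fin.succ_ne_zero l), add_zero]

theorem add_single_succ_mem_lowFree {m : ℕ} {w : Fin (n + 1) → ℕ} (hw : w ∈ lowFree n m)
    {l : Fin n} (hl : m ≤ l) (s : ℕ) : w + Pi.single l.succ s ∈ lowFree n m := fun i hi => by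
  have : i ≠ l := by rintro rfl; omega
  rw [Pi.add_apply, hw i hi, Pi.single_eq_of_ne ((Fin.succ_injective n).ne this),
    add_zero]

/-- The null families supported in `P`. -/
def suppIn {A J : Type*} [CommRing A] (ϖ : A) (P : Set J) : Submodule A (NullFun ϖ J) where
  carrier := {x | ∀ j, j ∉ P → x.1 j = 0}
  zero_mem' _ _ := rfl
  add_mem' hf hg j hj := by
    change _ + _ = (0 : A)
    rw [hf j hj, hg j hj, add_zero]
  smul_mem' c f hf j hj := by rw [NullFun.smul_apply, hf j hj, mul_zero]

theorem mulCoeff_eq_zero {x : (Fin (n + 1) → ℕ) → π.integers} {j : Fin (n + 1)}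
    {v : Fin (n + 1) → ℕ} (h : ∀ m, x (v - Pi.single j m) = 0) : mulCoeff π x j v = 0 :=
  Finset.sum_eq_zero fun i _ => by rw [h, mul_zero, ite_self]

theorem diffY_mem_suppIn {m : ℕ} {l : Fin n} (hl : m ≤ l)
    {x : NullFun (p : π.integers) (Fin (n + 1) → ℕ)} (hx : x ∈ suppIn _ (lowFree n m)) :
    diffY π l x ∈ suppIn (p : π.integers) (lowFree n m) := fun v hv => by
  have key : ∀ j : Fin (n + 1), (∀ i : Fin n, (i : ℕ) < m → i.succ ≠ j) → ∀ s,
      x.1 (v - Pi.single j s) = 0 := fun j hj s => hx _ fun hs => hv fun i hi => by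
    have h1 := hs i hi
    rwa [Pi.sub_apply, Pi.single_eq_of_ne (hj i hi), Nat.sub_zero] at h1
  rw [diffY_apply, hx v hv, mul_zero, zero_add,
    mulCoeff_eq_zero π (key l.succ fun i hi h => by
      have := Fin.succ_injective n h
      subst this
      omega),
    mulCoeff_eq_zero π (key 0 fun i _ => Fin.succ_ne_zero i), sub_zero]

variable (ha : 1 ≤ a)
include ha

/-- Modulo `D_{t,m}` the variable `y_m` can be eliminated. -/
theorem exists_diffY_add_eq (m : Fin n) {x : NullFun (p : π.integers) (Fin (n + 1) → ℕ)}
    (hx : x ∈ suppIn _ (lowFree n m)) : ∃ z ∈ suppIn (p : π.integers) (lowFree n m),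
      ∃ x' ∈ suppIn (p : π.integers) (lowFree n (m + 1)), diffY π m z + x' = x := by
  let V := Fin (n + 1) → ℕ
  let Φ : NullFun (p : π.integers) (V ⊕ V) →ₗ[π.integers] NullFun (p : π.integers) V :=
    diffY π m ∘ₗ NullFun.comap Sum.inl Sum.inl_injective +
      NullFun.comap Sum.inr Sum.inr_injective
  have hl : ∀ v : V, Φ (unitFun _ (Sum.inl v)) = diffY π m (unitFun _ v) := fun v => by
    change diffY π m (NullFun.comap _ _ _) + NullFun.comap _ _ _ = _
    rw [NullFun.comap_unitFun, NullFun.comap_unitFun_of_not _ _ (by simp), add_zero]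
  have hr : ∀ v : V, Φ (unitFun _ (Sum.inr v)) = unitFun _ v := fun v => by
    change diffY π m (NullFun.comap _ _ _) + NullFun.comap _ _ _ = _
    rw [NullFun.comap_unitFun, NullFun.comap_unitFun_of_not _ _ (by simp), map_zero, zero_add]
  let Q : Set (V ⊕ V) := {j | Sum.elim (· ∈ lowFree n m) (· ∈ lowFree n (m + 1)) j}
  let wt₁ : V ⊕ V → ℕ := Sum.elim (fun v => vDeg v + 1) vDeg
  have hS : ∀ (s : ℕ) (v : V), v m.succ = s → v ∈ lowFree n m →
      ∃ y ∈ fil (p : π.integers) wt₁ Q (vDeg v),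
        Φ y - unitFun _ v ∈ filStrict (p : π.integers) vDeg (lowFree n m) (vDeg v) := by
    intro s
    induction s with
    | zero =>
      intro v hv0 hv
      refine ⟨unitFun _ (Sum.inr v), unitFun_mem_fil ?_ le_rfl, ?_⟩
      · intro l hlt
        rcases Nat.lt_succ_iff_lt_or_eq.1 hlt with h | h
        · exact hv l h
        · rwa [Fin.ext h]
      · rw [hr, sub_self]; exact zero_mem _
    | succ s ih =>
      intro v hvs hv
      obtain ⟨w, rfl⟩ : ∃ w : V, v = w + Pi.single m.succ 1 :=
        ⟨v - Pi.single m.succ 1, (sub_single_eq_iff (by omega)).1 rfl⟩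
      have hw : w ∈ lowFree n m := fun l hlt => by
        have := hv l hlt
        rw [Pi.add_apply] at this
        omega
      have hdeg : ∀ j, vDeg (w + Pi.single j 1) = vDeg w + 1 := fun j => by
        rw [vDeg_add, vDeg_single]
      obtain ⟨y, hy, hy'⟩ := ih (w + Pi.single 0 1) (by
        rw [Pi.add_apply, Pi.single_eq_same] at hvs
        rw [Pi.add_apply, Pi.single_eq_of_ne (Fin.succ_ne_zero m)]
        omega) (add_single_zero_mem_lowFree hw 1)
      rw [hdeg] at hy hy' ⊢
      refine ⟨unitFun _ (Sum.inl w) + y, add_mem (unitFun_mem_fil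
        (show Sum.inl w ∈ Q from hw) le_rfl) hy, ?_⟩
      have h1 := add_mem (diffY_unitFun_sub_mem π m w (add_single_succ_mem_lowFree hw le_rfl)
        (add_single_zero_mem_lowFree hw)) hy'
      rw [map_add, hl]
      convert h1 using 1
      abel
  obtain ⟨y, hy, hyx⟩ := exists_preimage (π.isCoeffRing ha) (finite_vDeg_le (n := n)) Φ Q
    (lowFree n m) (fun v hv => hS _ v rfl hv) hx
  exact ⟨_, fun v hv => hy (Sum.inl v) hv, _, fun v hv => hy (Sum.inr v) hv, hyx⟩

/-- The image of `D_{t,l}` is contained in the sum of the `D_{t,m} C_m`, where `C_m` consists of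
the series in which `y_1, …, y_{m-1}` do not occur. This uses that the operators commute. -/
theorem exists_sum_diffY_eq (x : Fin n → NullFun (p : π.integers) (Fin (n + 1) → ℕ)) :
    ∃ z : Fin n → NullFun (p : π.integers) (Fin (n + 1) → ℕ),
      (∀ m : Fin n, z m ∈ suppIn (p : π.integers) (lowFree n m)) ∧
        ∑ m, diffY π m (z m) = ∑ l, diffY π l (x l) := by
  classical
  let W : Submodule π.integers (NullFun (p : π.integers) (Fin (n + 1) → ℕ)) :=
    ⨆ m : Fin n, (suppIn (p : π.integers) (lowFree n m)).map (diffY π m)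
  have key : ∀ (l : Fin n) (d m : ℕ), m + d = l → ∀ ζ ∈ suppIn (p : π.integers) (lowFree n m),
      diffY π l ζ ∈ W := by
    intro l d
    induction d with
    | zero =>
      intro m hm ζ hζ
      rw [add_zero] at hm
      subst hm
      exact Submodule.mem_iSup_of_mem l ⟨ζ, hζ, rfl⟩
    | succ d ih =>
      intro m hm ζ hζ
      obtain ⟨z, hz, ζ', hζ', rfl⟩ := exists_diffY_add_eq π ha (⟨m, by omega⟩ : Fin n) hζ
      rw [map_add, diffY_comm]
      exact add_mem (Submodule.mem_iSup_of_mem _ ⟨_, diffY_mem_suppIn π (by simp; omega) hz, rfl⟩)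
        (ih (m + 1) (by omega) ζ' hζ')
  have hmem : ∑ l, diffY π l (x l) ∈ W := sum_mem fun l _ =>
    key l l 0 (zero_add _) (x l) fun v hv => absurd (fun i hi => absurd hi (Nat.not_lt_zero _)) hv
  obtain ⟨f, hf, hfx⟩ := (Submodule.mem_iSup_iff_exists_finsupp _ _).1 hmem
  choose z hz hzf using hf
  refine ⟨z, hz, ?_⟩
  rw [← hfx, Finsupp.sum_fintype _ _ fun _ => rfl]
  exact Finset.sum_congr rfl fun m _ => hzf m

end TopCohomology

/-! ### A basis of the top cohomology -/

section Basis

variable {p a : ℕ} [Fact p.Prime] (π : DworkPi p a) {n : ℕ}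

theorem yExp_injective (u : Fin n → ℤ) : Function.Injective (yExp u) := fun _ _ h =>
  congrFun h 0

theorem mFun_prefixVec (j : Fin (n + 1)) : mFun (prefixVec n j) = 0 := by
  rw [mFun, ← Nat.bot_eq_zero, Finset.sup_eq_bot_iff]
  intro l _
  rw [prefixVec]
  split_ifs <;> simp

theorem sum_prefixVec (j : Fin (n + 1)) : ∑ l, prefixVec n j l = (j : ℕ) := by
  simp only [prefixVec]
  rw [Finset.sum_boole, Fin.card_filter_val_lt, min_eq_right (by omega)]

theorem yExp_prefixVec_succ (j : Fin (n + 1)) (r : ℕ) (l : Fin n) :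
    yExp (prefixVec n j) r l.succ = r + if (l : ℕ) < j then 1 else 0 := by
  rw [yExp, Fin.cons_succ, prefixVec]
  split_ifs <;> omega

theorem vDeg_yExp (j : Fin (n + 1)) (r : ℕ) :
    vDeg (yExp (prefixVec n j) r) = (n + 1) * r + j := by
  rw [vDeg, Fin.sum_univ_succ]
  simp only [yExp_prefixVec_succ]
  rw [Finset.sum_add_distrib, Finset.sum_boole, Fin.card_filter_val_lt, min_eq_right (by omega),
    Finset.sum_const, Finset.card_univ, Fintype.card_fin, smul_eq_mul]
  change r + (n * r + (j : ℕ)) = _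
  ring

variable (n) in
/-- The element `γ^j x_1 ⋯ x_j` of `C`, which represents `e_j`. -/
def eLift (j : Fin (n + 1)) : TypeC π n := ⟨_, gamma_pow_single_mem π n j⟩

theorem coordC_smul_eLift (g : TypeO π n) (j : Fin (n + 1)) : coordC π (g • eLift π n j) =
    NullFun.extend (yExp (prefixVec n j)) (yExp_injective _) (coordO π n g) := by
  have hγ := π.gamma_ne_zero
  refine Subtype.ext (funext fun v => ?_)
  by_cases h : ∃ r, yExp (prefixVec n j) r = v
  · obtain ⟨r, rfl⟩ := h
    rw [NullFun.extend_apply]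
    refine Subtype.ext ?_
    rw [coordC_apply, xExp_yExp (by rw [mFun_prefixVec]; exact Nat.zero_le _)]
    change PowerSeries.coeff r (g.1 * (Pi.single (prefixVec n j)
      (PowerSeries.C (π.gamma ^ (j : ℕ))) : Laurent p n) (prefixVec n j)) * _ = normCoeff π n g.1 r
    rw [Pi.single_eq_same, PowerSeries.coeff_mul_C, normCoeff, sum_prefixVec, div_eq_mul_inv,
      mul_assoc]
    congr 1
    rw [neg_add, zpow_add₀ hγ, zpow_neg, zpow_neg, zpow_natCast, mul_left_comm,
      mul_inv_cancel₀ (pow_ne_zero _ hγ), mul_one]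
    norm_cast
  · rw [NullFun.extend_apply_of_not _ _ _ h]
    refine Subtype.ext ?_
    rw [coordC_apply, lCoeff]
    have hne : xExp v ≠ prefixVec n j := fun hv => h ⟨v 0, by rw [← hv, yExp_xExp]⟩
    change PowerSeries.coeff (v 0) (g.1 * (Pi.single (prefixVec n j)
      (PowerSeries.C (π.gamma ^ (j : ℕ))) : Laurent p n) (xExp v)) * _ = 0
    rw [Pi.single_eq_of_ne hne, mul_zero, map_zero, zero_mul]

/-- The indices of the summands of `⨁_l C ⊕ ⨁_j O e_j` with respect to monomials. -/
abbrev TopIdx (n : ℕ) : Type := (Fin n × (Fin (n + 1) → ℕ)) ⊕ (ℕ × Fin (n + 1))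

theorem inl_pair_injective (l : Fin n) : Function.Injective fun v : Fin (n + 1) → ℕ =>
    (Sum.inl (l, v) : TopIdx n) := fun v w h => by simpa using h

theorem inr_pair_injective (j : Fin (n + 1)) : Function.Injective fun r : ℕ =>
    (Sum.inr (r, j) : TopIdx n) := fun v w h => by simpa using h

variable (n) in
/-- The map `(z, h) ↦ ∑_l D_{t,l} z_l + ∑_j h_j e_j`. -/
def topMap : NullFun (p : π.integers) (TopIdx n) →ₗ[π.integers]
    NullFun (p : π.integers) (Fin (n + 1) → ℕ) :=
  ∑ l, diffY π l ∘ₗ NullFun.comap _ (inl_pair_injective l) +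
    ∑ j, NullFun.extend _ (yExp_injective (prefixVec n j)) ∘ₗ NullFun.comap _ (inr_pair_injective j)

theorem topMap_apply (x : NullFun (p : π.integers) (TopIdx n)) : topMap π n x =
    ∑ l, diffY π l (NullFun.comap _ (inl_pair_injective l) x) +
    ∑ j, NullFun.extend _ (yExp_injective (prefixVec n j))
      (NullFun.comap _ (inr_pair_injective j) x) := by
  rw [topMap, LinearMap.add_apply, LinearMap.sum_apply, LinearMap.sum_apply]
  rfl

theorem topMap_inl (l : Fin n) (w : Fin (n + 1) → ℕ) :
    topMap π n (unitFun _ (Sum.inl (l, w))) = diffY π l (unitFun _ w) := by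
  rw [topMap_apply, Finset.sum_eq_single l, Finset.sum_eq_zero, add_zero]
  · rw [NullFun.comap_unitFun (fun v : Fin (n + 1) → ℕ => (Sum.inl (l, v) : TopIdx n))]
  · intro j _
    rw [NullFun.comap_unitFun_of_not _ _ (by simp), map_zero]
  · intro l' _ hl'
    rw [NullFun.comap_unitFun_of_not _ _ (by simp [hl']), map_zero]
  · exact fun h => absurd (Finset.mem_univ l) h

theorem topMap_inr (r : ℕ) (j : Fin (n + 1)) :
    topMap π n (unitFun _ (Sum.inr (r, j))) = unitFun _ (yExp (prefixVec n j) r) := by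
  rw [topMap_apply, Finset.sum_eq_zero, Finset.sum_eq_single j, zero_add]
  · rw [NullFun.comap_unitFun (fun r : ℕ => (Sum.inr (r, j) : TopIdx n)), NullFun.extend_unitFun]
  · intro j' _ hj'
    rw [NullFun.comap_unitFun_of_not _ _ (by simp [hj']), map_zero]
  · exact fun h => absurd (Finset.mem_univ j) h
  · intro l _
    rw [NullFun.comap_unitFun_of_not _ _ (by simp), map_zero]

/-- The weight on `⨁_l C ⊕ ⨁_j O e_j` for which `topMap` is filtered. -/
def topWt : TopIdx n → ℕ := Sum.elim (fun y => vDeg y.2 + 1) (fun y => (n + 1) * y.1 + y.2)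

variable (n) in
/-- The condition that the component `z_l` involves none of the variables `y_i` with `i < l`. -/
def topSupp : Set (TopIdx n) :=
  {x | Sum.elim (fun y : Fin n × (Fin (n + 1) → ℕ) => y.2 ∈ lowFree n y.1) (fun _ => True) x}

/-- Modulo lower terms and the image, every monomial is a power of `y_0`. -/
theorem exists_topMap_sub_mem (v : Fin (n + 1) → ℕ) :
    ∃ y ∈ fil (p : π.integers) topWt (topSupp n) (vDeg v),
      topMap π n y - (unitFun _ v - unitFun _ (Pi.single 0 (vDeg v))) ∈
        filStrict (p : π.integers) vDeg Set.univ (vDeg v) := by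
  obtain ⟨s, hs⟩ : ∃ s, s + v 0 = vDeg v := ⟨vDeg v - v 0, Nat.sub_add_cancel
    (Finset.single_le_sum (fun _ _ => Nat.zero_le _) (Finset.mem_univ 0))⟩
  induction s generalizing v with
  | zero =>
    have hv : v = Pi.single 0 (vDeg v) := by
      have h1 : vDeg v = v 0 + ∑ l : Fin n, v l.succ := Fin.sum_univ_succ v
      have h2 : ∑ l : Fin n, v l.succ = 0 := by omega
      rw [Finset.sum_eq_zero_iff] at h2
      funext j
      refine Fin.cases ?_ (fun l => ?_) j
      · rw [Pi.single_eq_same]; omega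
      · rw [Pi.single_eq_of_ne (Fin.succ_ne_zero l), h2 l (Finset.mem_univ l)]
    refine ⟨0, zero_mem _, ?_⟩
    rw [← hv, sub_self, map_zero, sub_zero]
    exact zero_mem _
  | succ s ih =>
    have hne : {l : Fin n | v l.succ ≠ 0}.Nonempty := by
      by_contra hcon
      rw [Set.not_nonempty_iff_eq_empty, Set.eq_empty_iff_forall_notMem] at hcon
      have h1 : vDeg v = v 0 + ∑ l : Fin n, v l.succ := Fin.sum_univ_succ v
      rw [Finset.sum_eq_zero fun l _ => not_not.1 (hcon l)] at h1
      omega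
    -- `l` is the first variable that occurs, so that `D_{t,l}` may be applied to `y^v / y_l`
    obtain ⟨l, hl, hmin⟩ := WellFounded.has_min (wellFounded_lt (α := Fin n)) _ hne
    obtain ⟨w, rfl⟩ : ∃ w : Fin (n + 1) → ℕ, v = w + Pi.single l.succ 1 :=
      ⟨v - Pi.single l.succ 1, (sub_single_eq_iff (Nat.one_le_iff_ne_zero.2 hl)).1 rfl⟩
    have hw : w ∈ lowFree n l := fun i hi => by
      have := not_not.1 fun h => hmin i h hi
      rw [Pi.add_apply] at this
      omega
    have hdeg : ∀ j, vDeg (w + Pi.single j 1) = vDeg w + 1 := fun j => by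
      rw [vDeg_add, vDeg_single]
    obtain ⟨y, hy, hy'⟩ := ih (w + Pi.single 0 1) (by
      rw [hdeg] at hs ⊢
      rw [Pi.add_apply, Pi.single_eq_of_ne (Fin.succ_ne_zero l).symm] at hs
      rw [Pi.add_apply, Pi.single_eq_same]
      omega)
    rw [hdeg] at hy hy' ⊢
    refine ⟨unitFun _ (Sum.inl (l, w)) + y, add_mem (unitFun_mem_fil
      (show Sum.inl (l, w) ∈ topSupp n from hw) le_rfl) hy, ?_⟩
    have h1 := add_mem (diffY_unitFun_sub_mem π l w (P := Set.univ) (fun _ => Set.mem_univ _)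
      fun _ => Set.mem_univ _) hy'
    rw [map_add, topMap_inl]
    convert h1 using 1
    abel

theorem exists_topMap_sub_unitFun_mem (v : Fin (n + 1) → ℕ) :
    ∃ y ∈ fil (p : π.integers) topWt (topSupp n) (vDeg v), topMap π n y - unitFun _ v ∈
      filStrict (p : π.integers) vDeg Set.univ (vDeg v) := by
  set r := vDeg v / (n + 1)
  set j : Fin (n + 1) := ⟨vDeg v % (n + 1), Nat.mod_lt _ (Nat.succ_pos n)⟩ with hj
  have hdeg : vDeg (yExp (prefixVec n j) r) = vDeg v := by
    rw [vDeg_yExp]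
    exact Nat.div_add_mod _ _
  obtain ⟨y, hy, hy'⟩ := exists_topMap_sub_mem π v
  obtain ⟨z, hz, hz'⟩ := exists_topMap_sub_mem π (yExp (prefixVec n j) r)
  rw [hdeg] at hz hz'
  refine ⟨y - z + unitFun _ (Sum.inr (r, j)), add_mem (sub_mem hy hz) (unitFun_mem_fil
    (show Sum.inr (r, j) ∈ topSupp n from trivial) ?_), ?_⟩
  · rw [← hdeg, vDeg_yExp]; rfl
  · rw [map_add, map_sub, topMap_inr]
    convert sub_mem hy' hz' using 1
    abel

theorem topMap_inl_apply_mem (l : Fin n) {v w : Fin (n + 1) → ℕ} (h : vDeg v = vDeg w + 1) :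
    (topMap π n (unitFun _ (Sum.inl (l, w)))).1 v -
      ((unitFun (p : π.integers) (w + Pi.single l.succ 1)).1 v -
        (unitFun (p : π.integers) (w + Pi.single 0 1)).1 v) ∈
          IsLocalRing.maximalIdeal π.integers := by
  rw [topMap_inl]
  exact Ideal.mem_of_dvd _ ((diffY_unitFun_sub_mem π l w (P := Set.univ) (fun _ => Set.mem_univ _)
      fun _ => Set.mem_univ _).2 v h) π.natCast_mem_maximalIdeal

theorem sum_unitFun_apply {A J : Type*} [CommRing A] {ϖ : A} {s : Finset J} {j : J} (h : j ∈ s) :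
    ∑ i ∈ s, (unitFun ϖ j).1 i = 1 := by
  rw [Finset.sum_eq_single_of_mem j h fun i _ hi => unitFun_of_ne hi, unitFun_self]

/-- In each weight, the leading part of `topMap` is injective modulo the maximal ideal. The sum of
all coefficients detects the coefficient of `t^r e_j`, as it kills the differences
`y_l y^w - y_0 y^w`; the coefficients of the latter vanish by induction on the exponent of `y_0`. -/
theorem mem_maximalIdeal_of_topMap (N : ℕ) (s : Finset (TopIdx n)) (c : TopIdx n → π.integers)
    (hs : ∀ x ∈ s, x ∈ topSupp n ∧ topWt x = N)
    (hc : ∀ v, vDeg v = N → ∑ x ∈ s, c x * (topMap π n (unitFun _ x)).1 v ∈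
      IsLocalRing.maximalIdeal π.integers) :
    ∀ x ∈ s, c x ∈ IsLocalRing.maximalIdeal π.integers := by
  classical
  set m := IsLocalRing.maximalIdeal π.integers with hm
  set F := ((finite_vDeg_le (n := n) N).subset (t := {v | vDeg v = N}) fun _ hv =>
    le_of_eq hv).toFinset with hF
  have hmemF : ∀ v, v ∈ F ↔ vDeg v = N := fun v => by rw [hF, Set.Finite.mem_toFinset]; rfl
  have hr : ∀ r j, Sum.inr (r, j) ∈ s → c (Sum.inr (r, j)) ∈ m := by
    intro r j hrj
    have h1 : ∑ x ∈ s, c x * ∑ v ∈ F, (topMap π n (unitFun _ x)).1 v ∈ m := by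
      simp only [Finset.mul_sum]
      rw [Finset.sum_comm]
      exact sum_mem fun v hv => hc v ((hmemF v).1 hv)
    rw [← Finset.add_sum_erase s _ hrj, topMap_inr, sum_unitFun_apply ((hmemF _).2
      ((vDeg_yExp j r).trans (hs _ hrj).2)), mul_one] at h1
    refine (Submodule.add_mem_iff_left _ (sum_mem fun x hx => ?_)).1 h1
    rw [Finset.mem_erase] at hx
    obtain ⟨hne, hx⟩ := hx
    rcases x with ⟨l, w⟩ | ⟨r', j'⟩
    · have hw : vDeg w + 1 = N := (hs _ hx).2
      have hdeg : ∀ j, vDeg (w + Pi.single j 1) = N := fun j => by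
        rw [vDeg_add, vDeg_single, hw]
      refine Ideal.mul_mem_left _ _ ?_
      have h2 := sum_mem (S := m) (t := F) fun v hv =>
        topMap_inl_apply_mem π l (((hmemF v).1 hv).trans hw.symm)
      rw [Finset.sum_sub_distrib, Finset.sum_sub_distrib, sum_unitFun_apply ((hmemF _).2 (hdeg _)),
        sum_unitFun_apply ((hmemF _).2 (hdeg _)), sub_self, sub_zero] at h2
      exact h2
    · exfalso
      have e1 : (n + 1) * r + j = N := (hs _ hrj).2
      have e2 : (n + 1) * r' + j' = N := (hs _ hx).2
      have e3 : r' = r := by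
        have e4 := congrArg (· / (n + 1)) (e2.trans e1.symm)
        simpa only [Nat.mul_add_div (Nat.succ_pos n), Nat.div_eq_of_lt j.2, Nat.div_eq_of_lt j'.2,
          add_zero] using e4
      subst e3
      exact hne (by rw [Fin.ext (by omega : (j' : ℕ) = j)])
  have hl : ∀ d l z, Sum.inl (l, z) ∈ s → z 0 = d → c (Sum.inl (l, z)) ∈ m := by
    intro d
    induction d using Nat.strong_induction_on with
    | _ d ih =>
      intro l z hlz hzd
      have hzN : vDeg z + 1 = N := (hs _ hlz).2
      have hz : z ∈ lowFree n l := (hs _ hlz).1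
      have hvN : vDeg (z + Pi.single l.succ 1) = N := by rw [vDeg_add, vDeg_single, hzN]
      have h1 := hc _ hvN
      rw [← Finset.add_sum_erase s _ hlz, Submodule.add_mem_iff_left _ (sum_mem fun x hx => ?_)]
        at h1
      · have h2 := Ideal.mul_mem_left m (c (Sum.inl (l, z)))
          (topMap_inl_apply_mem π l (hvN.trans hzN.symm))
        rw [unitFun_self, unitFun_of_ne, sub_zero, mul_sub, mul_one] at h2
        · have := sub_mem h1 h2
          rwa [sub_sub_cancel] at this
        · intro h
          have := congrFun h 0
          simp at this
      · rw [Finset.mem_erase] at hx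
        obtain ⟨hne, hx⟩ := hx
        rcases x with ⟨l', w⟩ | ⟨r', j'⟩
        · by_cases h0 : z + Pi.single l.succ 1 = w + Pi.single 0 1
          · refine Ideal.mul_mem_right _ _ (ih (w 0) ?_ l' w hx rfl)
            have := congrFun h0 0
            rw [Pi.add_apply, Pi.add_apply, Pi.single_eq_same,
              Pi.single_eq_of_ne (Fin.succ_ne_zero l).symm] at this
            omega
          · have hwN : vDeg w + 1 = N := (hs _ hx).2
            have hw : w ∈ lowFree n l' := (hs _ hx).1
            refine Ideal.mul_mem_left _ _ ?_
            have h2 := topMap_inl_apply_mem π l' (hvN.trans hwN.symm)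
            rw [unitFun_of_ne h0, unitFun_of_ne, sub_zero, sub_zero] at h2
            · exact h2
            · intro h
              rcases lt_trichotomy l' l with hlt | heq | hlt
              · have := congrFun h l'.succ
                rw [Pi.add_apply, Pi.add_apply, Pi.single_eq_same, hz l' hlt,
                  Pi.single_eq_of_ne ((Fin.succ_injective n).ne hlt.ne)] at this
                omega
              · subst heq
                exact hne (by rw [add_right_cancel h])
              · have := congrFun h l.succ
                rw [Pi.add_apply, Pi.add_apply, Pi.single_eq_same, hw l hlt,
                  Pi.single_eq_of_ne ((Fin.succ_injective n).ne hlt.ne)] at this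
                omega
        · exact Ideal.mul_mem_right _ _ (hr r' j' hx)
  rintro (⟨l, z⟩ | ⟨r, j⟩) hx
  · exact hl _ l z hx rfl
  · exact hr r j hx

variable (ha : 1 ≤ a)
include ha

theorem eq_zero_of_topMap_eq_zero {x : NullFun (p : π.integers) (TopIdx n)}
    (hx : ∀ j, j ∉ topSupp n → x.1 j = 0) (h : topMap π n x = 0) : x = 0 := by
  refine eq_zero_of_map_eq_zero (π.isCoeffRing ha) (wt₁ := topWt) (wt₂ := vDeg) _ (topSupp n) ?_
    (mem_maximalIdeal_of_topMap π) hx h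
  rintro (⟨l, w⟩ | ⟨r, j⟩) _
  · have h1 := diffY_unitFun_sub_mem π l w (P := Set.univ) (fun _ => Set.mem_univ _)
      fun _ => Set.mem_univ _
    have hdeg : ∀ j, vDeg (w + Pi.single j 1) = vDeg w + 1 := fun j => by
      rw [vDeg_add, vDeg_single]
    have h2 := add_mem h1.1 (sub_mem (unitFun_mem_fil (Set.mem_univ _) (hdeg l.succ).le)
      (unitFun_mem_fil (Set.mem_univ _) (hdeg 0).le))
    rw [sub_add_cancel] at h2
    rw [topMap_inl]
    exact h2
  · rw [topMap_inr]
    exact unitFun_mem_fil (Set.mem_univ _) (vDeg_yExp j r).le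

theorem exists_topMap_eq {N : ℕ} {x : NullFun (p : π.integers) (Fin (n + 1) → ℕ)}
    (hx : x ∈ fil (p : π.integers) vDeg Set.univ N) :
    ∃ y ∈ fil (p : π.integers) topWt (topSupp n) N, topMap π n y = x :=
  exists_preimage_fil (π.isCoeffRing ha) (finite_vDeg_le (n := n)) _ _ _
    (fun v _ => exists_topMap_sub_unitFun_mem π v) hx

theorem topMap_surjective : Function.Surjective (topMap π n) := fun x => by
  obtain ⟨y, -, hy⟩ := exists_preimage (π.isCoeffRing ha) (finite_vDeg_le (n := n)) (topMap π n)
    (topSupp n) Set.univ (fun v _ => exists_topMap_sub_unitFun_mem π v) (x := x)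
    (fun j hj => absurd (Set.mem_univ j) hj)
  exact ⟨y, hy⟩

end Basis

/-! ### The connection on the top cohomology -/

section Connection

variable {p a : ℕ} [Fact p.Prime] (π : DworkPi p a) {n : ℕ}

/-- The element `(z, h)` of `⨁_l C ⊕ ⨁_j O e_j`. -/
def topPair (z : Fin n → NullFun (p : π.integers) (Fin (n + 1) → ℕ))
    (h : Fin (n + 1) → NullFun (p : π.integers) ℕ) : NullFun (p : π.integers) (TopIdx n) :=
  ⟨Sum.elim (fun y => (z y.1).1 y.2) (fun y => (h y.2).1 y.1), fun m => by
    refine ((Set.finite_iUnion fun l => ((z l).2 m).image fun v => (Sum.inl (l, v) : TopIdx n)).union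
      (Set.finite_iUnion fun j => ((h j).2 m).image fun r => (Sum.inr (r, j) : TopIdx n))).subset ?_
    rintro (⟨l, v⟩ | ⟨r, j⟩) hx
    · exact Or.inl (Set.mem_iUnion.2 ⟨l, v, hx, rfl⟩)
    · exact Or.inr (Set.mem_iUnion.2 ⟨j, r, hx, rfl⟩)⟩

theorem topMap_topPair (z : Fin n → NullFun (p : π.integers) (Fin (n + 1) → ℕ))
    (h : Fin (n + 1) → NullFun (p : π.integers) ℕ) : topMap π n (topPair π z h) =
      ∑ l, diffY π l (z l) + ∑ j, NullFun.extend _ (yExp_injective (prefixVec n j)) (h j) :=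
  topMap_apply π _

theorem coordC_symm_extend (g : NullFun (p : π.integers) ℕ) (j : Fin (n + 1)) :
    (coordC π).symm (NullFun.extend _ (yExp_injective (prefixVec n j)) g) =
      (coordO π n).symm g • eLift π n j := by
  rw [LinearEquiv.symm_apply_eq, coordC_smul_eLift, LinearEquiv.apply_symm_apply]

theorem mk_coordC_symm_diffY (l : Fin n) (x : NullFun (p : π.integers) (Fin (n + 1) → ℕ)) :
    RelH.mk π n ((coordC π).symm (diffY π l x)) = 0 := by
  change RelH.mk π n ((coordC π).symm (coordC π (relDiff π n l ((coordC π).symm x)))) = 0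
  rw [LinearEquiv.symm_apply_apply]
  exact (Submodule.Quotient.mk_eq_zero _).2 (Submodule.mem_iSup_of_mem l ⟨_, rfl⟩)

theorem mk_coordC_symm_topMap (y : NullFun (p : π.integers) (TopIdx n)) :
    RelH.mk π n ((coordC π).symm (topMap π n y)) = ∑ j,
      (coordO π n).symm (NullFun.comap _ (inr_pair_injective j) y) • eVec π n j := by
  rw [topMap_apply, map_add, map_add, map_sum, map_sum, Finset.sum_eq_zero fun l _ =>
    mk_coordC_symm_diffY π l _, zero_add, map_sum, map_sum]
  refine Finset.sum_congr rfl fun j _ => ?_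
  rw [coordC_symm_extend, map_smul]
  rfl

theorem tMonomial_zero : tMonomial π n 0 = 1 :=
  Subtype.ext (by
    change PowerSeries.monomial 0 (π.gamma ^ ((n + 1) * 0)) = 1
    rw [mul_zero, pow_zero, PowerSeries.monomial_zero_eq_C_apply, map_one])

theorem coordC_eLift (j : Fin (n + 1)) :
    coordC π (eLift π n j) = unitFun _ (yExp (prefixVec n j) 0) := by
  have h := coordC_smul_eLift π (tMonomial π n 0) j
  rwa [tMonomial_zero, one_smul, ← tMonomial_zero π, coordO_tMonomial,
    NullFun.extend_unitFun] at h

theorem mk_coordC_symm_unitFun (j : Fin (n + 1)) (r : ℕ) :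
    RelH.mk π n ((coordC π).symm (unitFun _ (yExp (prefixVec n j) r))) =
      tMonomial π n r • eVec π n j := by
  rw [← NullFun.extend_unitFun _ (yExp_injective _), coordC_symm_extend, coordO_symm_unitFun,
    map_smul]
  rfl

variable (ha : 1 ≤ a)
include ha

theorem linearIndependent_eVec : LinearIndependent (TypeO π n) (eVec π n) := by
  rw [Fintype.linearIndependent_iff]
  intro g hg
  have h1 : RelH.mk π n (∑ j, g j • eLift π n j) = 0 := by
    rw [map_sum, ← hg]
    exact Finset.sum_congr rfl fun j _ => map_smul _ _ _
  have h2 : ∑ j, g j • eLift π n j ∈ relBoundary π n := (Submodule.Quotient.mk_eq_zero _).1 h1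
  obtain ⟨f, hf, hfx⟩ := (Submodule.mem_iSup_iff_exists_finsupp _ _).1 h2
  choose ζ hζ using hf
  rw [Finsupp.sum_fintype _ _ fun _ => rfl] at hfx
  obtain ⟨z, hz, hzx⟩ := exists_sum_diffY_eq π ha fun l => coordC π (ζ l)
  have h3 : topMap π n (topPair π z fun j => -coordO π n (g j)) = 0 := by
    rw [topMap_topPair, hzx]
    have h4 := congrArg (coordC π) hfx
    rw [map_sum, map_sum] at h4
    have h5 : ∑ l, diffY π l (coordC π (ζ l)) = ∑ l, coordC π (f l) :=
      Finset.sum_congr rfl fun l _ => by rw [diffY_coordC, hζ]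
    rw [h5, h4, ← Finset.sum_add_distrib]
    refine Finset.sum_eq_zero fun j _ => ?_
    rw [coordC_smul_eLift, map_neg, add_neg_cancel]
  have h6 := eq_zero_of_topMap_eq_zero π ha (fun x hx => by
    rcases x with ⟨l, w⟩ | ⟨r, j⟩
    · exact hz l w hx
    · exact absurd trivial hx) h3
  intro j
  refine (coordO π n).map_eq_zero_iff.1 (neg_eq_zero.1 (Subtype.ext (funext fun r => ?_)))
  exact congrFun (congrArg Subtype.val h6) (Sum.inr (r, j))

theorem span_eVec : ⊤ ≤ Submodule.span (TypeO π n) (Set.range (eVec π n)) := by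
  rintro x -
  obtain ⟨ζ, rfl⟩ := Submodule.mkQ_surjective (relBoundary π n) x
  obtain ⟨y, hy⟩ := topMap_surjective π ha (coordC π ζ)
  have h := mk_coordC_symm_topMap π y
  rw [hy, LinearEquiv.symm_apply_apply] at h
  change RelH.mk π n ζ ∈ _
  rw [h]
  exact sum_mem fun j _ => Submodule.smul_mem _ _ (Submodule.subset_span ⟨j, rfl⟩)

/-- The basis `e_0, …, e_n` of `H^n` over `O`. -/
def eBasis : Module.Basis (Fin (n + 1)) (TypeO π n) (RelH π n) :=
  Module.Basis.mk (linearIndependent_eVec π ha) (span_eVec π ha)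

theorem coe_eBasis : ⇑(eBasis π (n := n) ha) = eVec π n := Module.Basis.coe_mk _ _

omit ha in
/-- Up to an exact term, `∂` maps the representative of `e_j` to that of `e_{j+1}`, or of `t e_0`
if `j = n`, with a remainder that is divisible by `p` and of filtration `j + 2`. -/
theorem exists_connY_eLift (j : Fin (n + 1)) :
    ∃ y ∈ fil (p : π.integers) vDeg Set.univ (j + 2), ∃ b,
      RelH.mk π n ((coordC π).symm b) = 0 ∧ connY π (unitFun _ (yExp (prefixVec n j) 0)) + b =
        unitFun _ (yExp (prefixVec n (j + 1)) (if j = Fin.last n then 1 else 0)) +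
          (p : π.integers) • y := by
  set w := yExp (prefixVec n j) 0 with hw
  have hdeg : vDeg w = j := by rw [hw, vDeg_yExp, mul_zero, zero_add]
  have hw0 : w 0 = 0 := rfl
  have hws : ∀ l : Fin n, w l.succ = if (l : ℕ) < j then 1 else 0 := fun l => by
    rw [hw, yExp_prefixVec_succ, zero_add]
  obtain ⟨y, hy, hyc⟩ := exists_connY_unitFun π w
  rw [hw0, Nat.cast_zero, zero_smul, zero_add] at hyc
  rw [hdeg] at hy
  by_cases hj : j = Fin.last n
  · refine ⟨y, hy, 0, by rw [map_zero, map_zero], ?_⟩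
    rw [add_zero, hyc, if_pos hj]
    congr 2
    funext i
    refine Fin.cases ?_ (fun l => ?_) i
    · rw [Pi.add_apply, hw0, Pi.single_eq_same]; rfl
    · have h1 : ((j + 1 : Fin (n + 1)) : ℕ) = 0 := by rw [hj, Fin.last_add_one]; rfl
      have h2 : (j : ℕ) = n := by rw [hj]; rfl
      rw [Pi.add_apply, hws, yExp_prefixVec_succ, Pi.single_eq_of_ne (Fin.succ_ne_zero l), h1, h2,
        if_pos l.2]
      rfl
  · have hjn : (j : ℕ) < n := Fin.val_lt_last hj
    obtain ⟨z, hz, hzd⟩ := exists_diffY_unitFun π ⟨j, hjn⟩ w (P := Set.univ)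
      (fun _ => Set.mem_univ _) fun _ => Set.mem_univ _
    rw [hws, hw0, if_neg (lt_irrefl _), Nat.cast_zero, sub_zero, zero_smul, zero_add] at hzd
    rw [hdeg] at hz
    refine ⟨y + z, add_mem hy hz, _, mk_coordC_symm_diffY π ⟨j, hjn⟩ (unitFun _ w), ?_⟩
    have hexp : w + Pi.single (Fin.succ ⟨j, hjn⟩) 1 =
        yExp (prefixVec n (j + 1)) (if j = Fin.last n then 1 else 0) := by
      rw [if_neg hj]
      funext i
      refine Fin.cases ?_ (fun l => ?_) i
      · rw [Pi.add_apply, hw0, Pi.single_eq_of_ne (Fin.succ_ne_zero _).symm]; rfl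
      · have h1 : ((j + 1 : Fin (n + 1)) : ℕ) = j + 1 := by
          rw [Fin.val_add_one, if_neg hj]
        rw [Pi.add_apply, hws, yExp_prefixVec_succ, h1, zero_add]
        by_cases hl : l = ⟨j, hjn⟩
        · subst hl
          rw [Pi.single_eq_same, if_neg (lt_irrefl _), if_pos (Nat.lt_succ_self _)]
        · have : (l : ℕ) ≠ j := fun h => hl (Fin.ext h)
          rw [Pi.single_eq_of_ne ((Fin.succ_injective n).ne hl), add_zero]
          split_ifs <;> omega
    rw [hyc, hzd, hexp, smul_add]
    abel

/-- The connection matrix of `∂` on `H^n` in the basis `e_0, …, e_n`: it is the matrix of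
`e_j ↦ e_{j+1}`, `e_n ↦ γ^{n+1} t e_0` up to `p` times terms of controlled filtration. -/
theorem exists_relHConn_eVec : ∃ h : Fin (n + 1) → Fin (n + 1) → TypeO π n,
    (∀ l j : Fin (n + 1), coordO π n (h l j) ∈
      fil (p : π.integers) (fun r => (n + 1) * r + l) Set.univ (j + 2)) ∧
    ∀ j, relHConn π n (eVec π n j) = ∑ l, ((if l = j + 1 then
      tMonomial π n (if j = Fin.last n then 1 else 0) else 0) + (p : π.integers) • h l j) •
        eVec π n l := by
  have key : ∀ j : Fin (n + 1), ∃ y ∈ fil (p : π.integers) topWt (topSupp n) (j + 2),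
      relHConn π n (eVec π n j) = tMonomial π n (if j = Fin.last n then 1 else 0) •
        eVec π n (j + 1) + ∑ l, ((p : π.integers) • (coordO π n).symm
          (NullFun.comap _ (inr_pair_injective l) y)) • eVec π n l := fun j => by
    obtain ⟨x, hx, b, hb, hxb⟩ := exists_connY_eLift π j
    obtain ⟨y, hy, rfl⟩ := exists_topMap_eq π ha hx
    refine ⟨y, hy, ?_⟩
    have h1 : relHConn π n (eVec π n j) = RelH.mk π n (relConn π n (eLift π n j)) := rfl
    have h2 := congrArg (fun x => RelH.mk π n ((coordC π).symm x)) hxb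
    simp only [map_add] at h2
    rw [hb, add_zero, mk_coordC_symm_unitFun, ← coordC_eLift, connY_coordC,
      LinearEquiv.symm_apply_apply] at h2
    rw [h1, h2]
    congr 1
    rw [map_smul, (RelH.mk π n).map_smul_of_tower, mk_coordC_symm_topMap, Finset.smul_sum]
    exact Finset.sum_congr rfl fun l _ => (smul_assoc _ _ _).symm
  choose y hy h using key
  refine ⟨fun l j => (coordO π n).symm (NullFun.comap _ (inr_pair_injective l) (y j)),
    fun l j => ?_, fun j => ?_⟩
  · rw [LinearEquiv.apply_symm_apply]
    exact ⟨fun r => (hy j).1 (Sum.inr (r, l)), fun r hr => absurd (Set.mem_univ r) hr⟩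
  · rw [h]
    simp only [add_smul, Finset.sum_add_distrib, ite_smul, zero_smul, Finset.sum_ite_eq',
      Finset.mem_univ, if_true]

end Connection

/-! ### Perturbations of the graded connection -/

section Perturbation

variable {A : Type*} [CommRing A] (ϖ : A) {n k : ℕ}

/-- A finitely supported family as a null family. -/
def finsuppToNull (J : Type*) : (J →₀ A) →ₗ[A] NullFun ϖ J where
  toFun y := ⟨y, nullFun_of_finite y.hasFiniteSupport⟩
  map_add' _ _ := rfl
  map_smul' _ _ := rfl

variable {ϖ}

theorem finsuppToNull_single {J : Type*} (j : J) :
    finsuppToNull ϖ J (Finsupp.single j 1) = unitFun ϖ j := by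
  classical
  refine Subtype.ext (funext fun i => ?_)
  rw [unitFun_apply]
  change Finsupp.single j 1 i = _
  rw [Finsupp.single_apply]
  simp only [eq_comm]

theorem tWeight_zero_left (i : SymIdx n k) : tWeight (0, i) = i.weight := by
  rw [tWeight, mul_zero, zero_add]

theorem constIdx_injective : Function.Injective fun i : SymIdx n k => ((0, i) : ℕ × SymIdx n k) :=
  Prod.mk_right_injective 0

/-- The map `(u, c) ↦ D u + ∑_i c_i e^i`. -/
def cohMap (D : NullFun ϖ (ℕ × SymIdx n k) →ₗ[A] NullFun ϖ (ℕ × SymIdx n k)) :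
    NullFun ϖ ((ℕ × SymIdx n k) ⊕ SymIdx n k) →ₗ[A] NullFun ϖ (ℕ × SymIdx n k) :=
  D ∘ₗ NullFun.comap Sum.inl Sum.inl_injective +
    NullFun.extend _ constIdx_injective ∘ₗ NullFun.comap Sum.inr Sum.inr_injective

/-- The element `(u, c)` of the source of `cohMap`. -/
def cohPair (u : NullFun ϖ (ℕ × SymIdx n k)) (c : NullFun ϖ (SymIdx n k)) :
    NullFun ϖ ((ℕ × SymIdx n k) ⊕ SymIdx n k) :=
  ⟨Sum.elim u.1 c.1, fun m => by
    refine (((u.2 m).image Sum.inl).union ((c.2 m).image Sum.inr)).subset ?_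
    rintro (x | i) hx
    · exact Or.inl ⟨x, hx, rfl⟩
    · exact Or.inr ⟨i, hx, rfl⟩⟩

variable (n k) in
/-- The weight on the source of `cohMap` for which `cohMap` is filtered. -/
def cohWt : (ℕ × SymIdx n k) ⊕ SymIdx n k → ℕ :=
  Sum.elim (fun x => tWeight x + 1) SymIdx.weight

/-- The condition that only the constants `e^i` with `i ∈ B` occur. -/
def cohSupp (B : Finset (SymIdx n k)) : Set ((ℕ × SymIdx n k) ⊕ SymIdx n k) :=
  {x | Sum.elim (fun _ => True) (· ∈ B) x}

variable (D : NullFun ϖ (ℕ × SymIdx n k) →ₗ[A] NullFun ϖ (ℕ × SymIdx n k))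

theorem cohMap_cohPair (u : NullFun ϖ (ℕ × SymIdx n k)) (c : NullFun ϖ (SymIdx n k)) :
    cohMap D (cohPair u c) = D u + NullFun.extend _ constIdx_injective c := rfl

theorem cohMap_inl (x : ℕ × SymIdx n k) :
    cohMap D (unitFun _ (Sum.inl x)) = D (unitFun _ x) := by
  change D (NullFun.comap Sum.inl Sum.inl_injective _) +
    NullFun.extend _ constIdx_injective (NullFun.comap Sum.inr Sum.inr_injective _) = _
  rw [NullFun.comap_unitFun, NullFun.comap_unitFun_of_not _ _ (by simp), map_zero, add_zero]

theorem cohMap_inr (i : SymIdx n k) :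
    cohMap D (unitFun _ (Sum.inr i)) = unitFun ϖ (0, i) := by
  change D (NullFun.comap Sum.inl Sum.inl_injective _) +
    NullFun.extend _ constIdx_injective (NullFun.comap Sum.inr Sum.inr_injective _) = _
  rw [NullFun.comap_unitFun, NullFun.comap_unitFun_of_not _ _ (by simp), map_zero, zero_add,
    NullFun.extend_unitFun]

theorem finsuppToNull_constVec (B : Finset (SymIdx n k)) {c : SymIdx n k → A}
    (hc : ∀ i, i ∉ B → c i = 0) (c' : NullFun ϖ (SymIdx n k)) (hcc' : c'.1 = c) :
    finsuppToNull ϖ _ (constVec n k B c) = NullFun.extend _ constIdx_injective c' := by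
  refine Subtype.ext (funext fun x => ?_)
  change constVec n k B c x = _
  obtain ⟨r, i⟩ := x
  rw [constVec_apply]
  by_cases hr : r = 0
  · subst hr
    rw [NullFun.extend_apply (fun i : SymIdx n k => ((0, i) : ℕ × SymIdx n k)), hcc']
    split_ifs with h
    · rfl
    · exact (hc i fun hi => h ⟨rfl, hi⟩).symm
  · rw [if_neg fun h => hr h.1, NullFun.extend_apply_of_not]
    rintro ⟨i', h⟩
    exact hr (congrArg Prod.fst h).symm

variable (hD : ∀ x, D (unitFun ϖ x) - finsuppToNull ϖ _ (gradedConn n k A (Finsupp.single x 1)) ∈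
  filStrict ϖ tWeight Set.univ (tWeight x + 1))
include hD

theorem sub_gradedConn_mem {N : ℕ} {y : ℕ × SymIdx n k →₀ A}
    (hy : ∀ x, y x ≠ 0 → tWeight x + 1 = N) :
    D (finsuppToNull ϖ _ y) - finsuppToNull ϖ _ (gradedConn n k A y) ∈
      filStrict ϖ tWeight Set.univ N := by
  have h : y = ∑ x ∈ y.support, y x • Finsupp.single x (1 : A) := by
    conv_lhs => rw [← Finsupp.sum_single y]
    exact Finset.sum_congr rfl fun x _ => by rw [Finsupp.smul_single, smul_eq_mul, mul_one]
  rw [h]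
  simp only [map_sum, map_smul, finsuppToNull_single]
  rw [← Finset.sum_sub_distrib]
  refine sum_mem fun x hx => ?_
  have h1 := Submodule.smul_mem _ (y x) (hD x)
  rw [hy x (Finsupp.mem_support_iff.1 hx)] at h1
  convert h1 using 1
  exact (smul_sub _ _ _).symm

theorem map_unitFun_mem_fil (x : ℕ × SymIdx n k) :
    D (unitFun ϖ x) ∈ fil ϖ tWeight Set.univ (tWeight x + 1) := by
  have h : finsuppToNull ϖ _ (gradedConn n k A (Finsupp.single x 1)) ∈
      fil ϖ tWeight Set.univ (tWeight x + 1) := by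
    rw [gradedConn_single, map_sum]
    refine sum_mem fun j _ => ?_
    have h1 : (Finsupp.single (nextIdx x j) (1 * (x.2.1 j : A))) =
        (x.2.1 j : A) • Finsupp.single (nextIdx x j) (1 : A) := by
      rw [Finsupp.smul_single, smul_eq_mul, mul_one, one_mul]
    rw [h1, map_smul, finsuppToNull_single]
    by_cases hj : x.2.1 j = 0
    · rw [hj, Nat.cast_zero, zero_smul]; exact zero_mem _
    · exact Submodule.smul_mem _ _ (unitFun_mem_fil (Set.mem_univ _) (tWeight_nextIdx hj).le)
  have h2 := add_mem (hD x).1 h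
  rwa [sub_add_cancel] at h2

variable [IsLocalRing A] {B : Finset (SymIdx n k)}
  (hB : IsComplement (IsLocalRing.ResidueField A) B)
include hB

theorem exists_cohMap_sub_unitFun_mem (x : ℕ × SymIdx n k) :
    ∃ y ∈ fil ϖ (cohWt n k) (cohSupp B) (tWeight x), cohMap D y - unitFun ϖ x ∈
      filStrict ϖ tWeight Set.univ (tWeight x) := by
  obtain ⟨y, c, hy, hc, h⟩ := hB.exists_lift x
  set c' : NullFun ϖ (SymIdx n k) := ⟨c, nullFun_of_finite (Set.toFinite _)⟩ with hc'
  refine ⟨cohPair (finsuppToNull ϖ _ y) c', ⟨?_, ?_⟩, ?_⟩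
  · rintro (x' | i)
    · by_cases h0 : y x' = 0
      · exact (show (cohPair (finsuppToNull ϖ _ y) c').1 (Sum.inl x') = 0 from h0) ▸ dvd_zero _
      · have h1 : cohWt n k (Sum.inl x') = tWeight x := hy x' h0
        rw [h1, Nat.sub_self, pow_zero]
        exact one_dvd _
    · by_cases h0 : c i = 0
      · exact (show (cohPair (finsuppToNull ϖ _ y) c').1 (Sum.inr i) = 0 from h0) ▸ dvd_zero _
      · have h1 : cohWt n k (Sum.inr i) = tWeight x := (hc i h0).2
        rw [h1, Nat.sub_self, pow_zero]
        exact one_dvd _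
  · rintro (x' | i) hx'
    · exact absurd trivial hx'
    · by_contra h0
      exact hx' (hc i h0).1
  · rw [cohMap_cohPair, ← finsuppToNull_single, h, map_add, finsuppToNull_constVec B
      (fun i hi => by_contra fun h0 => hi (hc i h0).1) c' rfl, add_sub_add_right_eq_sub]
    exact sub_gradedConn_mem D hD hy

theorem mem_maximalIdeal_of_cohMap (hϖ : ϖ ∈ IsLocalRing.maximalIdeal A) (N : ℕ)
    (s : Finset ((ℕ × SymIdx n k) ⊕ SymIdx n k)) (c : (ℕ × SymIdx n k) ⊕ SymIdx n k → A)
    (hs : ∀ j ∈ s, j ∈ cohSupp B ∧ cohWt n k j = N)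
    (hc : ∀ x, tWeight x = N → ∑ j ∈ s, c j * (cohMap D (unitFun ϖ j)).1 x ∈
      IsLocalRing.maximalIdeal A) :
    ∀ j ∈ s, c j ∈ IsLocalRing.maximalIdeal A := by
  classical
  set y : ℕ × SymIdx n k →₀ A := ∑ x ∈ s.toLeft, Finsupp.single x (c (Sum.inl x)) with hy
  set d : SymIdx n k → A := fun i => if i ∈ s.toRight then c (Sum.inr i) else 0 with hd
  -- the leading parts of the images of the unit families
  set G : (ℕ × SymIdx n k) ⊕ SymIdx n k → (ℕ × SymIdx n k →₀ A) := Sum.elim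
    (fun x => gradedConn n k A (Finsupp.single x 1)) (fun i => Finsupp.single (0, i) 1) with hG
  have hyd : gradedConn n k A y + constVec n k B d = ∑ j ∈ s, c j • G j := by
    rw [← Finset.toLeft_disjSum_toRight (u := s), Finset.sum_disjSum, hy, map_sum]
    congr 1
    · refine Finset.sum_congr rfl fun x _ => ?_
      rw [hG, Sum.elim_inl, ← map_smul, Finsupp.smul_single, smul_eq_mul, mul_one]
    · rw [constVec, hd]
      simp only [apply_ite (Finsupp.single _), Finsupp.single_zero]
      rw [Finset.sum_ite_mem, Finset.inter_eq_right.2 fun i hi =>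
        (hs _ (Finset.mem_toRight.1 hi)).1]
      refine Finset.sum_congr rfl fun i _ => ?_
      rw [hG, Sum.elim_inr, Finsupp.smul_single, smul_eq_mul, mul_one]
  have hGmem : ∀ j ∈ s, ∀ x, tWeight x = N →
      (cohMap D (unitFun ϖ j)).1 x - G j x ∈ IsLocalRing.maximalIdeal A := by
    rintro (x' | i) hj x hx
    · rw [cohMap_inl]
      exact Ideal.mem_of_dvd _ ((hD x').2 x (hx.trans (hs _ hj).2.symm)) hϖ
    · rw [cohMap_inr, ← finsuppToNull_single]
      change Finsupp.single ((0, i) : ℕ × SymIdx n k) (1 : A) x - Finsupp.single (0, i) 1 x ∈ _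
      rw [sub_self]
      exact zero_mem _
  have hGzero : ∀ j ∈ s, ∀ x, tWeight x ≠ N → G j x = 0 := by
    rintro (x' | i) hj x hx
    · have hN : tWeight x' + 1 = N := (hs _ hj).2
      rw [hG, Sum.elim_inl, gradedConn_single, Finsupp.finsetSum_apply]
      refine Finset.sum_eq_zero fun l _ => ?_
      by_cases hl : x'.2.1 l = 0
      · rw [hl, Nat.cast_zero, mul_zero, Finsupp.single_zero, Finsupp.zero_apply]
      · rw [Finsupp.single_apply, if_neg]
        rintro rfl
        exact hx ((tWeight_nextIdx hl).trans hN)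
    · have hN : i.weight = N := (hs _ hj).2
      rw [hG, Sum.elim_inr, Finsupp.single_apply, if_neg]
      rintro rfl
      exact hx ((tWeight_zero_left i).trans hN)
  have hmem := hB.mem_maximalIdeal (y := y) (c := d) fun x => by
    rw [hyd, Finsupp.finsetSum_apply]
    by_cases hx : tWeight x = N
    · have h1 := sum_mem (S := IsLocalRing.maximalIdeal A) (t := s) fun j hj =>
        Ideal.mul_mem_left _ (c j) (hGmem j hj x hx)
      have h2 := sub_mem (hc x hx) h1
      rw [← Finset.sum_sub_distrib] at h2
      simpa only [mul_sub, sub_sub_cancel, Finsupp.smul_apply, smul_eq_mul] using h2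
    · rw [Finset.sum_eq_zero fun j hj => by
        rw [Finsupp.smul_apply, hGzero j hj x hx, smul_zero]]
      exact zero_mem _
  rintro (x | i) hj
  · have h1 := hmem.1 x
    rw [hy, Finsupp.finsetSum_apply] at h1
    simp only [Finsupp.single_apply] at h1
    rwa [Finset.sum_ite_eq', if_pos (Finset.mem_toLeft.2 hj)] at h1
  · have h1 := hmem.2 i (hs _ hj).1
    rw [hd] at h1
    simp only at h1
    rwa [if_pos (Finset.mem_toRight.2 hj)] at h1

variable [IsDomain A] (hA : IsCoeffRing ϖ)
include hA

theorem eq_zero_of_cohMap_eq_zero {x : NullFun ϖ ((ℕ × SymIdx n k) ⊕ SymIdx n k)}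
    (hx : ∀ j, j ∉ cohSupp B → x.1 j = 0) (h : cohMap D x = 0) : x = 0 := by
  refine eq_zero_of_map_eq_zero hA (wt₁ := cohWt n k) (wt₂ := tWeight) _ (cohSupp B) ?_
    (mem_maximalIdeal_of_cohMap D hD hB hA.not_isUnit) hx h
  rintro (x | i) _
  · rw [cohMap_inl]
    exact map_unitFun_mem_fil D hD x
  · rw [cohMap_inr]
    exact unitFun_mem_fil (Set.mem_univ _) (tWeight_zero_left i).le

theorem exists_cohMap_eq_of_mem_fil {N : ℕ} {x : NullFun ϖ (ℕ × SymIdx n k)}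
    (hx : x ∈ fil ϖ tWeight Set.univ N) :
    ∃ y ∈ fil ϖ (cohWt n k) (cohSupp B) N, cohMap D y = x :=
  exists_preimage_fil hA finite_tWeight_le _ _ _
    (fun x _ => exists_cohMap_sub_unitFun_mem D hD hB x) hx

theorem exists_cohMap_eq (x : NullFun ϖ (ℕ × SymIdx n k)) :
    ∃ y, (∀ j, j ∉ cohSupp B → y.1 j = 0) ∧ cohMap D y = x :=
  exists_preimage hA finite_tWeight_le _ _ Set.univ
    (fun x _ => exists_cohMap_sub_unitFun_mem D hD hB x) fun j hj => absurd (Set.mem_univ j) hj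

end Perturbation

/-! ### Coordinates on the symmetric powers -/

section SymCoordinates

variable {p a : ℕ} [Fact p.Prime] (π : DworkPi p a) {n : ℕ} (k : ℕ) (ha : 1 ≤ a)

/-- The basis of monomials `e^i` of `S_k` over `O`. -/
def symHBasis : Module.Basis (SymIdx n k) (TypeO π n) (SymH π n k) := symBasis k (eBasis π ha)

theorem symHBasis_apply (i : SymIdx n k) :
    symHBasis π k ha i = symMonomial (R := TypeO π n) (eVec π n) i := by
  rw [symHBasis, symBasis_apply, coe_eBasis]

/-- The coefficients of an element of `S_k` with respect to the `γ^{(n+1) r} t^r e^i`. -/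
def coordS : SymH π n k ≃ₗ[π.integers] NullFun (p : π.integers) (ℕ × SymIdx n k) where
  toFun x := ⟨fun y => (coordO π n ((symHBasis π k ha).repr x y.2)).1 y.1, fun m => by
    refine (Set.finite_iUnion fun i =>
      ((coordO π n ((symHBasis π k ha).repr x i)).2 m).image fun r => (r, i)).subset ?_
    rintro ⟨r, i⟩ hx
    exact Set.mem_iUnion.2 ⟨i, r, hx, rfl⟩⟩
  map_add' x y := Subtype.ext (funext fun z => by
    change (coordO π n ((symHBasis π k ha).repr (x + y) z.2)).1 z.1 = _
    rw [map_add, Finsupp.add_apply, map_add]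
    rfl)
  map_smul' c x := Subtype.ext (funext fun z => by
    have h : (c • x : SymH π n k) = algebraMap π.integers (TypeO π n) c • x :=
      (algebraMap_smul (TypeO π n) c x).symm
    change (coordO π n ((symHBasis π k ha).repr (c • x) z.2)).1 z.1 = _
    rw [h, map_smul, Finsupp.smul_apply, algebraMap_smul, map_smul]
    rfl)
  invFun f := ∑ i, (coordO π n).symm
    (NullFun.comap (fun r => (r, i)) (Prod.mk_left_injective i) f) • symHBasis π k ha i
  left_inv x := by
    conv_rhs => rw [← (symHBasis π k ha).sum_repr x]
    refine Finset.sum_congr rfl fun i _ => congrArg (· • symHBasis π k ha i) ?_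
    rw [LinearEquiv.symm_apply_eq]
    rfl
  right_inv f := Subtype.ext (funext fun z => by
    change (coordO π n ((symHBasis π k ha).repr (∑ i, (coordO π n).symm
      (NullFun.comap (fun r => (r, i)) (Prod.mk_left_injective i) f) •
        symHBasis π k ha i) z.2)).1 z.1 = _
    rw [Module.Basis.repr_sum_self, LinearEquiv.apply_symm_apply]
    rfl)

theorem coordS_apply (x : SymH π n k) (r : ℕ) (i : SymIdx n k) :
    (coordS π k ha x).1 (r, i) = (coordO π n ((symHBasis π k ha).repr x i)).1 r := rfl

theorem coordS_smul (g : TypeO π n) (i : SymIdx n k) : coordS π k ha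
    (g • symMonomial (R := TypeO π n) (eVec π n) i) =
      NullFun.extend (fun r => (r, i)) (Prod.mk_left_injective i) (coordO π n g) := by
  classical
  refine Subtype.ext (funext fun ⟨r, i'⟩ => ?_)
  rw [coordS_apply, ← symHBasis_apply π k ha, map_smul, Module.Basis.repr_self,
    Finsupp.smul_apply, Finsupp.single_apply]
  by_cases h : i = i'
  · subst h
    rw [if_pos rfl, smul_eq_mul, mul_one, NullFun.extend_apply (fun r : ℕ => (r, i))]
  · rw [if_neg h, smul_zero, map_zero, NullFun.extend_apply_of_not]
    · rfl
    · rintro ⟨r', hr'⟩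
      exact h (congrArg Prod.snd hr')

theorem coordS_tMonomial_smul (r : ℕ) (i : SymIdx n k) : coordS π k ha
    (tMonomial π n r • symMonomial (R := TypeO π n) (eVec π n) i) = unitFun _ (r, i) := by
  rw [coordS_smul, coordO_tMonomial, NullFun.extend_unitFun]

theorem coordS_symMonomial (i : SymIdx n k) : coordS π k ha
    (symMonomial (R := TypeO π n) (eVec π n) i) = unitFun _ (0, i) := by
  rw [← coordS_tMonomial_smul, tMonomial_zero, one_smul]

theorem tMonomial_mul (r s : ℕ) : tMonomial π n r * tMonomial π n s = tMonomial π n (r + s) :=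
  Subtype.ext (by
    change PowerSeries.monomial r _ * PowerSeries.monomial s _ = PowerSeries.monomial (r + s) _
    rw [PowerSeries.monomial_mul_monomial, ← pow_add, mul_add])

theorem thetaO_tMonomial (r : ℕ) :
    thetaO π n (tMonomial π n r) = (r : π.integers) • tMonomial π n r := by
  refine (coordO π n).injective (Subtype.ext (funext fun s => Subtype.ext ?_))
  rw [map_smul, coordO_tMonomial, NullFun.smul_apply]
  have h : ((coordO π n (thetaO π n (tMonomial π n r))).1 s : PadicAlgCl p) =
      s * ((coordO π n (tMonomial π n r)).1 s : PadicAlgCl p) := normCoeff_thetaPS π n _ s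
  rw [h, coordO_tMonomial]
  by_cases hs : s = r
  · rw [hs]; rfl
  · rw [unitFun_of_ne hs, mul_zero, Subring.coe_zero, mul_zero]

theorem coordO_tMonomial_mul (r : ℕ) (g : TypeO π n) (s : ℕ) :
    (coordO π n (tMonomial π n r * g)).1 s = if r ≤ s then (coordO π n g).1 (s - r) else 0 := by
  have hγ := π.gamma_ne_zero
  refine Subtype.ext ?_
  change normCoeff π n (PowerSeries.monomial r (π.gamma ^ ((n + 1) * r)) * g.1) s = _
  rw [normCoeff, PowerSeries.monomial_eq_C_mul_X_pow, mul_assoc, PowerSeries.coeff_C_mul,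
    PowerSeries.coeff_X_pow_mul']
  split_ifs with h
  · change _ = normCoeff π n g.1 (s - r)
    rw [normCoeff, div_eq_div_iff (pow_ne_zero _ hγ) (pow_ne_zero _ hγ), mul_right_comm, ← pow_add,
      ← mul_add, Nat.add_sub_cancel' h, mul_comm]
  · rw [mul_zero, zero_div]; rfl

/-- `∂` on the coefficients of the elements of `S_k`. -/
def connS : NullFun (p : π.integers) (ℕ × SymIdx n k) →ₗ[π.integers]
    NullFun (p : π.integers) (ℕ × SymIdx n k) :=
  (coordS π k ha).toLinearMap ∘ₗ symHConn π n k ∘ₗ (coordS π k ha).symm.toLinearMap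

theorem connS_coordS (x : SymH π n k) :
    connS π k ha (coordS π k ha x) = coordS π k ha (symHConn π n k x) := by
  change coordS π k ha (symHConn π n k ((coordS π k ha).symm (coordS π k ha x))) = _
  rw [LinearEquiv.symm_apply_apply]

/-- On `S_k`, the graded connection is the leading part of `∂`. -/
theorem connS_unitFun_sub_mem (x : ℕ × SymIdx n k) : connS π k ha (unitFun _ x) -
    finsuppToNull _ _ (gradedConn n k π.integers (Finsupp.single x 1)) ∈
      filStrict (p : π.integers) tWeight Set.univ (tWeight x + 1) := by
  obtain ⟨r, i⟩ := x
  obtain ⟨h, hh, he⟩ := exists_relHConn_eVec π ha (n := n)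
  -- the connection on the monomial splits into three parts
  have h1 : symHConn π n k (tMonomial π n r • symMonomial (R := TypeO π n) (eVec π n) i) =
      (r : π.integers) • tMonomial π n r • symMonomial (R := TypeO π n) (eVec π n) i +
      (∑ j, (i.1 j : π.integers) • tMonomial π n (nextIdx (r, i) j).1 •
        symMonomial (R := TypeO π n) (eVec π n) (nextIdx (r, i) j).2 +
      (p : π.integers) • ∑ j, ∑ l, (i.1 j : π.integers) • (tMonomial π n r * h l j) •
        symMonomial (R := TypeO π n) (eVec π n) (moveIdx i j l)) := by
    rw [symHConn, symConn_smul_add, thetaO_tMonomial, smul_assoc,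
      symConn_symMonomial _ _ _ _ _ he i, Finset.smul_sum, Finset.smul_sum,
      ← Finset.sum_add_distrib]
    congr 1
    refine Finset.sum_congr rfl fun j _ => ?_
    have c1 : ∀ (m : ℕ) (X : SymH π n k), (m : π.integers) • X = (m : TypeO π n) • X :=
      fun m X => by rw [← algebraMap_smul (TypeO π n) (m : π.integers) X, map_natCast]
    have c2 : ∀ g : TypeO π n, (p : π.integers) • g = (p : TypeO π n) * g := fun g => by
      rw [Algebra.smul_def, map_natCast]
    have hl : ∀ l, tMonomial π n r • ((i.1 j : TypeO π n) * ((if l = j + 1 then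
        tMonomial π n (if j = Fin.last n then 1 else 0) else 0) + (p : π.integers) • h l j)) •
          symMonomial (R := TypeO π n) (eVec π n) (moveIdx i j l) =
        (if l = j + 1 then (i.1 j : TypeO π n) • tMonomial π n (nextIdx (r, i) j).1 •
          symMonomial (R := TypeO π n) (eVec π n) (moveIdx i j l) else 0) +
        (p : TypeO π n) • (i.1 j : TypeO π n) • (tMonomial π n r * h l j) •
          symMonomial (R := TypeO π n) (eVec π n) (moveIdx i j l) := fun l => by
      rw [c2, nextIdx]
      split_ifs
      all_goals
        simp only [smul_smul, ← add_smul, zero_add, ← tMonomial_mul, tMonomial_zero]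
        congr 1
        ring
    rw [Finset.smul_sum, Finset.sum_congr rfl fun l _ => hl l, Finset.sum_add_distrib,
      Finset.sum_ite_eq', if_pos (Finset.mem_univ _), c1, c1, Finset.smul_sum]
    simp only [c1]
    rfl
  -- the part divisible by `p`
  have h2 : coordS π k ha (∑ j, ∑ l, (i.1 j : π.integers) • (tMonomial π n r * h l j) •
        symMonomial (R := TypeO π n) (eVec π n) (moveIdx i j l)) ∈
      fil (p : π.integers) tWeight Set.univ (tWeight (r, i) + 1 + 1) := by
    rw [map_sum]
    refine sum_mem fun j _ => ?_
    rw [map_sum]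
    refine sum_mem fun l _ => ?_
    rw [map_smul, coordS_smul]
    by_cases hj : i.1 j = 0
    · rw [hj, Nat.cast_zero, zero_smul]; exact zero_mem _
    refine Submodule.smul_mem _ _ ⟨fun ⟨s, i'⟩ => ?_, fun x hx => absurd (Set.mem_univ x) hx⟩
    by_cases hi' : i' = moveIdx i j l
    · subst hi'
      rw [NullFun.extend_apply (fun s : ℕ => (s, moveIdx i j l)), coordO_tMonomial_mul]
      split_ifs with hrs
      · refine (pow_dvd_pow _ ?_).trans ((hh l j).1 (s - r))
        have h3 := weight_moveIdx hj l
        obtain ⟨s, rfl⟩ := Nat.exists_eq_add_of_le hrs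
        rw [tWeight, tWeight, Nat.add_sub_cancel_left, mul_add]
        dsimp only
        omega
      · exact dvd_zero _
    · rw [NullFun.extend_apply_of_not]
      · exact dvd_zero _
      · rintro ⟨s', hs'⟩
        exact hi' (congrArg Prod.snd hs').symm
  have h3 : finsuppToNull (p : π.integers) _ (gradedConn n k π.integers
      (Finsupp.single (r, i) 1)) = ∑ j, (i.1 j : π.integers) • unitFun _ (nextIdx (r, i) j) := by
    rw [gradedConn_single, map_sum]
    refine Finset.sum_congr rfl fun j _ => ?_
    rw [← finsuppToNull_single, ← map_smul, Finsupp.smul_single, smul_eq_mul, mul_comm]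
  have h5 : coordS π k ha ((r : π.integers) • tMonomial π n r •
      symMonomial (R := TypeO π n) (eVec π n) i) = (r : π.integers) • unitFun _ (r, i) := by
    rw [map_smul, coordS_tMonomial_smul]
  rw [← coordS_tMonomial_smul π k ha, connS_coordS, h1, map_add, map_add, h5, map_sum, h3,
    (coordS π k ha).map_smul (p : π.integers)]
  have h4 : ∀ j, coordS π k ha ((i.1 j : π.integers) • tMonomial π n (nextIdx (r, i) j).1 •
      symMonomial (R := TypeO π n) (eVec π n) (nextIdx (r, i) j).2) =
        (i.1 j : π.integers) • unitFun _ (nextIdx (r, i) j) := fun j => by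
    rw [map_smul, coordS_tMonomial_smul]
  rw [Finset.sum_congr rfl fun j _ => h4 j, ← add_assoc, add_sub_right_comm, add_sub_cancel_right]
  exact add_mem (Submodule.smul_mem _ _ (fil_lt_le_filStrict _ _ (Nat.lt_succ_self _)
    (unitFun_mem_fil (Set.mem_univ _) le_rfl))) (smul_fil_mem_filStrict h2)

end SymCoordinates

/-! ### The cohomology of the symmetric powers -/

section Cohomology

variable {p a : ℕ} [Fact p.Prime] (π : DworkPi p a) {n k : ℕ} (ha : 1 ≤ a)
  {B : Finset (SymIdx n k)} (hB : IsComplement (IsLocalRing.ResidueField π.integers) B)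
include ha hB

theorem cohZero_eq_bot : CohZero (symHConn π n k) = ⊥ := by
  refine LinearMap.ker_eq_bot'.2 fun x hx => ?_
  have h := eq_zero_of_cohMap_eq_zero (connS π k ha) (connS_unitFun_sub_mem π k ha) hB
    (π.isCoeffRing ha) (x := cohPair (coordS π k ha x) 0) (fun j hj => by
      rcases j with y | i
      · exact absurd trivial hj
      · rfl) (by
      rw [cohMap_cohPair, connS_coordS, hx, map_zero, map_zero, add_zero])
  refine (coordS π k ha).map_eq_zero_iff.1 (Subtype.ext (funext fun y => ?_))
  exact congrFun (congrArg Subtype.val h) (Sum.inl y)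

omit hB in
/-- The image of `(u, c)` under `cohMap` represents `∑_i c_i e^i` in `H^1`. -/
theorem mk_coordS_symm_cohMap (y : NullFun (p : π.integers) ((ℕ × SymIdx n k) ⊕ SymIdx n k))
    (hy : ∀ i, i ∉ B → y.1 (Sum.inr i) = 0) :
    (Submodule.Quotient.mk ((coordS π k ha).symm (cohMap (connS π k ha) y)) :
      CohOne (symHConn π n k)) = ∑ i ∈ B, y.1 (Sum.inr i) •
        Submodule.Quotient.mk (symMonomial (eVec π n) i) := by
  classical
  have h1 : (coordS π k ha).symm (cohMap (connS π k ha) y) =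
      symHConn π n k ((coordS π k ha).symm (NullFun.comap Sum.inl Sum.inl_injective y)) +
        ∑ i ∈ B, y.1 (Sum.inr i) • symMonomial (R := TypeO π n) (eVec π n) i := by
    rw [LinearEquiv.symm_apply_eq, map_add, ← connS_coordS, LinearEquiv.apply_symm_apply, map_sum]
    refine congrArg (connS π k ha (NullFun.comap Sum.inl Sum.inl_injective y) + ·) ?_
    rw [LinearMap.comp_apply, ← finsuppToNull_constVec B hy (NullFun.comap Sum.inr Sum.inr_injective y) rfl, constVec,
      map_sum]
    refine Finset.sum_congr rfl fun i _ => ?_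
    rw [map_smul, coordS_symMonomial, ← finsuppToNull_single, ← map_smul, Finsupp.smul_single,
      smul_eq_mul, mul_one]
  rw [h1, Submodule.Quotient.mk_add, (Submodule.Quotient.mk_eq_zero _).2
    (LinearMap.mem_range_self (symHConn π n k) _), zero_add]
  refine (map_sum (Submodule.mkQ (LinearMap.range (symHConn π n k))) _ _).trans ?_
  exact Finset.sum_congr rfl fun i _ => map_smul (Submodule.mkQ _) _ _

theorem linearIndependent_const : LinearIndependent π.integers fun i : B =>
    (Submodule.Quotient.mk (symMonomial (R := TypeO π n) (eVec π n) (i : SymIdx n k)) :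
      CohOne (symHConn π n k)) := by
  classical
  rw [Fintype.linearIndependent_iff]
  intro g hg
  set c : NullFun (p : π.integers) (SymIdx n k) :=
    ⟨fun i => if h : i ∈ B then g ⟨i, h⟩ else 0, nullFun_of_finite (Set.toFinite _)⟩ with hc
  have hcB : ∀ i, i ∉ B → c.1 i = 0 := fun i hi => dif_neg hi
  have h1 := mk_coordS_symm_cohMap π ha (cohPair 0 c) hcB
  have h2 : ∑ i ∈ B, c.1 i • (Submodule.Quotient.mk (symMonomial (R := TypeO π n) (eVec π n) i) :
      CohOne (symHConn π n k)) = 0 := by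
    rw [← Finset.sum_coe_sort, ← hg]
    exact Finset.sum_congr rfl fun i _ => by rw [show c.1 i = g i from dif_pos i.2]
  obtain ⟨x, hx⟩ := (Submodule.Quotient.mk_eq_zero _).1 (h1.trans h2)
  rw [LinearEquiv.eq_symm_apply, ← connS_coordS, cohMap_cohPair, map_zero, zero_add] at hx
  have h3 := eq_zero_of_cohMap_eq_zero (connS π k ha) (connS_unitFun_sub_mem π k ha) hB
    (π.isCoeffRing ha) (x := cohPair (-coordS π k ha x) c) (fun j hj => by
      rcases j with y | i
      · exact absurd trivial hj
      · exact hcB i hj) (by rw [cohMap_cohPair, map_neg, hx, neg_add_cancel])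
  intro i
  have h4 := congrFun (congrArg Subtype.val h3) (Sum.inr i.1)
  exact (show c.1 i = g i from dif_pos i.2) ▸ h4

theorem span_const : ⊤ ≤ Submodule.span π.integers (Set.range fun i : B =>
    (Submodule.Quotient.mk (symMonomial (R := TypeO π n) (eVec π n) (i : SymIdx n k)) :
      CohOne (symHConn π n k))) := by
  rintro x -
  obtain ⟨ξ, rfl⟩ := Submodule.mkQ_surjective _ x
  obtain ⟨y, hy, hyx⟩ := exists_cohMap_eq (connS π k ha) (connS_unitFun_sub_mem π k ha) hB
    (π.isCoeffRing ha) (coordS π k ha ξ)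
  have h1 := mk_coordS_symm_cohMap π ha y fun i hi => hy (Sum.inr i) hi
  rw [hyx, LinearEquiv.symm_apply_apply] at h1
  rw [Submodule.mkQ_apply, h1]
  exact sum_mem fun i hi => Submodule.smul_mem _ _ (Submodule.subset_span ⟨⟨i, hi⟩, rfl⟩)

/-- The basis of `H^1` formed by the classes of the `e^i` with `i ∈ B`. -/
def cohOneBasis : Module.Basis B π.integers (CohOne (symHConn π n k)) :=
  Module.Basis.mk (linearIndependent_const π ha hB) (span_const π ha hB)

theorem cohOneBasis_apply (i : B) : cohOneBasis π ha hB i =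
    Submodule.Quotient.mk (symMonomial (R := TypeO π n) (eVec π n) (i : SymIdx n k)) :=
  Module.Basis.mk_apply _ _ i

omit hB in
theorem coordS_mem_fil_of_mem_filS {N : ℕ} {ξ : SymH π n k} (h : ξ ∈ FilS π n k N) :
    coordS π k ha ξ ∈ fil (p : π.integers) tWeight Set.univ N := by
  have hle : FilS π n k N ≤ (fil (p : π.integers) tWeight Set.univ N).comap
      (coordS π k ha).toLinearMap := by
    refine Submodule.span_le.2 ?_
    rintro _ ⟨r, i, hN, rfl⟩
    change coordS π k ha (tMonomial π n r • symMonomial (R := TypeO π n) (eVec π n) i) ∈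
      fil (p : π.integers) tWeight Set.univ N
    rw [coordS_tMonomial_smul]
    exact unitFun_mem_fil (Set.mem_univ _) hN
  exact hle h

theorem exists_const_of_mem_filS {N : ℕ} {ξ : SymH π n k} (h : ξ ∈ FilS π n k N) :
    ∃ C : SymIdx n k → π.integers,
      (∀ i ∈ B, ‖(C i : PadicAlgCl p)‖ ≤ (p : ℝ) ^ ((N : ℤ) - (i.weight : ℤ))) ∧
      (Submodule.Quotient.mk ξ : CohOne (symHConn π n k)) =
        ∑ i ∈ B, C i • Submodule.Quotient.mk (symMonomial (eVec π n) i) := by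
  obtain ⟨y, hy, hyx⟩ := exists_cohMap_eq_of_mem_fil (connS π k ha)
    (connS_unitFun_sub_mem π k ha) hB (π.isCoeffRing ha) (coordS_mem_fil_of_mem_filS π ha h)
  have h1 := mk_coordS_symm_cohMap π ha y fun i hi => hy.2 (Sum.inr i) hi
  rw [hyx, LinearEquiv.symm_apply_apply] at h1
  refine ⟨fun i => y.1 (Sum.inr i), fun i _ => ?_, h1⟩
  refine ((π.pow_dvd_iff _ _).1 (hy.1 (Sum.inr i))).trans ?_
  have hp : (1 : ℝ) ≤ p := by exact_mod_cast (Fact.out : p.Prime).one_lt.le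
  rw [inv_pow, ← zpow_natCast, ← zpow_neg]
  refine zpow_le_zpow_right₀ hp ?_
  change -((i.weight - N : ℕ) : ℤ) ≤ _
  omega

end Cohomology

end

end HyperKloosterman

open HyperKloosterman in
theorem theorem4p13 (p a n k : ℕ) [Fact p.Prime] (ha : 1 ≤ a) (hn : 1 ≤ n) (π : DworkPi p a)
    (ζ : AlgebraicClosure (ZMod p)) (hζ : IsPrimitiveRoot ζ (n + 1)) (hd : dNum n k ζ = 0) :
    CohZero (symHConn π n k) = ⊥ ∧
    (∃ B : Finset (SymIdx n k), IsConstantBasis n (IsLocalRing.ResidueField π.integers) B) ∧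
    ∀ B : Finset (SymIdx n k), IsConstantBasis n (IsLocalRing.ResidueField π.integers) B →
      (∃ b : Module.Basis B π.integers (CohOne (symHConn π n k)), ∀ i : B,
        b i = Submodule.Quotient.mk (symMonomial (eVec π n) (i : SymIdx n k))) ∧
      Module.Free π.integers (CohOne (symHConn π n k)) ∧
      (n + 1) * Module.finrank π.integers (CohOne (symHConn π n k)) = (n + k).choose n ∧
      ∀ (N : ℕ) (ξ : SymH π n k), ξ ∈ FilS π n k N →
        ∃ C : SymIdx n k → π.integers,
          (∀ i ∈ B, ‖(C i : PadicAlgCl p)‖ ≤ (p : ℝ) ^ ((N : ℤ) - (i.weight : ℤ))) ∧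
          (Submodule.Quotient.mk ξ : CohOne (symHConn π n k)) =
            ∑ i ∈ B, C i • Submodule.Quotient.mk (symMonomial (eVec π n) i) := by
  have hM := isUnit_shiftMat n k hζ hd (IsLocalRing.ResidueField π.integers)
  have hB := exists_isConstantBasis (n := n) (k := k) hM
  refine ⟨?_, hB, fun B hBc => ?_⟩
  · obtain ⟨B, hBc⟩ := hB
    exact cohZero_eq_bot π ha (hBc.isComplement hM)
  · have hBA := hBc.isComplement hM
    refine ⟨⟨cohOneBasis π ha hBA, cohOneBasis_apply π ha hBA⟩,
      Module.Free.of_basis (cohOneBasis π ha hBA), ?_, fun N ξ hξ =>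
        exists_const_of_mem_filS π ha hBA hξ⟩
    rw [Module.finrank_eq_card_basis (cohOneBasis π ha hBA), Fintype.card_coe]
    exact hBA.card_mul
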